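/- **Conventions.** Fix a field $\Bbbk$. All categories are $\Bbbk$-linear, and functors are $\Bbbk$-linear (bilinear in two variables). $[\mathcal A^{\mathrm{op}},\mathbf{Vec}_\Bbbk]$ denotes the category of $\Bbbk$-linear presheaves on a small $\Bbbk$-linear category $\mathcal A$. A *semigroup category* $\mathcal S$ is a category with a tensor product $\boxtimes$ and an associator $\mathsf a$ satisfying the pentagon axiom, without a unit. A *semigroup $\mathcal S$-module category* $\mathbf M$ is a category with an action $\star:\mathcal S\times\mathbf M\to\mathbf M$ and natural isomorphisms $(F\boxtimes G)\star X\cong F\star(G\star X)$ satisfying the pentagon axiom. Equivalences $\simeq$ of module categories are $\Bbbk$-linear equivalences $\Phi$ with coherent natural isomorphisms $\Phi(F\star X)\cong F\star\Phi(X)$. If $\mathcal S$ is monoidal, $\mathbf M$ is a *monoidal* module category if there is a natural isomorphism $\mathbb 1\star X\cong X$ satisfying the triangle axiom. An *adjunction* $(F,F^\blacklozenge,\eta^l,\eta^r,\varepsilon^l,\varepsilon^r)$ in $\mathcal S$ consists of objects $F,F^\blacklozenge$, left $\mathcal S$-module transformations $\eta^l:\mathrm{Id}\to-\boxtimes(F^\blacklozenge\boxtimes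 F)$ and $\varepsilon^l:-\boxtimes(F\boxtimes F^\blacklozenge)\to\mathrm{Id}$, and right $\mathcal S$-module transformations $\eta^r:\mathrm{Id}\to(F^\blacklozenge\boxtimes F)\boxtimes-$ and $\varepsilon^r:(F\boxtimes F^\blacklozenge)\boxtimes-\to\mathrm{Id}$, such that (up to associators) (I) $-\boxtimes F^\blacklozenge\dashv-\boxtimes F$ via $\eta^l,\varepsilon^l$; (II) $F\boxtimes-\dashv F^\blacklozenge\boxtimes-$ via $\eta^r,\varepsilon^r$; (III) $\varepsilon^r_F\circ\eta^l_F=\mathrm{id}_F$ and $\varepsilon^l_{F^\blacklozenge}\circ\eta^r_{F^\blacklozenge}=\mathrm{id}_{F^\blacklozenge}$; (IV) $\eta^l_H\boxtimes K=H\boxtimes\eta^r_K$ and $\varepsilon^l_H\boxtimes K=H\boxtimes\varepsilon^r_K$ for all $H,K\in\mathcal S$. $\mathcal S$ is *rigid* if for every object $F$ there is an adjunction with first entry $F$ and an adjunction with second entry $F$. Such an adjunction is *respected* in $\mathbf M$ if there is an adjunction of functors $(F\star-)\dashv(F^\blacklozenge\star-)$ with unit $\eta^{F,\mathbf M}$ and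 counit $\varepsilon^{F,\mathbf M}$ such that, up to coherence isomorphisms, $H\star\varepsilon^{F,\mathbf M}_X=\varepsilon^l_H\star X$ and $H\star\eta^{F,\mathbf M}_X=\eta^l_H\star X$ for all $H\in\mathcal S$, $X\in\mathbf M$. We write $\mathcal S\star\mathbf M=\mathbf M$ if every object of $\mathbf M$ is a direct summand of a finite direct sum of objects $F\star Y$ with $F\in\mathcal S$, $Y\in\mathbf M$ (the sum being formed in the additive envelope of $\mathbf M$ if it does not exist in $\mathbf M$). $\mathbf M$ is *Cauchy complete* if it has finite direct sums and its idempotents split. The category $[\mathcal S^{\mathrm{op}},\mathbf{Vec}_\Bbbk]$ is a semigroup category under Day convolution, $(P\circledast Q)(-)=\int^{H,K}\mathrm{Hom}(-,H\boxtimes K)\otimes P(H)\otimes Q(K)$, and for a small semigroup $\mathcal S$-module category $\mathbf M$, $[\mathbf M^{\mathrm{op}},\mathbf{Vec}_\Bbbk]$ is a semigroup module category over it via $(P\star N)(-)=\int^{F,X}\mathrm{Hom}(-,F\star X)\otimes P(F)\otimes N(X)$. A *module presheaf category* over $[\mathcal S^{\mathrm{op}},\mathbf{Vec}_\Bbbk]$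 is a semigroup module category $\mathbf N$ whose underlying category is $[\mathcal A^{\mathrm{op}},\mathbf{Vec}_\Bbbk]$ for some small $\mathcal A$ and whose action preserves small colimits in each variable. Restriction along the Yoneda embedding makes it a semigroup $\mathcal S$-module category. If $\mathbf N$ is monoidal, then it respects all adjunctions in $\mathcal S$, and $(\overline\varepsilon^{F,\mathbf N}_!)_F$ denotes the map whose component at $Q\in\mathbf N$ is $\coprod_{F\in\mathcal S}F\star(F^\blacklozenge\star Q)\to Q$ given by the counits $\varepsilon^{F,\mathbf N}_Q$. $\mathbf N\text{-f.g.proj}$ is the full subcategory of finitely generated projective objects, where $Q$ is finitely generated if every small jointly epimorphic family of morphisms to $Q$ has a finite jointly epimorphic subfamily. **Theorem.** Let $\mathcal S$ be a small rigid semigroup category. Then the semigroup category $[\mathcal S^{\mathrm{op}},\mathbf{Vec}_\Bbbk]$ has a unit object, i.e. it is monoidal, and for any choice of the unit structure the following hold. 1. If $\mathbf M$ is a small semigroup $\mathcal S$-module category such that $\mathcal S\star\mathbf M=\mathbf M$ and such that $\mathbf M$ respects all adjunctions in $\mathcal S$, then $[\mathbf M^{\mathrm{op}},\mathbf{Vec}_\Bbbk]$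 is a monoidal $[\mathcal S^{\mathrm{op}},\mathbf{Vec}_\Bbbk]$-module category. 2. There is a bijection $$\left\{\begin{array}{c}\text{Cauchy complete small semigroup }\mathcal S\text{-module categories }\mathbf M\\ \text{respecting all adjunctions in }\mathcal S\text{ and such that }\mathcal S\star\mathbf M=\mathbf M\end{array}\right\}\Big/\simeq\;\longleftrightarrow\;\left\{\begin{array}{c}\text{monoidal }[\mathcal S^{\mathrm{op}},\mathbf{Vec}_\Bbbk]\text{-module presheaf categories }\mathbf N\\ \text{such that }(\overline\varepsilon^{F,\mathbf N}_!)_F\text{ is an epimorphism}\end{array}\right\}\Big/\simeq$$ which sends $\mathbf M$ to $[\mathbf M^{\mathrm{op}},\mathbf{Vec}_\Bbbk]$ and whose inverse sends $\mathbf N$ to $\mathbf N\text{-f.g.proj}$; in particular, $[\mathbf M^{\mathrm{op}},\mathbf{Vec}_\Bbbk]$ belongs to the right side for $\mathbf M$ in the left side, and for $\mathbf N$ in the right side $\mathbf N\text{-f.g.proj}$ is stable under the action of $\mathcal S$ and is equivalent, as an $\mathcal S$-module category, to a member of the left side. -/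

import Mathlib

open CategoryTheory Opposite
open scoped TensorProduct

universe u v₁ w₁ v₂ w₂ v₃ w₃

noncomputable section

namespace SemigroupCat

/-! ### Presheaves of vector spaces -/

section Presheaves

variable (k : Type u) [Field k] (A : Type u) [Category.{u} A] [Preadditive A] [Linear k A]

/-- A presheaf of `k`-vector spaces on a `k`-linear category is `k`-linear if it is so on
morphism spaces. -/
structure IsLinearPresheaf (P : Aᵒᵖ ⥤ ModuleCat.{u} k) : Prop where
  map_add : ∀ {X Y : A} (f g : X ⟶ Y), P.map (f + g).op = P.map f.op + P.map g.op
  map_smul : ∀ {X Y : A} (r : k) (f : X ⟶ Y), P.map (r • f).op = r • P.map f.op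

/-- The `k`-linear category `[Aᵒᵖ, Vec_k]` of `k`-linear presheaves on `A`. -/
abbrev Psh : Type (u + 1) :=
  ObjectProperty.FullSubcategory (C := Aᵒᵖ ⥤ ModuleCat.{u} k) (IsLinearPresheaf k A)

variable {k A}

/-- The space of sections of a presheaf over an object. -/
abbrev Psh.sec (P : Psh k A) (X : A) : ModuleCat.{u} k := P.obj.obj (op X)

/-- Restriction of sections along a morphism. -/
def Psh.res (P : Psh k A) {X Y : A} (f : X ⟶ Y) : P.sec Y →ₗ[k] P.sec X := (P.obj.map f.op).hom

/-- The component at `X` of a morphism of presheaves. -/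
def Psh.app {P Q : Psh k A} (φ : P ⟶ Q) (X : A) : P.sec X →ₗ[k] Q.sec X :=
  (φ.hom.app (op X)).hom

@[simp] theorem Psh.res_id (P : Psh k A) {X : A} (p : P.sec X) : P.res (𝟙 X) p = p := by
  simp [Psh.res]

theorem Psh.res_comp (P : Psh k A) {X Y Z : A} (f : X ⟶ Y) (g : Y ⟶ Z) (p : P.sec Z) :
    P.res (f ≫ g) p = P.res f (P.res g p) := by
  simp [Psh.res]

theorem Psh.res_add (P : Psh k A) {X Y : A} (f g : X ⟶ Y) (p : P.sec Y) :
    P.res (f + g) p = P.res f p + P.res g p := by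
  simp only [Psh.res, P.property.map_add]; rfl

theorem Psh.res_smul (P : Psh k A) {X Y : A} (r : k) (f : X ⟶ Y) (p : P.sec Y) :
    P.res (r • f) p = r • P.res f p := by
  simp only [Psh.res, P.property.map_smul]; rfl

@[simp] theorem Psh.app_id (P : Psh k A) (X : A) (p : P.sec X) : Psh.app (𝟙 P) X p = p := by
  simp [Psh.app]

@[simp] theorem Psh.app_comp {P Q R : Psh k A} (φ : P ⟶ Q) (ψ : Q ⟶ R) (X : A) (p : P.sec X) :
    Psh.app (φ ≫ ψ) X p = Psh.app ψ X (Psh.app φ X p) := by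
  simp [Psh.app]

@[simp] theorem Psh.app_add {P Q : Psh k A} (φ ψ : P ⟶ Q) (X : A) (p : P.sec X) :
    Psh.app (φ + ψ) X p = Psh.app φ X p + Psh.app ψ X p := rfl

@[simp] theorem Psh.app_smul {P Q : Psh k A} (r : k) (φ : P ⟶ Q) (X : A) (p : P.sec X) :
    Psh.app (r • φ) X p = r • Psh.app φ X p := rfl

theorem Psh.app_res {P Q : Psh k A} (φ : P ⟶ Q) {X Y : A} (f : X ⟶ Y) (p : P.sec Y) :
    Psh.app φ X (P.res f p) = Q.res f (Psh.app φ Y p) := by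
  have := φ.hom.naturality f.op
  exact congrArg (fun h => h.hom p) this

theorem Psh.hom_ext {P Q : Psh k A} {φ ψ : P ⟶ Q}
    (h : ∀ X (p : P.sec X), Psh.app φ X p = Psh.app ψ X p) : φ = ψ := by
  apply ObjectProperty.hom_ext
  ext X p
  exact h X.unop p

/-- Construct a presheaf from its sections and restriction maps. -/
def Psh.ofSections (E : A → Type u) [∀ X, AddCommGroup (E X)] [∀ X, Module k (E X)]
    (r : ∀ {X Y : A}, (X ⟶ Y) → (E Y →ₗ[k] E X))
    (r_id : ∀ X, r (𝟙 X) = LinearMap.id)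
    (r_comp : ∀ {X Y Z : A} (f : X ⟶ Y) (g : Y ⟶ Z), r (f ≫ g) = r f ∘ₗ r g)
    (r_add : ∀ {X Y : A} (f g : X ⟶ Y), r (f + g) = r f + r g)
    (r_smul : ∀ {X Y : A} (c : k) (f : X ⟶ Y), r (c • f) = c • r f) : Psh k A where
  obj :=
    { obj := fun X => ModuleCat.of k (E X.unop)
      map := fun f => ModuleCat.ofHom (r f.unop)
      map_id := fun X => by
        apply ModuleCat.hom_ext; exact r_id X.unop
      map_comp := fun f g => by
        apply ModuleCat.hom_ext; exact r_comp g.unop f.unop }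
  property :=
    { map_add := fun f g => by apply ModuleCat.hom_ext; exact r_add f g
      map_smul := fun c f => by apply ModuleCat.hom_ext; exact r_smul c f }

/-- Construct a morphism of presheaves from its components. -/
def Psh.ofComponents {P Q : Psh k A} (φ : ∀ X, P.sec X →ₗ[k] Q.sec X)
    (h : ∀ {X Y : A} (f : X ⟶ Y) (p : P.sec Y), φ X (P.res f p) = Q.res f (φ Y p)) : P ⟶ Q :=
  ObjectProperty.homMk
    { app := fun X => ModuleCat.ofHom (φ X.unop)
      naturality := fun X Y f => by
        apply ModuleCat.hom_ext
        ext p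
        exact h f.unop p }

@[simp] theorem Psh.app_ofComponents {P Q : Psh k A} (φ : ∀ X, P.sec X →ₗ[k] Q.sec X) (h) (X : A)
    (p : P.sec X) : Psh.app (Psh.ofComponents (P := P) (Q := Q) φ h) X p = φ X p := rfl

/-- The Yoneda embedding `A ⥤ [Aᵒᵖ, Vec_k]`. -/
def yo : A ⥤ Psh k A where
  obj X := Psh.ofSections (fun Y => (Y ⟶ X)) (fun f => Linear.leftComp k X f)
    (fun Y => by ext; simp) (fun f g => by ext; simp) (fun f g => by ext; simp)
    (fun c f => by ext; simp)
  map {X X'} g := Psh.ofComponents (fun Y => Linear.rightComp k Y g)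
    (fun {Y _} f p => Category.assoc f (show _ ⟶ X from p) g)
  map_id X := Psh.hom_ext fun Y p => Category.comp_id (show Y ⟶ X from p)
  map_comp {X _ _} f g := Psh.hom_ext fun Y p => (Category.assoc (show Y ⟶ X from p) f g).symm

/-- A morphism `Y ⟶ X` as a section over `Y` of the presheaf represented by `X`. -/
def yoMk {X Y : A} (g : Y ⟶ X) : ((yo (k := k)).obj X).sec Y := g

theorem yo_res {X Y Z : A} (f : Z ⟶ Y) (g : Y ⟶ X) :
    ((yo (k := k)).obj X).res f (yoMk g) = yoMk (f ≫ g) := rfl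

theorem yo_app {X X' Y : A} (f : X ⟶ X') (g : Y ⟶ X) :
    Psh.app ((yo (k := k)).map f) Y (yoMk g) = yoMk (g ≫ f) := rfl

theorem yo_map_add {X X' : A} (f g : X ⟶ X') :
    (yo (k := k)).map (f + g) = yo.map f + yo.map g :=
  Psh.hom_ext fun Y p => Preadditive.comp_add Y X X' p f g

theorem yo_map_smul {X X' : A} (r : k) (f : X ⟶ X') :
    (yo (k := k)).map (r • f) = r • yo.map f :=
  Psh.hom_ext fun Y p => Linear.comp_smul Y X X' p r f

end Presheaves

/-! ### Bilinear functors and their extension to presheaves by coends -/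

/-- A functor of two variables between `k`-linear categories is `k`-bilinear, i.e. it is a
`k`-linear functor `A ⊗ B ⥤ C`. -/
structure IsBilinear (k : Type u) [Field k] {A : Type v₁} [Category.{w₁} A] [Preadditive A]
    [Linear k A] {B : Type v₂} [Category.{w₂} B] [Preadditive B] [Linear k B]
    {C : Type v₃} [Category.{w₃} C] [Preadditive C] [Linear k C] (T : A ⥤ B ⥤ C) : Prop where
  map_add_left : ∀ {X Y : A} (f g : X ⟶ Y) (Z : B),
    (T.map (f + g)).app Z = (T.map f).app Z + (T.map g).app Z
  map_smul_left : ∀ {X Y : A} (r : k) (f : X ⟶ Y) (Z : B),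
    (T.map (r • f)).app Z = r • (T.map f).app Z
  map_add_right : ∀ (X : A) {Y Z : B} (f g : Y ⟶ Z),
    (T.obj X).map (f + g) = (T.obj X).map f + (T.obj X).map g
  map_smul_right : ∀ (X : A) {Y Z : B} (r : k) (f : Y ⟶ Z),
    (T.obj X).map (r • f) = r • (T.obj X).map f

section Day

variable {k : Type u} [Field k]
  {A : Type u} [Category.{u} A] [Preadditive A] [Linear k A]
  {B : Type u} [Category.{u} B] [Preadditive B] [Linear k B]
  {C : Type u} [Category.{u} C] [Preadditive C] [Linear k C]

/-- A trilinear map from its values. -/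
def mkTrilinear {E F G V : Type u} [AddCommGroup E] [Module k E] [AddCommGroup F] [Module k F]
    [AddCommGroup G] [Module k G] [AddCommGroup V] [Module k V] (φ : E → F → G → V)
    (h₁ : ∀ x x' y z, φ (x + x') y z = φ x y z + φ x' y z)
    (h₁' : ∀ (c : k) x y z, φ (c • x) y z = c • φ x y z)
    (h₂ : ∀ x y y' z, φ x (y + y') z = φ x y z + φ x y' z)
    (h₂' : ∀ (c : k) x y z, φ x (c • y) z = c • φ x y z)
    (h₃ : ∀ x y z z', φ x y (z + z') = φ x y z + φ x y z')
    (h₃' : ∀ (c : k) x y z, φ x y (c • z) = c • φ x y z) : E →ₗ[k] F →ₗ[k] G →ₗ[k] V :=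
  LinearMap.mk₂ k (fun x y => { toFun := φ x y, map_add' := h₃ x y, map_smul' := fun c => h₃' c x y })
    (fun x x' y => by ext z; exact h₁ x x' y z) (fun c x y => by ext z; exact h₁' c x y z)
    (fun x y y' => by ext z; exact h₂ x y y' z) (fun c x y => by ext z; exact h₂' c x y z)

@[simp] theorem mkTrilinear_apply {E F G V : Type u} [AddCommGroup E] [Module k E]
    [AddCommGroup F] [Module k F] [AddCommGroup G] [Module k G] [AddCommGroup V] [Module k V]
    (φ : E → F → G → V) (h₁ h₁' h₂ h₂' h₃ h₃') (x : E) (y : F) (z : G) :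
    mkTrilinear (k := k) φ h₁ h₁' h₂ h₂' h₃ h₃' x y z = φ x y z := rfl

variable (T : A ⥤ B ⥤ C)

section

variable (P : Psh k A) (Q : Psh k B) (X : C)

/-- The direct sum `⨁ Hom(X, T(a, b)) ⊗ P(a) ⊗ Q(b)` over all pairs of objects. -/
abbrev DaySum : Type u :=
  DirectSum (A × B) fun ab =>
    (X ⟶ (T.obj ab.1).obj ab.2) ⊗[k] ((P.sec ab.1 : Type u) ⊗[k] (Q.sec ab.2 : Type u))

variable {P Q X} in
open Classical in
/-- The pure tensor `f ⊗ p ⊗ q` in the summand of index `(a, b)`. -/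
def dayPure {a : A} {b : B} (f : X ⟶ (T.obj a).obj b) (p : P.sec a) (q : Q.sec b) :
    DaySum T P Q X :=
  DirectSum.lof k (A × B) (fun ab =>
    (X ⟶ (T.obj ab.1).obj ab.2) ⊗[k] ((P.sec ab.1 : Type u) ⊗[k] (Q.sec ab.2 : Type u)))
    (a, b) (f ⊗ₜ[k] (p ⊗ₜ[k] q))

/-- The relations defining the coend. -/
def dayRel : Submodule k (DaySum T P Q X) :=
  Submodule.span k {z | ∃ (a a' : A) (b b' : B) (α : a ⟶ a') (β : b ⟶ b')
    (f : X ⟶ (T.obj a).obj b) (p : P.sec a') (q : Q.sec b'),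
    z = dayPure T (f ≫ (T.map α).app b ≫ (T.obj a').map β) p q
      - dayPure T f (P.res α p) (Q.res β q)}

/-- The coend `∫^{a, b} Hom(X, T(a, b)) ⊗ P(a) ⊗ Q(b)`. -/
abbrev DayCoend : Type u := DaySum T P Q X ⧸ dayRel T P Q X

variable {P Q X} in
/-- The class of `f ⊗ p ⊗ q` in the coend. -/
def dayMk {a : A} {b : B} (f : X ⟶ (T.obj a).obj b) (p : P.sec a) (q : Q.sec b) :
    DayCoend T P Q X :=
  (dayRel T P Q X).mkQ (dayPure T f p q)

variable {P Q X}

theorem dayMk_eq {a a' : A} {b b' : B} (α : a ⟶ a') (β : b ⟶ b')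
    (f : X ⟶ (T.obj a).obj b) (p : P.sec a') (q : Q.sec b') :
    dayMk T (f ≫ (T.map α).app b ≫ (T.obj a').map β) p q
      = dayMk T f (P.res α p) (Q.res β q) := by
  unfold dayMk
  rw [← sub_eq_zero, ← map_sub]
  simp only [Submodule.mkQ_apply, Submodule.Quotient.mk_eq_zero]
  exact Submodule.subset_span ⟨a, a', b, b', α, β, f, p, q, rfl⟩

open Classical in
/-- The universal property of the coend. -/
def dayLift {V : Type u} [AddCommGroup V] [Module k V]
    (φ : ∀ (a : A) (b : B),
      (X ⟶ (T.obj a).obj b) →ₗ[k] P.sec a →ₗ[k] Q.sec b →ₗ[k] V)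
    (hφ : ∀ (a a' : A) (b b' : B) (α : a ⟶ a') (β : b ⟶ b') (f : X ⟶ (T.obj a).obj b)
      (p : P.sec a') (q : Q.sec b'),
      φ a' b' (f ≫ (T.map α).app b ≫ (T.obj a').map β) p q
        = φ a b f (P.res α p) (Q.res β q)) :
    DayCoend T P Q X →ₗ[k] V :=
  (dayRel T P Q X).liftQ
    (DirectSum.toModule k (A × B) V fun ab =>
      TensorProduct.lift
        ((TensorProduct.uncurry (RingHom.id k) (P.sec ab.1) (Q.sec ab.2) V) ∘ₗ (φ ab.1 ab.2)))
    (by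
      unfold dayRel
      rw [Submodule.span_le]
      rintro _ ⟨a, a', b, b', α, β, f, p, q, rfl⟩
      simp only [SetLike.mem_coe, LinearMap.mem_ker, map_sub]
      rw [sub_eq_zero]
      simpa [dayPure] using hφ a a' b b' α β f p q)

@[simp] theorem dayLift_mk {V : Type u} [AddCommGroup V] [Module k V] (φ) (hφ) {a : A} {b : B}
    (f : X ⟶ (T.obj a).obj b) (p : P.sec a) (q : Q.sec b) :
    dayLift (V := V) T φ hφ (dayMk T f p q) = φ a b f p q := by
  simp [dayLift, dayMk, dayPure]

theorem dayMk_add_left {a : A} {b : B} (f f' : X ⟶ (T.obj a).obj b) (p : P.sec a)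
    (q : Q.sec b) : dayMk T (f + f') p q = dayMk T f p q + dayMk T f' p q := by
  simp [dayMk, dayPure, TensorProduct.add_tmul]

theorem dayMk_smul_left {a : A} {b : B} (c : k) (f : X ⟶ (T.obj a).obj b) (p : P.sec a)
    (q : Q.sec b) : dayMk T (c • f) p q = c • dayMk T f p q := by
  unfold dayMk dayPure
  rw [← TensorProduct.smul_tmul', map_smul, map_smul]

theorem dayMk_add_mid {a : A} {b : B} (f : X ⟶ (T.obj a).obj b) (p p' : P.sec a)
    (q : Q.sec b) : dayMk T f (p + p') q = dayMk T f p q + dayMk T f p' q := by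
  simp [dayMk, dayPure, TensorProduct.add_tmul, TensorProduct.tmul_add]

theorem dayMk_smul_mid {a : A} {b : B} (c : k) (f : X ⟶ (T.obj a).obj b) (p : P.sec a)
    (q : Q.sec b) : dayMk T f (c • p) q = c • dayMk T f p q := by
  unfold dayMk dayPure
  rw [← TensorProduct.smul_tmul', TensorProduct.tmul_smul, map_smul, map_smul]

theorem dayMk_add_right {a : A} {b : B} (f : X ⟶ (T.obj a).obj b) (p : P.sec a)
    (q q' : Q.sec b) : dayMk T f p (q + q') = dayMk T f p q + dayMk T f p q' := by
  simp [dayMk, dayPure, TensorProduct.tmul_add]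

theorem dayMk_smul_right {a : A} {b : B} (c : k) (f : X ⟶ (T.obj a).obj b) (p : P.sec a)
    (q : Q.sec b) : dayMk T f p (c • q) = c • dayMk T f p q := by
  unfold dayMk dayPure
  rw [TensorProduct.tmul_smul, TensorProduct.tmul_smul, map_smul, map_smul]

theorem day_ext {V : Type u} [AddCommGroup V] [Module k V] {φ ψ : DayCoend T P Q X →ₗ[k] V}
    (h : ∀ (a : A) (b : B) (f : X ⟶ (T.obj a).obj b) (p : P.sec a) (q : Q.sec b),
      φ (dayMk T f p q) = ψ (dayMk T f p q)) : φ = ψ := by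
  classical
  apply Submodule.linearMap_qext
  apply DirectSum.linearMap_ext
  rintro ⟨a, b⟩
  apply TensorProduct.ext'
  intro f pq
  induction pq using TensorProduct.induction_on with
  | zero => simp
  | tmul p q => exact h a b f p q
  | add x y hx hy => rw [TensorProduct.tmul_add, map_add, map_add, hx, hy]

end

variable (P : Psh k A) (Q : Psh k B)

/-- Restriction of classes in the coend along a morphism. -/
def dayRes {X Y : C} (h : X ⟶ Y) : DayCoend T P Q Y →ₗ[k] DayCoend T P Q X :=
  dayLift T
    (fun a b => mkTrilinear (fun f p q => dayMk T (h ≫ f) p q)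
      (fun f f' p q => by rw [Preadditive.comp_add, dayMk_add_left])
      (fun c f p q => by rw [Linear.comp_smul, dayMk_smul_left])
      (fun f p p' q => dayMk_add_mid T _ _ _ _)
      (fun c f p q => dayMk_smul_mid T _ _ _ _)
      (fun f p q q' => dayMk_add_right T _ _ _ _)
      (fun c f p q => dayMk_smul_right T _ _ _ _))
    (fun a a' b b' α β f p q => by
      simp only [mkTrilinear_apply, ← dayMk_eq, Category.assoc])

theorem dayRes_mk {X Y : C} (h : X ⟶ Y) {a : A} {b : B} (f : Y ⟶ (T.obj a).obj b)
    (p : P.sec a) (q : Q.sec b) : dayRes T P Q h (dayMk T f p q) = dayMk T (h ≫ f) p q := by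
  unfold dayRes
  exact dayLift_mk T _ _ f p q

/-- The presheaf `∫^{a, b} Hom(-, T(a, b)) ⊗ P(a) ⊗ Q(b)`. -/
def dayObj : Psh k C :=
  Psh.ofSections (fun X => DayCoend T P Q X) (fun {X Y} h => dayRes T P Q h)
    (fun X => day_ext T fun a b f p q => by simp [dayRes_mk])
    (fun f g => day_ext T fun a b f p q => by simp [dayRes_mk])
    (fun f g => day_ext T fun a b f p q => by simp [dayRes_mk, dayMk_add_left])
    (fun c f => day_ext T fun a b f p q => by simp [dayRes_mk, dayMk_smul_left])

variable {P Q}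

/-- The class of `f ⊗ p ⊗ q` as a section of the presheaf `dayObj T P Q`. -/
def gen {X : C} {a : A} {b : B} (f : X ⟶ (T.obj a).obj b) (p : P.sec a) (q : Q.sec b) :
    (dayObj T P Q).sec X := dayMk T f p q

theorem gen_res {X Y : C} (h : X ⟶ Y) {a : A} {b : B} (f : Y ⟶ (T.obj a).obj b)
    (p : P.sec a) (q : Q.sec b) : (dayObj T P Q).res h (gen T f p q) = gen T (h ≫ f) p q :=
  dayRes_mk T P Q h f p q

theorem gen_mid_res {X : C} {a a' : A} {b : B} (α : a ⟶ a') (f : X ⟶ (T.obj a).obj b)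
    (p : P.sec a') (q : Q.sec b) :
    gen T f (P.res α p) q = gen T (f ≫ (T.map α).app b) p q := by
  have h := dayMk_eq T α (𝟙 b) f p q
  have e : f ≫ (T.map α).app b ≫ (T.obj a').map (𝟙 b) = f ≫ (T.map α).app b := by simp
  rw [e, Psh.res_id] at h
  exact h.symm

theorem gen_right_res {X : C} {a : A} {b b' : B} (β : b ⟶ b') (f : X ⟶ (T.obj a).obj b)
    (p : P.sec a) (q : Q.sec b') :
    gen T f p (Q.res β q) = gen T (f ≫ (T.obj a).map β) p q := by
  have h := dayMk_eq T (𝟙 a) β f p q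
  have e : f ≫ (T.map (𝟙 a)).app b ≫ (T.obj a).map β = f ≫ (T.obj a).map β := by simp
  rw [e, Psh.res_id] at h
  exact h.symm

theorem gen_add_left {X : C} {a : A} {b : B} (f f' : X ⟶ (T.obj a).obj b) (p : P.sec a)
    (q : Q.sec b) : gen T (f + f') p q = gen T f p q + gen T f' p q := dayMk_add_left T _ _ _ _

theorem gen_smul_left {X : C} {a : A} {b : B} (c : k) (f : X ⟶ (T.obj a).obj b) (p : P.sec a)
    (q : Q.sec b) : gen T (c • f) p q = c • gen T f p q := dayMk_smul_left T _ _ _ _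

theorem gen_add_mid {X : C} {a : A} {b : B} (f : X ⟶ (T.obj a).obj b) (p p' : P.sec a)
    (q : Q.sec b) : gen T f (p + p') q = gen T f p q + gen T f p' q := dayMk_add_mid T _ _ _ _

theorem gen_smul_mid {X : C} {a : A} {b : B} (c : k) (f : X ⟶ (T.obj a).obj b) (p : P.sec a)
    (q : Q.sec b) : gen T f (c • p) q = c • gen T f p q := dayMk_smul_mid T _ _ _ _

theorem gen_add_right {X : C} {a : A} {b : B} (f : X ⟶ (T.obj a).obj b) (p : P.sec a)
    (q q' : Q.sec b) : gen T f p (q + q') = gen T f p q + gen T f p q' := dayMk_add_right T _ _ _ _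

theorem gen_smul_right {X : C} {a : A} {b : B} (c : k) (f : X ⟶ (T.obj a).obj b) (p : P.sec a)
    (q : Q.sec b) : gen T f p (c • q) = c • gen T f p q := dayMk_smul_right T _ _ _ _

theorem gen_ext {X : C} {V : Type u} [AddCommGroup V] [Module k V]
    {φ ψ : (dayObj T P Q).sec X →ₗ[k] V}
    (h : ∀ (a : A) (b : B) (f : X ⟶ (T.obj a).obj b) (p : P.sec a) (q : Q.sec b),
      φ (gen T f p q) = ψ (gen T f p q)) : φ = ψ := day_ext T h

/-- The linear map out of the sections of `dayObj T P Q` defined by a family of trilinear maps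
that is compatible with restriction. -/
def desc {X : C} {V : Type u} [AddCommGroup V] [Module k V]
    (φ : ∀ (a : A) (b : B), (X ⟶ (T.obj a).obj b) → P.sec a → Q.sec b → V)
    (h₁ : ∀ a b f f' p q, φ a b (f + f') p q = φ a b f p q + φ a b f' p q)
    (h₁' : ∀ a b (c : k) f p q, φ a b (c • f) p q = c • φ a b f p q)
    (h₂ : ∀ a b f p p' q, φ a b f (p + p') q = φ a b f p q + φ a b f p' q)
    (h₂' : ∀ a b (c : k) f p q, φ a b f (c • p) q = c • φ a b f p q)
    (h₃ : ∀ a b f p q q', φ a b f p (q + q') = φ a b f p q + φ a b f p q')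
    (h₃' : ∀ a b (c : k) f p q, φ a b f p (c • q) = c • φ a b f p q)
    (h₄ : ∀ a a' b (α : a ⟶ a') f p q, φ a' b (f ≫ (T.map α).app b) p q = φ a b f (P.res α p) q)
    (h₅ : ∀ a b b' (β : b ⟶ b') f p q, φ a b' (f ≫ (T.obj a).map β) p q = φ a b f p (Q.res β q)) :
    (dayObj T P Q).sec X →ₗ[k] V :=
  dayLift T (fun a b => mkTrilinear (φ a b) (h₁ a b) (h₁' a b) (h₂ a b) (h₂' a b) (h₃ a b)
    (h₃' a b)) (fun a a' b b' α β f p q => by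
      simp only [mkTrilinear_apply]
      rw [← h₄, ← h₅]
      simp)

theorem desc_gen {X : C} {V : Type u} [AddCommGroup V] [Module k V] (φ) (h₁ h₁' h₂ h₂' h₃ h₃' h₄ h₅)
    {a : A} {b : B} (f : X ⟶ (T.obj a).obj b) (p : P.sec a) (q : Q.sec b) :
    desc (V := V) T φ h₁ h₁' h₂ h₂' h₃ h₃' h₄ h₅ (gen T f p q) = φ a b f p q := by
  unfold desc gen
  exact dayLift_mk T _ _ f p q

attribute [irreducible] dayObj gen desc

/-- The morphism out of `dayObj T P Q` defined by a compatible family of trilinear maps. -/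
def descHom {R : Psh k C}
    (φ : ∀ (X : C) (a : A) (b : B), (X ⟶ (T.obj a).obj b) → P.sec a → Q.sec b → R.sec X)
    (h₁ : ∀ X a b f f' p q, φ X a b (f + f') p q = φ X a b f p q + φ X a b f' p q)
    (h₁' : ∀ X a b (c : k) f p q, φ X a b (c • f) p q = c • φ X a b f p q)
    (h₂ : ∀ X a b f p p' q, φ X a b f (p + p') q = φ X a b f p q + φ X a b f p' q)
    (h₂' : ∀ X a b (c : k) f p q, φ X a b f (c • p) q = c • φ X a b f p q)
    (h₃ : ∀ X a b f p q q', φ X a b f p (q + q') = φ X a b f p q + φ X a b f p q')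
    (h₃' : ∀ X a b (c : k) f p q, φ X a b f p (c • q) = c • φ X a b f p q)
    (h₄ : ∀ X a a' b (α : a ⟶ a') f p q,
      φ X a' b (f ≫ (T.map α).app b) p q = φ X a b f (P.res α p) q)
    (h₅ : ∀ X a b b' (β : b ⟶ b') f p q,
      φ X a b' (f ≫ (T.obj a).map β) p q = φ X a b f p (Q.res β q))
    (h₆ : ∀ X Y a b (h : X ⟶ Y) f p q, φ X a b (h ≫ f) p q = R.res h (φ Y a b f p q)) :
    dayObj T P Q ⟶ R :=
  Psh.ofComponents
    (fun X => desc T (φ X) (h₁ X) (h₁' X) (h₂ X) (h₂' X) (h₃ X) (h₃' X) (h₄ X) (h₅ X))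
    (fun {X Y} h => LinearMap.congr_fun
      (f := desc T (φ X) (h₁ X) (h₁' X) (h₂ X) (h₂' X) (h₃ X) (h₃' X) (h₄ X) (h₅ X) ∘ₗ
        (dayObj T P Q).res h)
      (g := R.res h ∘ₗ
        desc T (φ Y) (h₁ Y) (h₁' Y) (h₂ Y) (h₂' Y) (h₃ Y) (h₃' Y) (h₄ Y) (h₅ Y))
      (gen_ext T fun a b f p q => by
        simp only [LinearMap.comp_apply, gen_res, desc_gen, h₆]))

theorem descHom_gen {R : Psh k C} (φ h₁ h₁' h₂ h₂' h₃ h₃' h₄ h₅ h₆) {X : C} {a : A} {b : B}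
    (f : X ⟶ (T.obj a).obj b) (p : P.sec a) (q : Q.sec b) :
    Psh.app (descHom (R := R) T φ h₁ h₁' h₂ h₂' h₃ h₃' h₄ h₅ h₆) X (gen T f p q)
      = φ X a b f p q := by
  unfold descHom
  rw [Psh.app_ofComponents, desc_gen]

/-- The action of morphisms of presheaves on `dayObj`. -/
def dayMap {P' : Psh k A} {Q' : Psh k B} (φ : P ⟶ P') (ψ : Q ⟶ Q') :
    dayObj T P Q ⟶ dayObj T P' Q' :=
  descHom T (fun X a b f p q => gen T f (Psh.app φ a p) (Psh.app ψ b q))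
    (fun X a b f f' p q => gen_add_left T _ _ _ _)
    (fun X a b c f p q => gen_smul_left T _ _ _ _)
    (fun X a b f p p' q => by rw [map_add, gen_add_mid])
    (fun X a b c f p q => by rw [map_smul, gen_smul_mid])
    (fun X a b f p q q' => by rw [map_add, gen_add_right])
    (fun X a b c f p q => by rw [map_smul, gen_smul_right])
    (fun X a a' b α f p q => by rw [Psh.app_res, gen_mid_res])
    (fun X a b b' β f p q => by rw [Psh.app_res, gen_right_res])
    (fun X Y a b h f p q => by rw [gen_res])

theorem dayMap_gen {P' : Psh k A} {Q' : Psh k B} (φ : P ⟶ P') (ψ : Q ⟶ Q') {X : C} {a : A} {b : B}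
    (f : X ⟶ (T.obj a).obj b) (p : P.sec a) (q : Q.sec b) :
    Psh.app (dayMap T φ ψ) X (gen T f p q) = gen T f (Psh.app φ a p) (Psh.app ψ b q) := by
  unfold dayMap
  rw [descHom_gen]

theorem dayObj_hom_ext {R : Psh k C} {φ ψ : dayObj T P Q ⟶ R}
    (h : ∀ (X : C) (a : A) (b : B) (f : X ⟶ (T.obj a).obj b) (p : P.sec a) (q : Q.sec b),
      Psh.app φ X (gen T f p q) = Psh.app ψ X (gen T f p q)) : φ = ψ :=
  Psh.hom_ext fun X => LinearMap.congr_fun (gen_ext T fun a b f p q => h X a b f p q)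

/-- The extension of `T : A ⥤ B ⥤ C` to a functor of two variables on presheaves,
`(P, Q) ↦ ∫^{a, b} Hom(-, T(a, b)) ⊗ P(a) ⊗ Q(b)`. -/
def day : Psh k A ⥤ Psh k B ⥤ Psh k C where
  obj P :=
    { obj := fun Q => dayObj T P Q
      map := fun ψ => dayMap T (𝟙 P) ψ
      map_id := fun Q => dayObj_hom_ext T fun X a b f p q => by simp [dayMap_gen]
      map_comp := fun ψ ψ' => dayObj_hom_ext T fun X a b f p q => by simp [dayMap_gen] }
  map φ :=
    { app := fun Q => dayMap T φ (𝟙 Q)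
      naturality := fun Q Q' ψ => dayObj_hom_ext T fun X a b f p q => by simp [dayMap_gen] }
  map_id P := by
    ext Q : 2
    exact dayObj_hom_ext T fun X a b f p q => by simp [dayMap_gen]
  map_comp φ φ' := by
    ext Q : 2
    exact dayObj_hom_ext T fun X a b f p q => by simp [dayMap_gen]

theorem day_isBilinear : IsBilinear k (day (k := k) T) where
  map_add_left f g Z := by
    change dayMap T (f + g) (𝟙 Z) = dayMap T f (𝟙 Z) + dayMap T g (𝟙 Z)
    refine dayObj_hom_ext T fun X a b h p q => ?_
    rw [Psh.app_add, dayMap_gen, dayMap_gen, dayMap_gen, Psh.app_add, gen_add_mid]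
  map_smul_left r f Z := by
    change dayMap T (r • f) (𝟙 Z) = r • dayMap T f (𝟙 Z)
    refine dayObj_hom_ext T fun X a b h p q => ?_
    rw [Psh.app_smul, dayMap_gen, dayMap_gen, Psh.app_smul, gen_smul_mid]
  map_add_right Z _ _ f g := by
    change dayMap T (𝟙 Z) (f + g) = dayMap T (𝟙 Z) f + dayMap T (𝟙 Z) g
    refine dayObj_hom_ext T fun X a b h p q => ?_
    rw [Psh.app_add, dayMap_gen, dayMap_gen, dayMap_gen, Psh.app_add, gen_add_right]
  map_smul_right Z _ _ r f := by
    change dayMap T (𝟙 Z) (r • f) = r • dayMap T (𝟙 Z) f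
    refine dayObj_hom_ext T fun X a b h p q => ?_
    rw [Psh.app_smul, dayMap_gen, dayMap_gen, Psh.app_smul, gen_smul_right]

theorem gen_gen_right {D : Type u} [Category.{u} D] [Preadditive D] [Linear k D]
    (T' : D ⥤ C ⥤ B) {R : Psh k D} {N : Psh k C} {X : C} {a : A} {b : B}
    (f : X ⟶ (T.obj a).obj b) (p : P.sec a) {d : D} {c : C} (g : b ⟶ (T'.obj d).obj c)
    (r : R.sec d) (n : N.sec c) :
    gen T f p (gen T' g r n) = gen T (f ≫ (T.obj a).map g) p (gen T' (𝟙 _) r n) := by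
  rw [← gen_right_res, gen_res, Category.comp_id]

theorem gen_gen_left {D E : Type u} [Category.{u} D] [Preadditive D] [Linear k D]
    [Category.{u} E] [Preadditive E] [Linear k E]
    (T' : D ⥤ E ⥤ A) {R : Psh k D} {N : Psh k E} {X : C} {a : A} {b : B}
    (f : X ⟶ (T.obj a).obj b) {d : D} {e : E} (g : a ⟶ (T'.obj d).obj e)
    (r : R.sec d) (n : N.sec e) (q : Q.sec b) :
    gen T f (gen T' g r n) q = gen T (f ≫ (T.map g).app b) (gen T' (𝟙 _) r n) q := by
  rw [← gen_mid_res, gen_res, Category.comp_id]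

theorem dayObj_hom_ext₂ {D E : Type u} [Category.{u} D] [Preadditive D] [Linear k D]
    [Category.{u} E] [Preadditive E] [Linear k E]
    (T' : D ⥤ E ⥤ A) {P : Psh k D} {Q : Psh k E} {N : Psh k B} {R : Psh k C}
    {φ ψ : dayObj T (dayObj T' P Q) N ⟶ R}
    (h : ∀ (X : C) (a : A) (b : B) (f : X ⟶ (T.obj a).obj b) (d : D) (e : E)
      (g : a ⟶ (T'.obj d).obj e) (p : P.sec d) (q : Q.sec e) (n : N.sec b),
      Psh.app φ X (gen T f (gen T' g p q) n) = Psh.app ψ X (gen T f (gen T' g p q) n)) :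
    φ = ψ :=
  dayObj_hom_ext T fun X a b f t n => LinearMap.congr_fun
    (f := Psh.app φ X ∘ₗ
      { toFun := fun t => gen T f t n
        map_add' := fun _ _ => gen_add_mid T _ _ _ _
        map_smul' := fun _ _ => gen_smul_mid T _ _ _ _ })
    (g := Psh.app ψ X ∘ₗ
      { toFun := fun t => gen T f t n
        map_add' := fun _ _ => gen_add_mid T _ _ _ _
        map_smul' := fun _ _ => gen_smul_mid T _ _ _ _ })
    (gen_ext T' fun d e g p q => h X a b f d e g p q n) t

theorem dayObj_hom_ext₂' {D E : Type u} [Category.{u} D] [Preadditive D] [Linear k D]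
    [Category.{u} E] [Preadditive E] [Linear k E]
    (T' : D ⥤ E ⥤ B) {P : Psh k D} {Q : Psh k E} {N : Psh k A} {R : Psh k C}
    {φ ψ : dayObj T N (dayObj T' P Q) ⟶ R}
    (h : ∀ (X : C) (a : A) (b : B) (f : X ⟶ (T.obj a).obj b) (d : D) (e : E)
      (g : b ⟶ (T'.obj d).obj e) (p : P.sec d) (q : Q.sec e) (n : N.sec a),
      Psh.app φ X (gen T f n (gen T' g p q)) = Psh.app ψ X (gen T f n (gen T' g p q))) :
    φ = ψ :=
  dayObj_hom_ext T fun X a b f n t => LinearMap.congr_fun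
    (f := Psh.app φ X ∘ₗ
      { toFun := fun t => gen T f n t
        map_add' := fun _ _ => gen_add_right T _ _ _ _
        map_smul' := fun _ _ => gen_smul_right T _ _ _ _ })
    (g := Psh.app ψ X ∘ₗ
      { toFun := fun t => gen T f n t
        map_add' := fun _ _ => gen_add_right T _ _ _ _
        map_smul' := fun _ _ => gen_smul_right T _ _ _ _ })
    (gen_ext T' fun d e g p q => h X a b f d e g p q n) t

theorem dayObj_hom_ext₃ {D E D' E' : Type u} [Category.{u} D] [Preadditive D] [Linear k D]
    [Category.{u} E] [Preadditive E] [Linear k E] [Category.{u} D'] [Preadditive D'] [Linear k D']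
    [Category.{u} E'] [Preadditive E'] [Linear k E']
    (T' : D ⥤ E ⥤ A) (T'' : D' ⥤ E' ⥤ D)
    {P : Psh k D'} {Q : Psh k E'} {L : Psh k E} {N : Psh k B} {R : Psh k C}
    {φ ψ : dayObj T (dayObj T' (dayObj T'' P Q) L) N ⟶ R}
    (h : ∀ (X : C) (a : A) (b : B) (f : X ⟶ (T.obj a).obj b) (d : D) (e : E)
      (g : a ⟶ (T'.obj d).obj e) (d' : D') (e' : E') (g' : d ⟶ (T''.obj d').obj e')
      (p : P.sec d') (q : Q.sec e') (l : L.sec e) (n : N.sec b),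
      Psh.app φ X (gen T f (gen T' g (gen T'' g' p q) l) n) =
        Psh.app ψ X (gen T f (gen T' g (gen T'' g' p q) l) n)) :
    φ = ψ :=
  dayObj_hom_ext₂ T T' fun X a b f d e g t l n => LinearMap.congr_fun
    (f := Psh.app φ X ∘ₗ
      { toFun := fun t => gen T f (gen T' g t l) n
        map_add' := fun _ _ => by rw [gen_add_mid, gen_add_mid]
        map_smul' := fun _ _ => by rw [gen_smul_mid, gen_smul_mid]; rfl })
    (g := Psh.app ψ X ∘ₗ
      { toFun := fun t => gen T f (gen T' g t l) n
        map_add' := fun _ _ => by rw [gen_add_mid, gen_add_mid]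
        map_smul' := fun _ _ => by rw [gen_smul_mid, gen_smul_mid]; rfl })
    (gen_ext T'' fun d' e' g' p q => h X a b f d e g d' e' g' p q l n) t

/-- A section of a representable presheaf as a morphism. -/
def yoHom {X Y : A} (u : ((yo (k := k)).obj X).sec Y) : Y ⟶ X := u

theorem yoMk_hom {X Y : A} (u : ((yo (k := k)).obj X).sec Y) : yoMk (yoHom u) = u := rfl

theorem yoHom_mk {X Y : A} (g : Y ⟶ X) : yoHom (yoMk (k := k) g) = g := rfl

theorem yoHom_add {X Y : A} (u v : ((yo (k := k)).obj X).sec Y) :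
    yoHom (u + v) = yoHom u + yoHom v := rfl

theorem yoHom_smul {X Y : A} (c : k) (u : ((yo (k := k)).obj X).sec Y) :
    yoHom (c • u) = c • yoHom u := rfl

theorem yoHom_res {X Y Z : A} (f : Z ⟶ Y) (u : ((yo (k := k)).obj X).sec Y) :
    yoHom (((yo (k := k)).obj X).res f u) = f ≫ yoHom u := rfl

theorem yoHom_app {X X' Y : A} (f : X ⟶ X') (u : ((yo (k := k)).obj X).sec Y) :
    yoHom (Psh.app ((yo (k := k)).map f) Y u) = yoHom u ≫ f := rfl

variable {T}

/-- The canonical map from the presheaf represented by `T(a, b)`. -/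
def yoToDay (T : A ⥤ B ⥤ C) (a : A) (b : B) :
    (yo (k := k)).obj ((T.obj a).obj b) ⟶ dayObj T (yo.obj a) (yo.obj b) :=
  Psh.ofComponents
    (fun X =>
      { toFun := fun g => gen T (yoHom g) (yoMk (𝟙 a)) (yoMk (𝟙 b))
        map_add' := fun g g' => by rw [yoHom_add, gen_add_left]
        map_smul' := fun c g => by rw [yoHom_smul, gen_smul_left]; rfl })
    (fun {X Y} f p => by
      change gen T (yoHom _) _ _ = Psh.res _ f (gen T (yoHom p) _ _)
      rw [gen_res, yoHom_res])

theorem yoToDay_app (a : A) (b : B) {X : C} (g : X ⟶ (T.obj a).obj b) :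
    Psh.app (yoToDay (k := k) T a b) X (yoMk g) = gen T g (yoMk (𝟙 a)) (yoMk (𝟙 b)) := rfl

/-- The canonical map to the presheaf represented by `T(a, b)`. -/
def dayToYo (hT : IsBilinear k T) (a : A) (b : B) :
    dayObj T (yo.obj a) (yo.obj b) ⟶ (yo (k := k)).obj ((T.obj a).obj b) :=
  descHom T (fun X a' b' f u v => yoMk (f ≫ (T.map (yoHom u)).app b' ≫ (T.obj a).map (yoHom v)))
    (fun X a b f f' p q => by rw [Preadditive.add_comp]; rfl)
    (fun X a b c f p q => by rw [Linear.smul_comp]; rfl)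
    (fun X a' b' f p p' q => by
      rw [yoHom_add, hT.map_add_left, Preadditive.add_comp, Preadditive.comp_add]; rfl)
    (fun X a' b' c f p q => by
      rw [yoHom_smul, hT.map_smul_left, Linear.smul_comp, Linear.comp_smul]; rfl)
    (fun X a' b' f p q q' => by
      rw [yoHom_add, hT.map_add_right, Preadditive.comp_add, Preadditive.comp_add]; rfl)
    (fun X a' b' c f p q => by
      rw [yoHom_smul, hT.map_smul_right, Linear.comp_smul, Linear.comp_smul]; rfl)
    (fun X a a' b α f p q => by
      rw [yoHom_res, Functor.map_comp, NatTrans.comp_app, Category.assoc, Category.assoc])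
    (fun X a' b b' β f p q => by
      rw [yoHom_res, Functor.map_comp, Category.assoc, NatTrans.naturality_assoc])
    (fun X Y a b h f p q => by rw [yo_res, Category.assoc])

theorem dayToYo_gen (hT : IsBilinear k T) {a a' : A} {b b' : B} {X : C}
    (f : X ⟶ (T.obj a').obj b') (u : a' ⟶ a) (v : b' ⟶ b) :
    Psh.app (dayToYo (k := k) hT a b) X (gen T f (yoMk u) (yoMk v))
      = yoMk (f ≫ (T.map u).app b' ≫ (T.obj a).map v) := by
  unfold dayToYo
  rw [descHom_gen]; rfl

/-- On representable presheaves, the extension `day T` is given by `T`. -/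
def yoDay (hT : IsBilinear k T) (a : A) (b : B) :
    (yo (k := k)).obj ((T.obj a).obj b) ≅ dayObj T (yo.obj a) (yo.obj b) where
  hom := yoToDay T a b
  inv := dayToYo hT a b
  hom_inv_id := Psh.hom_ext fun X g => by
    rw [Psh.app_comp, Psh.app_id, ← yoMk_hom g, yoToDay_app, dayToYo_gen]
    exact congrArg yoMk (by simp)
  inv_hom_id := dayObj_hom_ext T fun X a' b' f p q => by
    rw [Psh.app_comp, Psh.app_id, ← yoMk_hom p, ← yoMk_hom q, dayToYo_gen,
      yoToDay_app, ← Category.assoc, ← gen_right_res, ← gen_mid_res, yo_res, yo_res]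
    simp only [Category.comp_id, yoMk_hom]

end Day

/-! ### Semigroup categories and their module categories -/

section Semigroup

variable (k : Type u) [Field k]

/-- A semigroup category: a `k`-linear category with a `k`-bilinear tensor product and an
associator satisfying the pentagon axiom, but without a unit object. -/
class SemigroupCategory (S : Type v₁) [Category.{w₁} S] [Preadditive S] [Linear k S] where
  /-- the tensor product -/
  tensor : S ⥤ S ⥤ S
  bilinear : IsBilinear k tensor
  /-- the associator -/
  assoc : ∀ F G H : S, (tensor.obj ((tensor.obj F).obj G)).obj H ≅
    (tensor.obj F).obj ((tensor.obj G).obj H)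
  assoc_nat₁ : ∀ {F F' : S} (f : F ⟶ F') (G H : S),
    (tensor.map ((tensor.map f).app G)).app H ≫ (assoc F' G H).hom =
      (assoc F G H).hom ≫ (tensor.map f).app ((tensor.obj G).obj H)
  assoc_nat₂ : ∀ (F : S) {G G' : S} (g : G ⟶ G') (H : S),
    (tensor.map ((tensor.obj F).map g)).app H ≫ (assoc F G' H).hom =
      (assoc F G H).hom ≫ (tensor.obj F).map ((tensor.map g).app H)
  assoc_nat₃ : ∀ (F G : S) {H H' : S} (h : H ⟶ H'),
    (tensor.obj ((tensor.obj F).obj G)).map h ≫ (assoc F G H').hom =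
      (assoc F G H).hom ≫ (tensor.obj F).map ((tensor.obj G).map h)
  pentagon : ∀ F G H K : S,
    (tensor.map (assoc F G H).hom).app K ≫ (assoc F ((tensor.obj G).obj H) K).hom ≫
        (tensor.obj F).map (assoc G H K).hom =
      (assoc ((tensor.obj F).obj G) H K).hom ≫ (assoc F G ((tensor.obj H).obj K)).hom

open SemigroupCategory

/-- The structure of a (left) semigroup `S`-module category on a `k`-linear category `M`. -/
structure SemigroupModule (S : Type v₁) [Category.{w₁} S] [Preadditive S] [Linear k S]
    [SemigroupCategory k S] (M : Type v₂) [Category.{w₂} M] [Preadditive M] [Linear k M] where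
  /-- the action, written `F ⋆ X` in comments -/
  act : S ⥤ M ⥤ M
  bilinear : IsBilinear k act
  /-- the isomorphism `(F ⊠ G) ⋆ X ≅ F ⋆ (G ⋆ X)` -/
  assoc : ∀ (F G : S) (X : M), (act.obj (((tensor k).obj F).obj G)).obj X ≅
    (act.obj F).obj ((act.obj G).obj X)
  assoc_nat₁ : ∀ {F F' : S} (f : F ⟶ F') (G : S) (X : M),
    (act.map (((tensor k).map f).app G)).app X ≫ (assoc F' G X).hom =
      (assoc F G X).hom ≫ (act.map f).app ((act.obj G).obj X)
  assoc_nat₂ : ∀ (F : S) {G G' : S} (g : G ⟶ G') (X : M),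
    (act.map (((tensor k).obj F).map g)).app X ≫ (assoc F G' X).hom =
      (assoc F G X).hom ≫ (act.obj F).map ((act.map g).app X)
  assoc_nat₃ : ∀ (F G : S) {X X' : M} (h : X ⟶ X'),
    (act.obj (((tensor k).obj F).obj G)).map h ≫ (assoc F G X').hom =
      (assoc F G X).hom ≫ (act.obj F).map ((act.obj G).map h)
  pentagon : ∀ (F G H : S) (X : M),
    (act.map (SemigroupCategory.assoc (k := k) F G H).hom).app X ≫
        (assoc F (((tensor k).obj G).obj H) X).hom ≫ (act.obj F).map (assoc G H X).hom =
      (assoc (((tensor k).obj F).obj G) H X).hom ≫ (assoc F G ((act.obj H).obj X)).hom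

/-- A semigroup category as a module category over itself. -/
def SemigroupModule.regular (S : Type v₁) [Category.{w₁} S] [Preadditive S] [Linear k S]
    [SemigroupCategory k S] : SemigroupModule k S S where
  act := tensor k
  bilinear := SemigroupCategory.bilinear
  assoc := SemigroupCategory.assoc
  assoc_nat₁ := SemigroupCategory.assoc_nat₁
  assoc_nat₂ := SemigroupCategory.assoc_nat₂
  assoc_nat₃ := SemigroupCategory.assoc_nat₃
  pentagon := SemigroupCategory.pentagon

end Semigroup

section DayAssoc

open SemigroupCategory

variable {k : Type u} [Field k]
  {S : Type u} [Category.{u} S] [Preadditive S] [Linear k S] [SemigroupCategory k S]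
  {M : Type u} [Category.{u} M] [Preadditive M] [Linear k M] (σ : SemigroupModule k S M)

section

variable (P Q : Psh k S) (N : Psh k M)

/-- For fixed `f`, `n`, the map `[g, p, q] ↦ [f', p, [𝟙, q, n]]`. -/
def assocAux (X : M) (L : S) (Z : M) (f : X ⟶ (σ.act.obj L).obj Z) (n : N.sec Z) :
    (dayObj (tensor k) P Q).sec L →ₗ[k] (dayObj σ.act P (dayObj σ.act Q N)).sec X :=
  desc (tensor k)
    (fun H K g p q => gen σ.act (f ≫ (σ.act.map g).app Z ≫ (σ.assoc H K Z).hom) p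
      (gen σ.act (𝟙 _) q n))
    (fun H K g g' p q => by
      rw [σ.bilinear.map_add_left, Preadditive.add_comp, Preadditive.comp_add, gen_add_left])
    (fun H K c g p q => by
      rw [σ.bilinear.map_smul_left, Linear.smul_comp, Linear.comp_smul, gen_smul_left])
    (fun H K g p p' q => gen_add_mid ..)
    (fun H K c g p q => gen_smul_mid ..)
    (fun H K g p q q' => by rw [gen_add_mid, gen_add_right])
    (fun H K c g p q => by rw [gen_smul_mid, gen_smul_right])
    (fun H H' K α g p q => by
      rw [gen_mid_res]
      simp only [Functor.map_comp, NatTrans.comp_app, Category.assoc, σ.assoc_nat₁])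
    (fun H K K' β g p q => by
      rw [gen_mid_res, Category.id_comp, gen_gen_right σ.act σ.act _ p ((σ.act.map β).app Z)]
      simp only [Functor.map_comp, NatTrans.comp_app, Category.assoc, σ.assoc_nat₂])

theorem assocAux_gen (X : M) (L : S) (Z : M) (f : X ⟶ (σ.act.obj L).obj Z) (n : N.sec Z)
    {H K : S} (g : L ⟶ ((tensor k).obj H).obj K) (p : P.sec H) (q : Q.sec K) :
    assocAux σ P Q N X L Z f n (gen (tensor k) g p q) =
      gen σ.act (f ≫ (σ.act.map g).app Z ≫ (σ.assoc H K Z).hom) p (gen σ.act (𝟙 _) q n) := by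
  unfold assocAux
  rw [desc_gen]

/-- The associator, `[f, [g, p, q], n] ↦ [f', p, [𝟙, q, n]]`. -/
def assocHom : dayObj σ.act (dayObj (tensor k) P Q) N ⟶ dayObj σ.act P (dayObj σ.act Q N) :=
  descHom σ.act (fun X L Z f t n => assocAux σ P Q N X L Z f n t)
    (fun X L Z f f' t n => LinearMap.congr_fun
      (f := assocAux σ P Q N X L Z (f + f') n)
      (g := assocAux σ P Q N X L Z f n + assocAux σ P Q N X L Z f' n)
      (gen_ext _ fun H K g p q => by
        simp only [LinearMap.add_apply, assocAux_gen, Preadditive.add_comp, gen_add_left]) t)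
    (fun X L Z c f t n => LinearMap.congr_fun
      (f := assocAux σ P Q N X L Z (c • f) n)
      (g := c • assocAux σ P Q N X L Z f n)
      (gen_ext _ fun H K g p q => by
        simp only [LinearMap.smul_apply, assocAux_gen, Linear.smul_comp, gen_smul_left]) t)
    (fun X L Z f t t' n => map_add _ _ _)
    (fun X L Z c f t n => map_smul _ _ _)
    (fun X L Z f t n n' => LinearMap.congr_fun
      (f := assocAux σ P Q N X L Z f (n + n'))
      (g := assocAux σ P Q N X L Z f n + assocAux σ P Q N X L Z f n')
      (gen_ext _ fun H K g p q => by
        simp only [LinearMap.add_apply, assocAux_gen, gen_add_right]) t)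
    (fun X L Z c f t n => LinearMap.congr_fun
      (f := assocAux σ P Q N X L Z f (c • n))
      (g := c • assocAux σ P Q N X L Z f n)
      (gen_ext _ fun H K g p q => by
        simp only [LinearMap.smul_apply, assocAux_gen, gen_smul_right]) t)
    (fun X L L' Z α f t n => LinearMap.congr_fun
      (f := assocAux σ P Q N X L' Z (f ≫ (σ.act.map α).app Z) n)
      (g := assocAux σ P Q N X L Z f n ∘ₗ (dayObj (tensor k) P Q).res α)
      (gen_ext _ fun H K g p q => by
        simp only [LinearMap.comp_apply, gen_res, assocAux_gen, Functor.map_comp,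
          NatTrans.comp_app, Category.assoc]) t)
    (fun X L Z Z' β f t n => LinearMap.congr_fun
      (f := assocAux σ P Q N X L Z' (f ≫ (σ.act.obj L).map β) n)
      (g := assocAux σ P Q N X L Z f (N.res β n))
      (gen_ext _ fun H K g p q => by
        simp only [assocAux_gen]
        rw [gen_right_res, Category.id_comp, gen_gen_right σ.act σ.act _ p ((σ.act.obj K).map β)]
        simp only [Category.assoc, ← σ.assoc_nat₃, NatTrans.naturality_assoc]) t)
    (fun X Y L Z h f t n => LinearMap.congr_fun
      (f := assocAux σ P Q N X L Z (h ≫ f) n)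
      (g := Psh.res _ h ∘ₗ assocAux σ P Q N Y L Z f n)
      (gen_ext _ fun H K g p q => by
        simp only [LinearMap.comp_apply, gen_res, assocAux_gen, Category.assoc]) t)

theorem assocHom_gen {X : M} {L : S} {Z : M} (f : X ⟶ (σ.act.obj L).obj Z) (n : N.sec Z)
    {H K : S} (g : L ⟶ ((tensor k).obj H).obj K) (p : P.sec H) (q : Q.sec K) :
    Psh.app (assocHom σ P Q N) X (gen σ.act f (gen (tensor k) g p q) n) =
      gen σ.act (f ≫ (σ.act.map g).app Z ≫ (σ.assoc H K Z).hom) p (gen σ.act (𝟙 _) q n) := by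
  unfold assocHom
  rw [descHom_gen, assocAux_gen]

/-- For fixed `f`, `p`, the map `[g, q, n] ↦ [f', [𝟙, p, q], n]`. -/
def assocInvAux (X : M) (H : S) (W : M) (f : X ⟶ (σ.act.obj H).obj W) (p : P.sec H) :
    (dayObj σ.act Q N).sec W →ₗ[k] (dayObj σ.act (dayObj (tensor k) P Q) N).sec X :=
  desc σ.act
    (fun K Z g q n => gen σ.act (f ≫ (σ.act.obj H).map g ≫ (σ.assoc H K Z).inv)
      (gen (tensor k) (𝟙 _) p q) n)
    (fun K Z g g' q n => by
      rw [σ.bilinear.map_add_right, Preadditive.add_comp, Preadditive.comp_add, gen_add_left])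
    (fun K Z c g q n => by
      rw [σ.bilinear.map_smul_right, Linear.smul_comp, Linear.comp_smul, gen_smul_left])
    (fun K Z g q q' n => by rw [gen_add_right, gen_add_mid])
    (fun K Z c g q n => by rw [gen_smul_right, gen_smul_mid])
    (fun K Z g q n n' => gen_add_right ..)
    (fun K Z c g q n => gen_smul_right ..)
    (fun K K' Z α g q n => by
      rw [gen_right_res, Category.id_comp,
        gen_gen_left σ.act (tensor k) _ (((tensor k).obj H).map α)]
      have e : (σ.act.obj H).map ((σ.act.map α).app Z) ≫ (σ.assoc H K' Z).inv =
          (σ.assoc H K Z).inv ≫ (σ.act.map (((tensor k).obj H).map α)).app Z := by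
        rw [Iso.comp_inv_eq, Category.assoc, σ.assoc_nat₂, Iso.inv_hom_id_assoc]
      simp only [Functor.map_comp, Category.assoc, e])
    (fun K Z Z' β g q n => by
      rw [gen_right_res]
      have e : (σ.act.obj H).map ((σ.act.obj K).map β) ≫ (σ.assoc H K Z').inv =
          (σ.assoc H K Z).inv ≫ (σ.act.obj (((tensor k).obj H).obj K)).map β := by
        rw [Iso.comp_inv_eq, Category.assoc, σ.assoc_nat₃, Iso.inv_hom_id_assoc]
      simp only [Functor.map_comp, Category.assoc, e])

theorem assocInvAux_gen (X : M) (H : S) (W : M) (f : X ⟶ (σ.act.obj H).obj W) (p : P.sec H)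
    {K : S} {Z : M} (g : W ⟶ (σ.act.obj K).obj Z) (q : Q.sec K) (n : N.sec Z) :
    assocInvAux σ P Q N X H W f p (gen σ.act g q n) =
      gen σ.act (f ≫ (σ.act.obj H).map g ≫ (σ.assoc H K Z).inv) (gen (tensor k) (𝟙 _) p q) n := by
  unfold assocInvAux
  rw [desc_gen]

/-- The inverse of the associator. -/
def assocInv : dayObj σ.act P (dayObj σ.act Q N) ⟶ dayObj σ.act (dayObj (tensor k) P Q) N :=
  descHom σ.act (fun X H W f p t => assocInvAux σ P Q N X H W f p t)
    (fun X H W f f' p t => LinearMap.congr_fun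
      (f := assocInvAux σ P Q N X H W (f + f') p)
      (g := assocInvAux σ P Q N X H W f p + assocInvAux σ P Q N X H W f' p)
      (gen_ext _ fun K Z g q n => by
        simp only [LinearMap.add_apply, assocInvAux_gen, Preadditive.add_comp, gen_add_left]) t)
    (fun X H W c f p t => LinearMap.congr_fun
      (f := assocInvAux σ P Q N X H W (c • f) p)
      (g := c • assocInvAux σ P Q N X H W f p)
      (gen_ext _ fun K Z g q n => by
        simp only [LinearMap.smul_apply, assocInvAux_gen, Linear.smul_comp, gen_smul_left]) t)
    (fun X H W f p p' t => LinearMap.congr_fun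
      (f := assocInvAux σ P Q N X H W f (p + p'))
      (g := assocInvAux σ P Q N X H W f p + assocInvAux σ P Q N X H W f p')
      (gen_ext _ fun K Z g q n => by
        simp only [LinearMap.add_apply, assocInvAux_gen, gen_add_mid]) t)
    (fun X H W c f p t => LinearMap.congr_fun
      (f := assocInvAux σ P Q N X H W f (c • p))
      (g := c • assocInvAux σ P Q N X H W f p)
      (gen_ext _ fun K Z g q n => by
        simp only [LinearMap.smul_apply, assocInvAux_gen, gen_smul_mid]) t)
    (fun X H W f p t t' => map_add _ _ _)
    (fun X H W c f p t => map_smul _ _ _)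
    (fun X H H' W α f p t => LinearMap.congr_fun
      (f := assocInvAux σ P Q N X H' W (f ≫ (σ.act.map α).app W) p)
      (g := assocInvAux σ P Q N X H W f (P.res α p))
      (gen_ext _ fun K Z g q n => by
        simp only [assocInvAux_gen]
        rw [gen_mid_res, Category.id_comp,
          gen_gen_left σ.act (tensor k) _ (((tensor k).map α).app K)]
        have e : (σ.act.map α).app ((σ.act.obj K).obj Z) ≫ (σ.assoc H' K Z).inv =
            (σ.assoc H K Z).inv ≫ (σ.act.map (((tensor k).map α).app K)).app Z := by
          rw [Iso.comp_inv_eq, Category.assoc, σ.assoc_nat₁, Iso.inv_hom_id_assoc]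
        simp only [Category.assoc, ← e, NatTrans.naturality_assoc]) t)
    (fun X H W W' β f p t => LinearMap.congr_fun
      (f := assocInvAux σ P Q N X H W' (f ≫ (σ.act.obj H).map β) p)
      (g := assocInvAux σ P Q N X H W f p ∘ₗ (dayObj σ.act Q N).res β)
      (gen_ext _ fun K Z g q n => by
        simp only [LinearMap.comp_apply, gen_res, assocInvAux_gen, Functor.map_comp,
          Category.assoc]) t)
    (fun X Y H W h f p t => LinearMap.congr_fun
      (f := assocInvAux σ P Q N X H W (h ≫ f) p)
      (g := Psh.res _ h ∘ₗ assocInvAux σ P Q N Y H W f p)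
      (gen_ext _ fun K Z g q n => by
        simp only [LinearMap.comp_apply, gen_res, assocInvAux_gen, Category.assoc]) t)

theorem assocInv_gen {X : M} {H : S} {W : M} (f : X ⟶ (σ.act.obj H).obj W) (p : P.sec H)
    {K : S} {Z : M} (g : W ⟶ (σ.act.obj K).obj Z) (q : Q.sec K) (n : N.sec Z) :
    Psh.app (assocInv σ P Q N) X (gen σ.act f p (gen σ.act g q n)) =
      gen σ.act (f ≫ (σ.act.obj H).map g ≫ (σ.assoc H K Z).inv) (gen (tensor k) (𝟙 _) p q) n := by
  unfold assocInv
  rw [descHom_gen, assocInvAux_gen]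

end

/-- The associativity isomorphism `(P ⊛ Q) ⋆ N ≅ P ⋆ (Q ⋆ N)`. -/
def dayAssoc (P Q : Psh k S) (N : Psh k M) :
    dayObj σ.act (dayObj (tensor k) P Q) N ≅ dayObj σ.act P (dayObj σ.act Q N) where
  hom := assocHom σ P Q N
  inv := assocInv σ P Q N
  hom_inv_id := dayObj_hom_ext₂ _ _ fun X L Z f H K g p q n => by
    rw [Psh.app_comp, Psh.app_id, assocHom_gen, assocInv_gen, gen_gen_left σ.act (tensor k) f g]
    simp
  inv_hom_id := dayObj_hom_ext₂' _ _ fun X L Z f H K g p q n => by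
    rw [Psh.app_comp, Psh.app_id, assocInv_gen, assocHom_gen, gen_gen_right σ.act σ.act f _ g]
    simp

theorem dayAssoc_nat₁ {P P' : Psh k S} (φ : P ⟶ P') (Q : Psh k S) (N : Psh k M) :
    dayMap σ.act (dayMap (tensor k) φ (𝟙 Q)) (𝟙 N) ≫ (dayAssoc σ P' Q N).hom =
      (dayAssoc σ P Q N).hom ≫ dayMap σ.act φ (𝟙 (dayObj σ.act Q N)) :=
  dayObj_hom_ext₂ _ _ fun X L Z f H K g p q n => by
    simp only [dayAssoc, Psh.app_comp, dayMap_gen, assocHom_gen, Psh.app_id]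

theorem dayAssoc_nat₂ (P : Psh k S) {Q Q' : Psh k S} (φ : Q ⟶ Q') (N : Psh k M) :
    dayMap σ.act (dayMap (tensor k) (𝟙 P) φ) (𝟙 N) ≫ (dayAssoc σ P Q' N).hom =
      (dayAssoc σ P Q N).hom ≫ dayMap σ.act (𝟙 P) (dayMap σ.act φ (𝟙 N)) :=
  dayObj_hom_ext₂ _ _ fun X L Z f H K g p q n => by
    simp only [dayAssoc, Psh.app_comp, dayMap_gen, assocHom_gen, Psh.app_id]

theorem dayAssoc_nat₃ (P Q : Psh k S) {N N' : Psh k M} (φ : N ⟶ N') :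
    dayMap σ.act (𝟙 (dayObj (tensor k) P Q)) φ ≫ (dayAssoc σ P Q N').hom =
      (dayAssoc σ P Q N).hom ≫ dayMap σ.act (𝟙 P) (dayMap σ.act (𝟙 Q) φ) :=
  dayObj_hom_ext₂ _ _ fun X L Z f H K g p q n => by
    simp only [dayAssoc, Psh.app_comp, dayMap_gen, assocHom_gen, Psh.app_id]

/-- The associativity isomorphism `(P ⊛ Q) ⊛ R ≅ P ⊛ (Q ⊛ R)` of Day convolution. -/
def tensorAssoc (P Q R : Psh k S) :
    dayObj (tensor k) (dayObj (tensor k) P Q) R ≅ dayObj (tensor k) P (dayObj (tensor k) Q R) :=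
  dayAssoc (SemigroupModule.regular k S) P Q R

theorem tensorAssoc_gen (P Q R : Psh k S) {X L K : S} (f : X ⟶ ((tensor k).obj L).obj K)
    {H G : S} (g : L ⟶ ((tensor k).obj H).obj G) (p : P.sec H) (q : Q.sec G) (r : R.sec K) :
    Psh.app (tensorAssoc P Q R).hom X (gen (tensor k) f (gen (tensor k) g p q) r) =
      gen (tensor k) (f ≫ ((tensor k).map g).app K ≫ (SemigroupCategory.assoc (k := k) H G K).hom)
        p (gen (tensor k) (𝟙 _) q r) :=
  assocHom_gen (SemigroupModule.regular k S) P Q R f r g p q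

theorem dayAssoc_pentagon (P Q R : Psh k S) (N : Psh k M) :
    dayMap σ.act (tensorAssoc P Q R).hom (𝟙 N) ≫
        (dayAssoc σ P (dayObj (tensor k) Q R) N).hom ≫ dayMap σ.act (𝟙 P) (dayAssoc σ Q R N).hom =
      (dayAssoc σ (dayObj (tensor k) P Q) R N).hom ≫ (dayAssoc σ P Q (dayObj σ.act R N)).hom :=
  dayObj_hom_ext₃ _ _ _ fun X L Z f H K g F G h p q r n => by
    simp only [Psh.app_comp, dayMap_gen, tensorAssoc_gen]
    simp only [dayAssoc, assocHom_gen, dayMap_gen, Psh.app_id, Category.id_comp]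
    have e : (σ.act.map (𝟙 (((tensor k).obj G).obj K))).app Z ≫ (σ.assoc G K Z).hom =
      (σ.assoc G K Z).hom := by simp
    rw [e, gen_gen_right σ.act σ.act _ p (σ.assoc G K Z).hom]
    have := σ.pentagon F G K Z
    simp only [Category.assoc, Functor.map_comp, NatTrans.comp_app, this,
      reassoc_of% (σ.assoc_nat₁ h K Z)]

end DayAssoc

section PshSemigroup

open SemigroupCategory

variable {k : Type u} [Field k]
  {S : Type u} [Category.{u} S] [Preadditive S] [Linear k S] [SemigroupCategory k S]

/-- Day convolution: the presheaf category `[Sᵒᵖ, Vec_k]` of a semigroup category is a semigroup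
category, with `(P ⊛ Q)(-) = ∫^{H, K} Hom(-, H ⊠ K) ⊗ P(H) ⊗ Q(K)`. -/
instance pshSemigroup : SemigroupCategory k (Psh k S) where
  tensor := day (tensor k)
  bilinear := day_isBilinear _
  assoc P Q R := tensorAssoc P Q R
  assoc_nat₁ := dayAssoc_nat₁ (SemigroupModule.regular k S)
  assoc_nat₂ := dayAssoc_nat₂ (SemigroupModule.regular k S)
  assoc_nat₃ := dayAssoc_nat₃ (SemigroupModule.regular k S)
  pentagon := dayAssoc_pentagon (SemigroupModule.regular k S)

/-- The presheaf category `[Mᵒᵖ, Vec_k]` of a semigroup `S`-module category `M` is a semigroup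
`[Sᵒᵖ, Vec_k]`-module category, with `(P ⋆ N)(-) = ∫^{F, X} Hom(-, F ⋆ X) ⊗ P(F) ⊗ N(X)`, the
extension of the action of `S` on `M` that is cocontinuous in both variables. -/
def SemigroupModule.psh {M : Type u} [Category.{u} M] [Preadditive M] [Linear k M]
    (σ : SemigroupModule k S M) : SemigroupModule k (Psh k S) (Psh k M) where
  act := day σ.act
  bilinear := day_isBilinear _
  assoc P Q N := dayAssoc σ P Q N
  assoc_nat₁ := dayAssoc_nat₁ σ
  assoc_nat₂ := dayAssoc_nat₂ σ
  assoc_nat₃ := dayAssoc_nat₃ σ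
  pentagon := dayAssoc_pentagon σ

/-- The Yoneda embedding of a semigroup category is compatible with tensor products. -/
def yoTensor (F G : S) : (yo (k := k)).obj (((tensor k).obj F).obj G) ≅
    ((tensor k).obj (yo.obj F)).obj (yo.obj G) :=
  yoDay SemigroupCategory.bilinear F G

theorem yoTensor_nat₁ {F F' : S} (f : F ⟶ F') (G : S) :
    (yo (k := k)).map (((tensor k).map f).app G) ≫ (yoTensor F' G).hom =
      (yoTensor F G).hom ≫ ((tensor k).map (yo.map f)).app (yo.obj G) := by
  change _ ≫ yoToDay (tensor k) F' G = yoToDay (tensor k) F G ≫ dayMap (tensor k) (yo.map f) (𝟙 _)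
  refine Psh.hom_ext fun X g => ?_
  rw [Psh.app_comp, Psh.app_comp, ← yoMk_hom g, yo_app, yoToDay_app, yoToDay_app, dayMap_gen,
    Psh.app_id, yo_app, ← gen_mid_res, yo_res, Category.comp_id, Category.id_comp]

theorem yoTensor_nat₂ (F : S) {G G' : S} (f : G ⟶ G') :
    (yo (k := k)).map (((tensor k).obj F).map f) ≫ (yoTensor F G').hom =
      (yoTensor F G).hom ≫ ((tensor k).obj (yo.obj F)).map (yo.map f) := by
  change _ ≫ yoToDay (tensor k) F G' = yoToDay (tensor k) F G ≫ dayMap (tensor k) (𝟙 _) (yo.map f)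
  refine Psh.hom_ext fun X g => ?_
  rw [Psh.app_comp, Psh.app_comp, ← yoMk_hom g, yo_app, yoToDay_app, yoToDay_app, dayMap_gen,
    Psh.app_id, yo_app, ← gen_right_res, yo_res, Category.comp_id, Category.id_comp]

theorem yoTensor_assoc (F G H : S) :
    (yo (k := k)).map (SemigroupCategory.assoc (k := k) F G H).hom ≫
        (yoTensor F (((tensor k).obj G).obj H)).hom ≫
          ((tensor k).obj (yo.obj F)).map (yoTensor G H).hom =
      (yoTensor (((tensor k).obj F).obj G) H).hom ≫
        ((tensor k).map (yoTensor F G).hom).app (yo.obj H) ≫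
          (SemigroupCategory.assoc (k := k) (yo.obj F) (yo.obj G) (yo.obj H)).hom := by
  change _ ≫ yoToDay (tensor k) _ _ ≫ dayMap (tensor k) (𝟙 _) (yoToDay (tensor k) _ _) =
    yoToDay (tensor k) _ _ ≫ dayMap (tensor k) (yoToDay (tensor k) _ _) (𝟙 _) ≫
      (tensorAssoc (yo.obj F) (yo.obj G) (yo.obj H)).hom
  refine Psh.hom_ext fun X g => ?_
  simp only [Psh.app_comp]
  rw [← yoMk_hom g, yo_app, yoToDay_app, yoToDay_app, dayMap_gen, dayMap_gen, Psh.app_id,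
    Psh.app_id, yoToDay_app, yoToDay_app, tensorAssoc_gen]
  simp

namespace SemigroupModule

variable {N : Type v₁} [Category.{w₁} N] [Preadditive N] [Linear k N]

/-- Restriction of a `[Sᵒᵖ, Vec_k]`-module category along the Yoneda embedding of `S`. -/
def restrictYo (τ : SemigroupModule k (Psh k S) N) : SemigroupModule k S N where
  act := yo ⋙ τ.act
  bilinear :=
    { map_add_left := fun f g Z => by
        simpa only [Functor.comp_map, yo_map_add] using
          τ.bilinear.map_add_left (yo.map f) (yo.map g) Z
      map_smul_left := fun r f Z => by
        simpa only [Functor.comp_map, yo_map_smul] using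
          τ.bilinear.map_smul_left r (yo.map f) Z
      map_add_right := fun X => τ.bilinear.map_add_right (yo.obj X)
      map_smul_right := fun X => τ.bilinear.map_smul_right (yo.obj X) }
  assoc F G X := (τ.act.mapIso (yoTensor F G)).app X ≪≫ τ.assoc (yo.obj F) (yo.obj G) X
  assoc_nat₁ f G X := by
    have e := congrArg (fun t => (τ.act.map t).app X) (yoTensor_nat₁ (k := k) f G)
    simp only [Functor.map_comp, NatTrans.comp_app] at e
    simp only [Functor.comp_map, Functor.comp_obj, Iso.trans_hom, Iso.app_hom, Functor.mapIso_hom,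
      reassoc_of% e, τ.assoc_nat₁, Category.assoc]
  assoc_nat₂ F _ _ g X := by
    have e := congrArg (fun t => (τ.act.map t).app X) (yoTensor_nat₂ (k := k) F g)
    simp only [Functor.map_comp, NatTrans.comp_app] at e
    simp only [Functor.comp_map, Functor.comp_obj, Iso.trans_hom, Iso.app_hom, Functor.mapIso_hom,
      reassoc_of% e, τ.assoc_nat₂, Category.assoc]
  assoc_nat₃ F G _ _ h := by
    simp only [Functor.comp_obj, Iso.trans_hom, Iso.app_hom, Functor.mapIso_hom,
      NatTrans.naturality_assoc, τ.assoc_nat₃, Category.assoc]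
  pentagon F G H X := by
    have e := congrArg (fun t => (τ.act.map t).app X) (yoTensor_assoc (k := k) F G H)
    simp only [Functor.map_comp, NatTrans.comp_app] at e
    simp only [Functor.comp_map, Functor.comp_obj, Iso.trans_hom, Iso.app_hom, Functor.mapIso_hom,
      Functor.map_comp, Category.assoc, ← reassoc_of% (τ.assoc_nat₂ (yo.obj F)), reassoc_of% e,
      τ.pentagon, reassoc_of% τ.assoc_nat₁]

/-- Restriction of a module category to a full subcategory that is stable under the action. -/
def full {S' : Type v₂} [Category.{w₂} S'] [Preadditive S'] [Linear k S'] [SemigroupCategory k S']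
    (σ : SemigroupModule k S' N) (P : ObjectProperty N)
    (h : ∀ (F : S') (X : N), P X → P ((σ.act.obj F).obj X)) :
    SemigroupModule k S' P.FullSubcategory where
  act :=
    { obj := fun F => P.lift (P.ι ⋙ σ.act.obj F) fun X => h F X.obj X.property
      map := fun f =>
        { app := fun X => ObjectProperty.homMk ((σ.act.map f).app X.obj)
          naturality := fun X Y g => by
            apply ObjectProperty.hom_ext
            exact (σ.act.map f).naturality g.hom }
      map_id := fun F => by ext X : 2; apply ObjectProperty.hom_ext; simp
      map_comp := fun f g => by ext X : 2; apply ObjectProperty.hom_ext; simp }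
  bilinear :=
    { map_add_left := fun f g Z => by
        apply ObjectProperty.hom_ext; exact σ.bilinear.map_add_left f g Z.obj
      map_smul_left := fun r f Z => by
        apply ObjectProperty.hom_ext; exact σ.bilinear.map_smul_left r f Z.obj
      map_add_right := fun X _ _ f g => by
        apply ObjectProperty.hom_ext; exact σ.bilinear.map_add_right X f.hom g.hom
      map_smul_right := fun X _ _ r f => by
        apply ObjectProperty.hom_ext; exact σ.bilinear.map_smul_right X r f.hom }
  assoc F G X := ObjectProperty.isoMk P (σ.assoc F G X.obj)
  assoc_nat₁ f G X := by apply ObjectProperty.hom_ext; exact σ.assoc_nat₁ f G X.obj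
  assoc_nat₂ F _ _ g X := by apply ObjectProperty.hom_ext; exact σ.assoc_nat₂ F g X.obj
  assoc_nat₃ F G _ _ g := by apply ObjectProperty.hom_ext; exact σ.assoc_nat₃ F G g.hom
  pentagon F G H X := by apply ObjectProperty.hom_ext; exact σ.pentagon F G H X.obj

end SemigroupModule

end PshSemigroup

/-! ### Non-unital adjunctions and rigidity -/

section Rigid

open SemigroupCategory

variable (k : Type u) [Field k]
  {S : Type v₁} [Category.{w₁} S] [Preadditive S] [Linear k S] [SemigroupCategory k S]

/-- An adjunction `(F, F', ηˡ, ηʳ, εˡ, εʳ)` in a semigroup category. Here `ηˡ` and `εˡ` are left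
module transformations `𝟭 ⟶ - ⊠ (F' ⊠ F)` and `- ⊠ (F ⊠ F') ⟶ 𝟭`, while `ηʳ` and `εʳ` are right
module transformations `𝟭 ⟶ (F' ⊠ F) ⊠ -` and `(F ⊠ F') ⊠ - ⟶ 𝟭`. -/
structure Adj (F F' : S) where
  ηl : 𝟭 S ⟶ (tensor k).flip.obj (((tensor k).obj F').obj F)
  εl : (tensor k).flip.obj (((tensor k).obj F).obj F') ⟶ 𝟭 S
  ηr : 𝟭 S ⟶ (tensor k).obj (((tensor k).obj F').obj F)
  εr : (tensor k).obj (((tensor k).obj F).obj F') ⟶ 𝟭 S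
  /-- `ηˡ` is a left module transformation -/
  ηl_module : ∀ H K : S,
    ηl.app (((tensor k).obj H).obj K) ≫
        (SemigroupCategory.assoc (k := k) H K (((tensor k).obj F').obj F)).hom =
      ((tensor k).obj H).map (ηl.app K)
  /-- `εˡ` is a left module transformation -/
  εl_module : ∀ H K : S,
    εl.app (((tensor k).obj H).obj K) =
      (SemigroupCategory.assoc (k := k) H K (((tensor k).obj F).obj F')).hom ≫
        ((tensor k).obj H).map (εl.app K)
  /-- `ηʳ` is a right module transformation -/
  ηr_module : ∀ H K : S,
    ηr.app (((tensor k).obj H).obj K) =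
      ((tensor k).map (ηr.app H)).app K ≫
        (SemigroupCategory.assoc (k := k) (((tensor k).obj F').obj F) H K).hom
  /-- `εʳ` is a right module transformation -/
  εr_module : ∀ H K : S,
    (SemigroupCategory.assoc (k := k) (((tensor k).obj F).obj F') H K).hom ≫
        εr.app (((tensor k).obj H).obj K) =
      ((tensor k).map (εr.app H)).app K
  /-- `- ⊠ F'` is left adjoint to `- ⊠ F` via `ηˡ` and `εˡ`: first triangle identity -/
  left_triangle : ∀ H : S,
    ((tensor k).map (ηl.app H)).app F' ≫
        ((tensor k).map (SemigroupCategory.assoc (k := k) H F' F).inv).app F' ≫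
          (SemigroupCategory.assoc (k := k) (((tensor k).obj H).obj F') F F').hom ≫
            εl.app (((tensor k).obj H).obj F') = 𝟙 _
  /-- second triangle identity -/
  left_triangle' : ∀ H : S,
    ηl.app (((tensor k).obj H).obj F) ≫
        (SemigroupCategory.assoc (k := k) (((tensor k).obj H).obj F) F' F).inv ≫
          ((tensor k).map (SemigroupCategory.assoc (k := k) H F F').hom).app F ≫
            ((tensor k).map (εl.app H)).app F = 𝟙 _
  /-- `F ⊠ -` is left adjoint to `F' ⊠ -` via `ηʳ` and `εʳ`: first triangle identity -/
  right_triangle : ∀ H : S,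
    ((tensor k).obj F).map (ηr.app H) ≫
        ((tensor k).obj F).map (SemigroupCategory.assoc (k := k) F' F H).hom ≫
          (SemigroupCategory.assoc (k := k) F F' (((tensor k).obj F).obj H)).inv ≫
            εr.app (((tensor k).obj F).obj H) = 𝟙 _
  /-- second triangle identity -/
  right_triangle' : ∀ H : S,
    ηr.app (((tensor k).obj F').obj H) ≫
        (SemigroupCategory.assoc (k := k) F' F (((tensor k).obj F').obj H)).hom ≫
          ((tensor k).obj F').map (SemigroupCategory.assoc (k := k) F F' H).inv ≫
            ((tensor k).obj F').map (εr.app H) = 𝟙 _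
  /-- zigzag identity for `F` -/
  zigzag : ηl.app F ≫ (SemigroupCategory.assoc (k := k) F F' F).inv ≫ εr.app F = 𝟙 F
  /-- zigzag identity for `F'` -/
  zigzag' : ηr.app F' ≫ (SemigroupCategory.assoc (k := k) F' F F').hom ≫ εl.app F' = 𝟙 F'
  /-- compatibility of `ηˡ` and `ηʳ` -/
  unit_compat : ∀ H K : S,
    ((tensor k).map (ηl.app H)).app K ≫
        (SemigroupCategory.assoc (k := k) H (((tensor k).obj F').obj F) K).hom =
      ((tensor k).obj H).map (ηr.app K)
  /-- compatibility of `εˡ` and `εʳ` -/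
  counit_compat : ∀ H K : S,
    (SemigroupCategory.assoc (k := k) H (((tensor k).obj F).obj F') K).hom ≫
        ((tensor k).obj H).map (εr.app K) =
      ((tensor k).map (εl.app H)).app K

variable (S) in
/-- A semigroup category is rigid if every object is the left part of an adjunction and also the
right part of an adjunction, i.e. it has duals on both sides. -/
def IsRigid : Prop :=
  ∀ F : S, (∃ F' : S, Nonempty (Adj k F F')) ∧ (∃ F' : S, Nonempty (Adj k F' F))

end Rigid

namespace SemigroupModule

open SemigroupCategory

variable {k : Type u} [Field k]
  {S : Type v₁} [Category.{w₁} S] [Preadditive S] [Linear k S] [SemigroupCategory k S]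
  {M : Type v₂} [Category.{w₂} M] [Preadditive M] [Linear k M]

/-- A witness that the adjunction `d` in `S` is respected in the `S`-module category `M`: an
adjunction between the functors `F ⋆ -` and `F' ⋆ -` that is coherent with `d`, in the sense
that `H ⋆ ε_X` and `H ⋆ η_X` agree with `εˡ_H ⋆ X` and `ηˡ_H ⋆ X` up to the coherence
isomorphisms. -/
structure RespectedAdj (σ : SemigroupModule k S M) {F F' : S} (d : Adj k F F') where
  adj : σ.act.obj F ⊣ σ.act.obj F'
  counit_coherent : ∀ (H : S) (X : M),
    (σ.act.obj H).map (adj.counit.app X) =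
      (σ.act.obj H).map (σ.assoc F F' X).inv ≫
        (σ.assoc H (((tensor k).obj F).obj F') X).inv ≫ (σ.act.map (d.εl.app H)).app X
  unit_coherent : ∀ (H : S) (X : M),
    (σ.act.obj H).map (adj.unit.app X) =
      (σ.act.map (d.ηl.app H)).app X ≫ (σ.assoc H (((tensor k).obj F').obj F) X).hom ≫
        (σ.act.obj H).map (σ.assoc F' F X).hom

/-- The `S`-module category `M` respects all adjunctions in `S`. -/
def RespectsAdjunctions (σ : SemigroupModule k S M) : Prop :=
  ∀ (F F' : S) (d : Adj k F F'), Nonempty (σ.RespectedAdj d)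

/-- The condition `S ⋆ M = M`: every object `X` of `M` is a direct summand of a finite direct sum
of objects of the form `F ⋆ Y`. If the direct sum does not exist in `M`, it is understood to be
formed in the additive envelope of `M`, so that a direct summand is given by a matrix of morphisms
`i j : X ⟶ F j ⋆ Y j` and `p j : F j ⋆ Y j ⟶ X` such that `∑ j, i j ≫ p j = 𝟙 X`. -/
def Generated (σ : SemigroupModule k S M) : Prop :=
  ∀ X : M, ∃ (n : ℕ) (F : Fin n → S) (Y : Fin n → M)
    (i : ∀ j, X ⟶ (σ.act.obj (F j)).obj (Y j)) (p : ∀ j, (σ.act.obj (F j)).obj (Y j) ⟶ X),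
      ∑ j, i j ≫ p j = 𝟙 X

end SemigroupModule

/-! ### Units -/

section Unit

open SemigroupCategory

/-- A unit object of a semigroup category, with left and right unitors satisfying the triangle
axiom: this makes the semigroup category a monoidal category. -/
structure UnitStr (k : Type u) [Field k] (C : Type v₁) [Category.{w₁} C] [Preadditive C]
    [Linear k C] [SemigroupCategory k C] where
  unit : C
  left : (tensor k).obj unit ≅ 𝟭 C
  right : (tensor k).flip.obj unit ≅ 𝟭 C
  triangle : ∀ P Q : C,
    (SemigroupCategory.assoc (k := k) P unit Q).hom ≫ ((tensor k).obj P).map (left.hom.app Q) =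
      ((tensor k).map (right.hom.app P)).app Q

variable {k : Type u} [Field k]
  {C : Type v₁} [Category.{w₁} C] [Preadditive C] [Linear k C] [SemigroupCategory k C]
  {N : Type v₂} [Category.{w₂} N] [Preadditive N] [Linear k N]

/-- A semigroup module category over a monoidal category is a monoidal module category if there
is a unitor `1 ⋆ X ≅ X` satisfying the triangle axiom. -/
def SemigroupModule.IsMonoidal (U : UnitStr k C) (σ : SemigroupModule k C N) : Prop :=
  ∃ l : σ.act.obj U.unit ≅ 𝟭 N, ∀ (P : C) (X : N),
    (σ.assoc P U.unit X).hom ≫ (σ.act.obj P).map (l.hom.app X) =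
      (σ.act.map (U.right.hom.app P)).app X

end Unit

/-! ### Equivalences of module categories -/

section Equivalence

open SemigroupCategory

variable {k : Type u} [Field k]
  {S : Type v₁} [Category.{w₁} S] [Preadditive S] [Linear k S] [SemigroupCategory k S]

/-- A `k`-linear equivalence of semigroup `S`-module categories. (When `S` and the module
categories are monoidal, such a functor is automatically compatible with the unitors, so this is
also the notion of equivalence of monoidal module categories.) -/
structure ModuleEquiv {M : Type v₂} [Category.{w₂} M] [Preadditive M] [Linear k M]
    {N : Type v₃} [Category.{w₃} N] [Preadditive N] [Linear k N]
    (σ : SemigroupModule k S M) (τ : SemigroupModule k S N) where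
  functor : M ⥤ N
  map_add : ∀ {X Y : M} (f g : X ⟶ Y), functor.map (f + g) = functor.map f + functor.map g
  map_smul : ∀ {X Y : M} (r : k) (f : X ⟶ Y), functor.map (r • f) = r • functor.map f
  isEquivalence : functor.IsEquivalence
  /-- the isomorphism `Φ(F ⋆ X) ≅ F ⋆ Φ(X)` -/
  iso : ∀ (F : S) (X : M),
    functor.obj ((σ.act.obj F).obj X) ≅ (τ.act.obj F).obj (functor.obj X)
  iso_nat_left : ∀ {F G : S} (f : F ⟶ G) (X : M),
    functor.map ((σ.act.map f).app X) ≫ (iso G X).hom =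
      (iso F X).hom ≫ (τ.act.map f).app (functor.obj X)
  iso_nat_right : ∀ (F : S) {X Y : M} (h : X ⟶ Y),
    functor.map ((σ.act.obj F).map h) ≫ (iso F Y).hom =
      (iso F X).hom ≫ (τ.act.obj F).map (functor.map h)
  coherence : ∀ (F G : S) (X : M),
    functor.map (σ.assoc F G X).hom ≫ (iso F ((σ.act.obj G).obj X)).hom ≫
        (τ.act.obj F).map (iso G X).hom =
      (iso (((tensor k).obj F).obj G) X).hom ≫ (τ.assoc F G (functor.obj X)).hom

namespace ModuleEquiv

variable {M : Type v₂} [Category.{w₂} M] [Preadditive M] [Linear k M]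
  {N : Type v₃} [Category.{w₃} N] [Preadditive N] [Linear k N]
  {σ : SemigroupModule k S M} {τ : SemigroupModule k S N}

/-- The identity equivalence. -/
def refl (σ : SemigroupModule k S M) : ModuleEquiv σ σ where
  functor := 𝟭 M
  map_add _ _ := rfl
  map_smul _ _ := rfl
  isEquivalence := inferInstance
  iso F X := Iso.refl _
  iso_nat_left f X := by simp
  iso_nat_right F _ _ h := by simp
  coherence F G X := by simp

/-- The inverse equivalence. -/
def symm (e : ModuleEquiv σ τ) : ModuleEquiv τ σ :=
  haveI := e.isEquivalence
  let E := e.functor.asEquivalence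
  let ε : ∀ Y : N, e.functor.obj (E.inverse.obj Y) ≅ Y := fun Y => E.counitIso.app Y
  have hε : ∀ {Y Y' : N} (h : Y ⟶ Y'),
      e.functor.map (E.inverse.map h) = (ε Y).hom ≫ h ≫ (ε Y').inv := fun h => by
    rw [← Category.assoc, Iso.eq_comp_inv]
    exact E.counitIso.hom.naturality h
  let s : ∀ (F : S) (Y : N), E.inverse.obj ((τ.act.obj F).obj Y) ≅
      (σ.act.obj F).obj (E.inverse.obj Y) := fun F Y =>
    e.functor.preimageIso (ε _ ≪≫ (τ.act.obj F).mapIso (ε Y).symm ≪≫ (e.iso F _).symm)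
  have hs : ∀ (F : S) (Y : N), e.functor.map (s F Y).hom =
      (ε _).hom ≫ (τ.act.obj F).map (ε Y).inv ≫ (e.iso F _).inv := fun F Y => by
    simp [s]
  { functor := E.inverse
    map_add := fun f g => e.functor.map_injective (by
      rw [e.map_add, hε, hε, hε, Preadditive.add_comp, Preadditive.comp_add])
    map_smul := fun r f => e.functor.map_injective (by
      rw [e.map_smul, hε, hε, Linear.smul_comp, Linear.comp_smul])
    isEquivalence := inferInstance
    iso := s
    iso_nat_left := fun {F G} f X => e.functor.map_injective (by
      have h := e.iso_nat_left f (E.inverse.obj X)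
      rw [← Iso.eq_comp_inv, Category.assoc] at h
      simp only [Functor.map_comp, hε, hs, h, Category.assoc, Iso.inv_hom_id_assoc,
        NatTrans.naturality_assoc])
    iso_nat_right := fun F X Y h => e.functor.map_injective (by
      have h' := e.iso_nat_right F (E.inverse.map h)
      rw [← Iso.eq_comp_inv, Category.assoc] at h'
      simp only [Functor.map_comp, hε, hs, h', Category.assoc, Iso.inv_hom_id_assoc]
      simp only [← Functor.map_comp_assoc, Iso.inv_hom_id_assoc])
    coherence := fun F G X => e.functor.map_injective (by
      have h := e.coherence F G (E.inverse.obj X)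
      have h₁ : (τ.assoc F G (e.functor.obj (E.inverse.obj X))).hom ≫
          (τ.act.obj F).map (e.iso G (E.inverse.obj X)).inv ≫ (e.iso F _).inv =
          (e.iso (((tensor k).obj F).obj G) (E.inverse.obj X)).inv ≫
            e.functor.map (σ.assoc F G (E.inverse.obj X)).hom := by
        rw [Iso.eq_inv_comp, ← reassoc_of% h, ← Functor.map_comp_assoc, Iso.hom_inv_id,
          CategoryTheory.Functor.map_id, Category.id_comp, Iso.hom_inv_id, Category.comp_id]
      have h₂ := e.iso_nat_right F (s G X).hom
      rw [← Iso.eq_comp_inv, Category.assoc] at h₂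
      have h₃ := τ.assoc_nat₃ F G (ε X).inv
      rw [Functor.map_comp, Functor.map_comp, Functor.map_comp, h₂, hε, hs, hs, hs]
      simp only [Functor.map_comp, Category.assoc, Iso.inv_hom_id_assoc, ← h₁]
      rw [← Functor.map_comp_assoc (τ.act.obj F) (ε _).inv, Iso.inv_hom_id,
        CategoryTheory.Functor.map_id, Category.id_comp, ← reassoc_of% h₃]) }

/-- The composite of two equivalences. -/
def trans (e : ModuleEquiv σ τ) {L : Type v₁} [Category.{w₁} L] [Preadditive L] [Linear k L]
    {ρ : SemigroupModule k S L} (e' : ModuleEquiv τ ρ) : ModuleEquiv σ ρ where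
  functor := e.functor ⋙ e'.functor
  map_add f g := by simp only [Functor.comp_map, e.map_add, e'.map_add]
  map_smul r f := by simp only [Functor.comp_map, e.map_smul, e'.map_smul]
  isEquivalence :=
    haveI := e.isEquivalence
    haveI := e'.isEquivalence
    inferInstance
  iso F X := e'.functor.mapIso (e.iso F X) ≪≫ e'.iso F _
  iso_nat_left f X := by
    simp only [Functor.comp_map, Functor.comp_obj, Iso.trans_hom, Functor.mapIso_hom,
      ← Functor.map_comp_assoc, e.iso_nat_left, Category.assoc]
    simp only [Functor.map_comp, Category.assoc, e'.iso_nat_left]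
  iso_nat_right F _ _ h := by
    simp only [Functor.comp_map, Functor.comp_obj, Iso.trans_hom, Functor.mapIso_hom,
      ← Functor.map_comp_assoc, e.iso_nat_right, Category.assoc]
    simp only [Functor.map_comp, Category.assoc, e'.iso_nat_right]
  coherence F G X := by
    have h := congrArg e'.functor.map (e.coherence F G X)
    simp only [Functor.map_comp] at h
    simp only [Functor.comp_map, Functor.comp_obj, Iso.trans_hom, Functor.mapIso_hom,
      Functor.map_comp, Category.assoc, ← reassoc_of% (e'.iso_nat_right F), e'.coherence,
      reassoc_of% h]

end ModuleEquiv

end Equivalence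

/-! ### Finitely generated projective objects, cocontinuity, counits -/

section Conditions

/-- A family of morphisms to `Q` is jointly epimorphic; if the coproduct of the sources exists,
this means that the induced morphism from the coproduct to `Q` is an epimorphism. -/
def JointlyEpi {N : Type v₁} [Category.{w₁} N] {I : Type v₂} {X : I → N} {Q : N}
    (f : ∀ i, X i ⟶ Q) : Prop :=
  ∀ ⦃Z : N⦄ (g h : Q ⟶ Z), (∀ i, f i ≫ g = f i ≫ h) → g = h

/-- An object is finitely generated if every small jointly epimorphic family of morphisms to it
has a finite jointly epimorphic subfamily. -/
def IsFinGen {N : Type v₁} [Category.{w₁} N] (Q : N) : Prop :=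
  ∀ (I : Type w₁) (X : I → N) (f : ∀ i, X i ⟶ Q), JointlyEpi f →
    ∃ t : Finset I, JointlyEpi fun i : t => f i

/-- The finitely generated projective objects of a category. -/
def fgProj (N : Type v₁) [Category.{w₁} N] : ObjectProperty N :=
  fun Q => Projective Q ∧ IsFinGen Q

/-- Cauchy completeness of a `k`-linear category: it has finite direct sums and idempotents
split. -/
def CauchyComplete (M : Type v₁) [Category.{w₁} M] [Preadditive M] : Prop :=
  Limits.HasFiniteBiproducts M ∧ IsIdempotentComplete M

namespace SemigroupModule

variable {k : Type u} [Field k]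
  {S : Type v₁} [Category.{w₁} S] [Preadditive S] [Linear k S] [SemigroupCategory k S]
  {N : Type v₂} [Category.{w₂} N] [Preadditive N] [Linear k N]

/-- The action preserves small colimits in each of the two variables. -/
def Cocontinuous (σ : SemigroupModule k S N) : Prop :=
  (∀ P : S, Limits.PreservesColimitsOfSize.{u, u} (σ.act.obj P)) ∧
    ∀ Q : N, Limits.PreservesColimitsOfSize.{u, u} (σ.act.flip.obj Q)

/-- An adjunction in `S` together with a witness that it is respected in the module category. -/
structure RespectedPair (σ : SemigroupModule k S N) where
  F : S
  F' : S
  adjunction : Adj k F F'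
  respected : σ.RespectedAdj adjunction

/-- The counit map `(ε^F_!)_F` with components `∐_F F ⋆ (F' ⋆ Q) ⟶ Q` is an epimorphism, where
`F` runs over the objects of `S`, where `F'` is a dual of `F`, and where the component of index `F`
is the counit of the adjunction between `F ⋆ -` and `F' ⋆ -` induced by the one in `S`. (Different
choices of the dual, or of the adjunction, change the component of index `F` only by precomposition
with an isomorphism, so that it does not matter that all of the choices are included here.) -/
def CounitsEpi (σ : SemigroupModule k S N) : Prop :=
  ∀ Q : N, JointlyEpi
    (X := fun i : σ.RespectedPair => (σ.act.obj i.F).obj ((σ.act.obj i.F').obj Q)) (Q := Q)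
    fun i => i.respected.adj.counit.app Q

end SemigroupModule

end Conditions

/-! ### The two classes of module categories -/

section Bundles

variable (k : Type u) [Field k] (S : Type u) [Category.{u} S] [Preadditive S] [Linear k S]
  [SemigroupCategory k S]

/-- A small semigroup `S`-module category. -/
structure SModuleCat where
  carrier : Type u
  [category : Category.{u} carrier]
  [preadditive : Preadditive carrier]
  [linear : Linear k carrier]
  str : SemigroupModule k S carrier

attribute [instance] SModuleCat.category SModuleCat.preadditive SModuleCat.linear

/-- A semigroup `[Sᵒᵖ, Vec_k]`-module category whose underlying category is the category of
presheaves on a small `k`-linear category. -/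
structure PshModuleCat where
  base : Type u
  [category : Category.{u} base]
  [preadditive : Preadditive base]
  [linear : Linear k base]
  str : SemigroupModule k (Psh k S) (Psh k base)

attribute [instance] PshModuleCat.category PshModuleCat.preadditive PshModuleCat.linear

variable {k S}

/-- The `[Sᵒᵖ, Vec_k]`-module category `[Mᵒᵖ, Vec_k]`. -/
def SModuleCat.psh (M : SModuleCat k S) : PshModuleCat k S where
  base := M.carrier
  str := M.str.psh

/-- The conditions on an `S`-module category on the left side of the correspondence: it is Cauchy
complete, it respects all adjunctions in `S`, and `S ⋆ M = M`. -/
structure SModuleCat.IsAdmissible (M : SModuleCat k S) : Prop where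
  cauchyComplete : CauchyComplete M.carrier
  respects : M.str.RespectsAdjunctions
  generated : M.str.Generated

/-- The conditions on a `[Sᵒᵖ, Vec_k]`-module category on the right side of the correspondence:
the action is cocontinuous in both variables, the module category is monoidal, and the counit map
of the `S`-module category obtained by restriction is an epimorphism. -/
structure PshModuleCat.IsAdmissible (U : UnitStr k (Psh k S)) (N : PshModuleCat k S) : Prop where
  cocontinuous : N.str.Cocontinuous
  monoidal : N.str.IsMonoidal U
  counitsEpi : N.str.restrictYo.CounitsEpi

/-- `N`-f.g.proj is stable under the action of `S`. -/
def PshModuleCat.FgProjStable (N : PshModuleCat k S) : Prop :=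
  ∀ (F : S) (Q : Psh k N.base), fgProj (Psh k N.base) Q →
    fgProj (Psh k N.base) ((N.str.restrictYo.act.obj F).obj Q)

/-- The `S`-module category `N`-f.g.proj, with the action of `S` obtained by restriction. -/
def PshModuleCat.fgProjModule (N : PshModuleCat k S) (h : N.FgProjStable) :
    SemigroupModule k S (fgProj (Psh k N.base)).FullSubcategory :=
  N.str.restrictYo.full (fgProj (Psh k N.base)) h

/-- Equivalence of the `S`-module categories on the left side of the correspondence. -/
instance leftSetoid : Setoid {M : SModuleCat k S // M.IsAdmissible} where
  r M M' := Nonempty (ModuleEquiv M.1.str M'.1.str)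
  iseqv :=
    { refl := fun _ => ⟨ModuleEquiv.refl _⟩
      symm := fun ⟨e⟩ => ⟨e.symm⟩
      trans := fun ⟨e⟩ ⟨e'⟩ => ⟨e.trans e'⟩ }

/-- Equivalence of the `[Sᵒᵖ, Vec_k]`-module categories on the right side of the
correspondence. -/
instance rightSetoid (U : UnitStr k (Psh k S)) :
    Setoid {N : PshModuleCat k S // N.IsAdmissible U} where
  r N N' := Nonempty (ModuleEquiv N.1.str N'.1.str)
  iseqv :=
    { refl := fun _ => ⟨ModuleEquiv.refl _⟩
      symm := fun ⟨e⟩ => ⟨e.symm⟩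
      trans := fun ⟨e⟩ ⟨e'⟩ => ⟨e.trans e'⟩ }

end Bundles

end SemigroupCat

end

-- The unit object is already hidden in the adjunctions of `S`. The counits of an adjunction form a
-- compatible pair of module transformations `- ⊠ X ⟶ 𝟭` and `X ⊠ - ⟶ 𝟭` with `X = F ⊠ F'`, and for
-- varying `X` all such pairs form a presheaf `unitPsh`. A section over `A` and a section over `B`
-- can be evaluated on each other, and the two resulting restrictions over `A ⊠ B` agree
-- (`unit_swap`). The unitors evaluate sections. Their inverses insert a unit `η` and tensor with a
-- counit, and the zigzag identities together with `unit_swap` show that this is inverse to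
-- evaluation. The same exchange shows that every section of `unitPsh` is a restriction of a counit
-- (`IsRigid.res_counit`).
--
-- The second principle is faithfulness: in the module categories that matter, a morphism `a` is
-- determined by all the morphisms `H ⋆ a`. For small `M` with `S ⋆ M = M` this holds because the
-- identity of every object is a finite sum of maps through counits `F ⋆ (F' ⋆ X) ⟶ X`
-- (`exists_sum_counit`). For a cocontinuous monoidal `N` it holds because `unitPsh` is covered by
-- representables, so that its sections act on `X` by a jointly epimorphic family
-- (`Unitor.jointlyEpi_act`). Faithfulness makes structure unique and identities checkable after
-- acting by `H`, where they become identities in `S`: coherent units and counits automatically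
-- satisfy the triangle identities (`RespectedAdj.ofCoherent`), and the sections of `unitPsh` act
-- linearly and naturally. Hence presheaves on a generated `M` respecting adjunctions form a
-- monoidal module category (`isMonoidal_psh`), and conversely a cocontinuous monoidal `N` respects
-- all adjunctions (`Unitor.respectedAdj`). The choice of the unit is immaterial, since any two are
-- compared by a canonical isomorphism (`IsMonoidal.of_unitStr`).
--
-- The bijection is Morita theory with an action. Finitely generated projective presheaves are the
-- summands of finite sums of representables (`Psh.fgProj_iff_finRetract`). They are stable under
-- `S`, because `F ⋆ -` has a right adjoint `F' ⋆ -` which is a left adjoint in turn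
-- (`fgProjStable`). A full subcategory of finitely generated projective objects that generates
-- recovers the presheaf category by the functor `Q ↦ Hom(ι -, Q)` (`nerve_isEquivalence`), and this
-- functor is compatible with the actions, since by cocontinuity it suffices to look at
-- representables (`isIso_nvMap`). Over a Cauchy complete category the finitely generated
-- projectives are exactly the representables (`exists_yo_iso`). The two constructions are therefore
-- mutually inverse, once the finitely generated projectives are replaced by a small model
-- (`exists_small_model`), in which generation holds because the jointly epimorphic counits split
-- finitely over a finitely generated projective object.

universe v₄ w₄

noncomputable section

namespace SemigroupCat

open SemigroupCategory

/-! ### The Yoneda lemma for linear presheaves -/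

section Yoneda

variable {k : Type u} [Field k] {A : Type u} [Category.{u} A] [Preadditive A] [Linear k A]

/-- The morphism from a representable presheaf determined by a section. -/
def Psh.el {P : Psh k A} {X : A} (p : P.sec X) : yo.obj X ⟶ P :=
  Psh.ofComponents
    (fun Y =>
      { toFun := fun u => P.res (yoHom u) p
        map_add' := fun u v => by rw [yoHom_add, Psh.res_add]
        map_smul' := fun c u => by rw [yoHom_smul, Psh.res_smul]; rfl })
    (fun {Y Z} f u => by
      change P.res (yoHom _) p = P.res f (P.res (yoHom u) p)
      rw [yoHom_res, Psh.res_comp])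

theorem Psh.el_app {P : Psh k A} {X Y : A} (p : P.sec X) (f : Y ⟶ X) :
    Psh.app (Psh.el p) Y (yoMk f) = P.res f p := rfl

@[simp] theorem Psh.el_app_id {P : Psh k A} {X : A} (p : P.sec X) :
    Psh.app (Psh.el p) X (yoMk (𝟙 X)) = p := by
  rw [Psh.el_app, Psh.res_id]

theorem Psh.yo_hom_ext {P : Psh k A} {X : A} {φ ψ : yo.obj X ⟶ P}
    (h : Psh.app φ X (yoMk (𝟙 X)) = Psh.app ψ X (yoMk (𝟙 X))) : φ = ψ :=
  Psh.hom_ext fun Y u => by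
    have e : u = (yo.obj X).res (yoHom u) (yoMk (𝟙 X)) := by
      rw [yo_res, Category.comp_id, yoMk_hom]
    rw [e, Psh.app_res, Psh.app_res, h]

theorem Psh.el_eta {P : Psh k A} {X : A} (φ : yo.obj X ⟶ P) :
    Psh.el (Psh.app φ X (yoMk (𝟙 X))) = φ :=
  Psh.yo_hom_ext (Psh.el_app_id _)

theorem Psh.el_injective {P : Psh k A} {X : A} {p q : P.sec X} (h : Psh.el p = Psh.el q) :
    p = q := by
  rw [← Psh.el_app_id p, h, Psh.el_app_id]

theorem Psh.el_comp {P Q : Psh k A} {X : A} (p : P.sec X) (φ : P ⟶ Q) :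
    Psh.el p ≫ φ = Psh.el (Psh.app φ X p) :=
  Psh.yo_hom_ext (by simp)

theorem Psh.yo_map_el {P : Psh k A} {X Y : A} (f : Y ⟶ X) (p : P.sec X) :
    yo.map f ≫ Psh.el p = Psh.el (P.res f p) :=
  Psh.yo_hom_ext (by rw [Psh.app_comp, yo_app, Psh.el_app, Category.id_comp, Psh.el_app_id])

theorem Psh.el_add {P : Psh k A} {X : A} (p q : P.sec X) :
    Psh.el (p + q) = Psh.el p + Psh.el q :=
  Psh.yo_hom_ext (by simp)

theorem Psh.el_smul {P : Psh k A} {X : A} (c : k) (p : P.sec X) :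
    Psh.el (c • p) = c • Psh.el p :=
  Psh.yo_hom_ext (by simp)

theorem yo_map_injective {X Y : A} {f g : X ⟶ Y} (h : (yo (k := k)).map f = yo.map g) :
    f = g := by
  have := congrArg (fun t => yoHom (Psh.app t X (yoMk (𝟙 X)))) h
  simpa only [yo_app, yoHom_mk, Category.id_comp] using this

theorem yo_map_yoHom {X Y : A} (φ : (yo (k := k)).obj X ⟶ yo.obj Y) :
    yo.map (yoHom (Psh.app φ X (yoMk (𝟙 X)))) = φ :=
  Psh.yo_hom_ext (by rw [yo_app, Category.id_comp, yoMk_hom])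

instance : (yo (k := k) (A := A)).Full := ⟨fun φ => ⟨_, yo_map_yoHom φ⟩⟩
instance : (yo (k := k) (A := A)).Faithful := ⟨fun h => yo_map_injective h⟩
instance : (yo (k := k) (A := A)).Additive := ⟨yo_map_add _ _⟩
instance : (yo (k := k) (A := A)).Linear k := ⟨fun f r => yo_map_smul r f⟩

theorem Psh.app_sum {P Q : Psh k A} {I : Type*} (t : Finset I) (φ : I → (P ⟶ Q)) (X : A)
    (p : P.sec X) : Psh.app (∑ i ∈ t, φ i) X p = ∑ i ∈ t, Psh.app (φ i) X p := by
  induction t using Finset.cons_induction with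
  | empty => rfl
  | cons a s h ih => rw [Finset.sum_cons, Finset.sum_cons, Psh.app_add, ih]

theorem Psh.el_sum {P : Psh k A} {X : A} {I : Type*} (t : Finset I) (p : I → P.sec X) :
    Psh.el (∑ i ∈ t, p i) = ∑ i ∈ t, Psh.el (p i) :=
  Psh.yo_hom_ext (by simp [Psh.app_sum])

end Yoneda

/-! ### Nerves of linear functors -/

section Nerve

variable {k : Type u} [Field k] {B : Type u} [Category.{u} B] [Preadditive B] [Linear k B]
  {E : Type v₁} [Category.{u} E] [Preadditive E] [Linear k E]

/-- The presheaf `Hom(K -, R)`, as a functor of `R`. -/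
def nerve (K : B ⥤ E) [K.Additive] [K.Linear k] : E ⥤ Psh k B where
  obj R := Psh.ofSections (fun b => (K.obj b ⟶ R)) (fun f => Linear.leftComp k R (K.map f))
    (fun Y => by ext; simp) (fun f g => by ext; simp)
    (fun f g => by ext; simp) (fun c f => by ext; simp)
  map {R R'} φ := Psh.ofComponents (fun b => Linear.rightComp k (K.obj b) φ)
    (fun {_ _} f p => Category.assoc (K.map f) (show _ ⟶ R from p) φ)
  map_id R := Psh.hom_ext fun b p => Category.comp_id (show K.obj b ⟶ R from p)
  map_comp {R _ _} φ ψ := Psh.hom_ext fun b p =>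
    (Category.assoc (show K.obj b ⟶ R from p) φ ψ).symm

variable {K : B ⥤ E} [K.Additive] [K.Linear k]

/-- A morphism `K b ⟶ R` as a section of `nerve K R`. -/
def nerveMk {b : B} {R : E} (g : K.obj b ⟶ R) : ((nerve (k := k) K).obj R).sec b := g

/-- A section of `nerve K R` as a morphism `K b ⟶ R`. -/
def nerveHom {b : B} {R : E} (g : ((nerve (k := k) K).obj R).sec b) : K.obj b ⟶ R := g

theorem nerveMk_hom {b : B} {R : E} (g : ((nerve (k := k) K).obj R).sec b) :
    nerveMk (nerveHom g) = g := rfl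

@[simp] theorem nerveHom_mk {b : B} {R : E} (g : K.obj b ⟶ R) :
    nerveHom (nerveMk (k := k) g) = g := rfl

theorem nerveHom_add {b : B} {R : E} (g h : ((nerve (k := k) K).obj R).sec b) :
    nerveHom (g + h) = nerveHom g + nerveHom h := rfl

theorem nerveHom_smul {b : B} {R : E} (c : k) (g : ((nerve (k := k) K).obj R).sec b) :
    nerveHom (c • g) = c • nerveHom g := rfl

theorem nerveMk_add {b : B} {R : E} (g h : K.obj b ⟶ R) :
    nerveMk (k := k) (g + h) = nerveMk g + nerveMk h := rfl

theorem nerveMk_smul {b : B} {R : E} (c : k) (g : K.obj b ⟶ R) :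
    nerveMk (c • g) = c • nerveMk (k := k) g := rfl

theorem nerve_res {b b' : B} {R : E} (f : b' ⟶ b) (g : K.obj b ⟶ R) :
    ((nerve (k := k) K).obj R).res f (nerveMk g) = nerveMk (K.map f ≫ g) := rfl

theorem nerveHom_res {b b' : B} {R : E} (f : b' ⟶ b) (g : ((nerve (k := k) K).obj R).sec b) :
    nerveHom (((nerve (k := k) K).obj R).res f g) = K.map f ≫ nerveHom g := rfl

theorem nerve_app {b : B} {R R' : E} (φ : R ⟶ R') (g : K.obj b ⟶ R) :
    Psh.app ((nerve (k := k) K).map φ) b (nerveMk g) = nerveMk (g ≫ φ) := rfl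

instance : (nerve (k := k) K).Additive where
  map_add {R _ φ ψ} := Psh.hom_ext fun b p =>
    Preadditive.comp_add (K.obj b) R _ (nerveHom p) φ ψ

instance : (nerve (k := k) K).Linear k where
  map_smul {R _} φ r := Psh.hom_ext fun b p =>
    Linear.comp_smul (K.obj b) R _ (nerveHom p) r φ

end Nerve

/-! ### Jointly epimorphic families of presheaves -/

section JointlyEpi

variable {k : Type u} [Field k] {A : Type u} [Category.{u} A] [Preadditive A] [Linear k A]

/-- The quotient of a presheaf by a family of submodules stable under restriction. -/
def Psh.quot (Q : Psh k A) (R : ∀ X, Submodule k (Q.sec X))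
    (hR : ∀ {X Y : A} (f : X ⟶ Y), R Y ≤ (R X).comap (Q.res f)) : Psh k A :=
  Psh.ofSections (fun X => (Q.sec X : Type u) ⧸ R X) (fun {X Y} f => (R Y).mapQ (R X) (Q.res f) (hR f))
    (fun X => by ext p; simp)
    (fun f g => by ext p; simp [Psh.res_comp])
    (fun f g => by ext p; simp [Psh.res_add])
    (fun c f => by ext p; simp [Psh.res_smul])

/-- The projection to the quotient presheaf. -/
def Psh.quotMk (Q : Psh k A) (R : ∀ X, Submodule k (Q.sec X))
    (hR : ∀ {X Y : A} (f : X ⟶ Y), R Y ≤ (R X).comap (Q.res f)) : Q ⟶ Q.quot R hR :=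
  Psh.ofComponents (fun X => (R X).mkQ) (fun _ _ => rfl)

theorem Psh.quotMk_app_eq_zero (Q : Psh k A) (R : ∀ X, Submodule k (Q.sec X)) (hR) {X : A}
    (q : Q.sec X) : Psh.app (Q.quotMk R hR) X q = 0 ↔ q ∈ R X :=
  Submodule.Quotient.mk_eq_zero _

/-- The spans of the images form a subpresheaf of `Q`. The projection to the quotient by it agrees
with zero on every `f i`, so it is zero. The index type may live in any universe, which matters for
families of counits. -/
theorem JointlyEpi.mem_iSup_range {I : Type v₁} {X : I → Psh k A} {Q : Psh k A}
    {f : ∀ i, X i ⟶ Q} (hf : JointlyEpi f) {a : A} (q : Q.sec a) :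
    q ∈ ⨆ i, LinearMap.range (Psh.app (f i) a) := by
  let R : ∀ X, Submodule k (Q.sec X) := fun a => ⨆ i, LinearMap.range (Psh.app (f i) a)
  have hR : ∀ {X Y : A} (g : X ⟶ Y), R Y ≤ (R X).comap (Q.res g) := by
    intro X Y g
    refine iSup_le fun i => ?_
    rintro _ ⟨p, rfl⟩
    rw [Submodule.mem_comap, ← Psh.app_res]
    exact (le_iSup (fun i => LinearMap.range (Psh.app (f i) _)) i) ⟨_, rfl⟩
  have h0 : Q.quotMk R hR = 0 := hf _ _ fun i => Psh.hom_ext fun b p => by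
    rw [Limits.comp_zero, Psh.app_comp]
    refine ((Q.quotMk_app_eq_zero R hR _).2 ?_).trans rfl
    exact (le_iSup (fun i => LinearMap.range (Psh.app (f i) _)) i) ⟨_, rfl⟩
  refine (Q.quotMk_app_eq_zero R hR q).1 ?_
  rw [h0]; rfl

theorem JointlyEpi.exists_sum {I : Type v₁} {X : I → Psh k A} {Q : Psh k A}
    {f : ∀ i, X i ⟶ Q} (hf : JointlyEpi f) {a : A} (q : Q.sec a) :
    ∃ (t : Finset I) (x : ∀ i, (X i).sec a), ∑ i ∈ t, Psh.app (f i) a (x i) = q := by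
  obtain ⟨g, hg, hs⟩ := (Submodule.mem_iSup_iff_exists_finsupp _ _).1 (hf.mem_iSup_range q)
  choose x hx using hg
  exact ⟨g.support, x, (Finset.sum_congr rfl fun i _ => hx i).trans hs⟩

theorem JointlyEpi.of_surjective {I : Type v₁} {X : I → Psh k A} {Q : Psh k A}
    {f : ∀ i, X i ⟶ Q} (hf : ∀ a (q : Q.sec a), ∃ i x, Psh.app (f i) a x = q) : JointlyEpi f :=
  fun Z g h e => Psh.hom_ext fun a q => by
    obtain ⟨i, x, rfl⟩ := hf a q
    rw [← Psh.app_comp, e, Psh.app_comp]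

theorem Psh.jointlyEpi_el (Q : Psh k A) :
    JointlyEpi fun i : Σ a, Q.sec a => Psh.el i.2 :=
  JointlyEpi.of_surjective fun a q => ⟨⟨a, q⟩, _, Psh.el_app_id q⟩

theorem JointlyEpi.comp {N : Type v₁} [Category.{w₁} N] {I : Type v₂} {J : I → Type v₃}
    {X : I → N} {Y : ∀ i, J i → N} {Q : N} {f : ∀ i, X i ⟶ Q} {g : ∀ i j, Y i j ⟶ X i}
    (hf : JointlyEpi f) (hg : ∀ i, JointlyEpi (g i)) :
    JointlyEpi fun ij : Σ i, J i => g ij.1 ij.2 ≫ f ij.1 :=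
  fun Z a b e => hf a b fun i => hg i _ _ fun j => by simpa using e ⟨i, j⟩

theorem JointlyEpi.of_factor {N : Type v₁} [Category.{w₁} N] {I : Type v₂} {J : Type v₃}
    {X : I → N} {Y : J → N} {Q : N} {f : ∀ i, X i ⟶ Q} {g : ∀ j, Y j ⟶ Q}
    (hf : JointlyEpi f) (h : ∀ i, ∃ j, ∃ s : X i ⟶ Y j, s ≫ g j = f i) : JointlyEpi g :=
  fun Z a b e => hf a b fun i => by
    obtain ⟨j, s, hs⟩ := h i
    rw [← hs, Category.assoc, Category.assoc, e]

/-- Two morphisms out of `L.obj Q` can be compared after transposing them to morphisms out of `Q`.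
-/
theorem JointlyEpi.map_of_isLeftAdjoint {N : Type v₁} [Category.{w₁} N] {N' : Type v₂}
    [Category.{w₂} N'] {L : N ⥤ N'} {R : N' ⥤ N} (adj : L ⊣ R) {I : Type v₃}
    {X : I → N} {Q : N} {f : ∀ i, X i ⟶ Q} (hf : JointlyEpi f) :
    JointlyEpi fun i => L.map (f i) := fun Z g h e =>
  (adj.homEquiv Q Z).injective (hf _ _ fun i => by
    rw [← Adjunction.homEquiv_naturality_left, ← Adjunction.homEquiv_naturality_left, e])

end JointlyEpi

/-! ### Colimits of linear presheaves -/

section Colimits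

open Limits

variable {k : Type u} [Field k] {A : Type u} [Category.{u} A] [Preadditive A] [Linear k A]

/-- Colimits of functors are pointwise, so the linearity equations for the colimit may be tested
after composing with the colimit injections, where they are the linearity of the diagram. -/
instance (J : Type u) [Category.{u} J] :
    ObjectProperty.IsClosedUnderColimitsOfShape (C := Aᵒᵖ ⥤ ModuleCat.{u} k)
      (IsLinearPresheaf k A) J where
  colimitsOfShape_le := by
    rintro P ⟨h⟩
    have hP := h.prop_diag_obj
    have hc := fun X : Aᵒᵖ => isColimitOfPreserves ((evaluation _ (ModuleCat.{u} k)).obj X) h.isColimit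
    have key : ∀ j {X Y : Aᵒᵖ} (e : X ⟶ Y), (h.ι.app j).app X ≫ P.map e =
        (h.diag.obj j).map e ≫ (h.ι.app j).app Y := fun j _ _ e => ((h.ι.app j).naturality e).symm
    constructor
    · intro X Y f g
      refine (hc (op Y)).hom_ext fun j => ?_
      change (h.ι.app j).app _ ≫ _ = (h.ι.app j).app _ ≫ _
      rw [Preadditive.comp_add, key, key, key, (hP j).map_add, Preadditive.add_comp]
    · intro X Y r f
      refine (hc (op Y)).hom_ext fun j => ?_
      change (h.ι.app j).app _ ≫ _ = (h.ι.app j).app _ ≫ _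
      rw [Linear.comp_smul, key, key, (hP j).map_smul,
        Linear.smul_comp]

instance : HasColimits (Psh k A) where
  has_colimits_of_shape J _ := hasColimitsOfShape_of_closedUnderColimits J _

end Colimits

/-! ### Presentation by representables and cocontinuous functors -/

section Cocontinuity

open Limits

variable {k : Type u} [Field k] {A : Type u} [Category.{u} A] [Preadditive A] [Linear k A]

/-- The component at the colimit is the map induced by an isomorphism of the two image diagrams. -/
theorem isIso_app_of_isColimit {J : Type*} [Category* J] {C : Type*} [Category* C] {E : Type*}
    [Category* E] {T T' : C ⥤ E} (θ : T ⟶ T') {K : J ⥤ C} {c : Cocone K} (hc : IsColimit c)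
    [PreservesColimit K T] [PreservesColimit K T'] (h : ∀ j, IsIso (θ.app (K.obj j))) :
    IsIso (θ.app c.pt) := by
  let α : K ⋙ T ≅ K ⋙ T' := NatIso.ofComponents (fun j => @asIso _ _ _ _ (θ.app (K.obj j)) (h j))
  have e : θ.app c.pt = ((isColimitOfPreserves T hc).coconePointsIsoOfNatIso
      (isColimitOfPreserves T' hc) α).hom := by
    refine (isColimitOfPreserves T hc).hom_ext fun j => ?_
    rw [IsColimit.comp_coconePointsIsoOfNatIso_hom]
    exact θ.naturality (c.ι.app j)
  rw [e]
  infer_instance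

theorem JointlyEpi.epi_sigmaDesc {N : Type v₁} [Category.{w₁} N] {I : Type v₂} {X : I → N} {Q : N}
    {f : ∀ i, X i ⟶ Q} [HasCoproduct X] (hf : JointlyEpi f) : Epi (Sigma.desc f) :=
  ⟨fun g h e => hf g h fun i => by
    simpa using congrArg (fun t => Sigma.ι X i ≫ t) e⟩

/-- A jointly epimorphic small family is an epimorphism out of a coproduct, and `T` preserves both
the coproduct and the epimorphism. -/
theorem JointlyEpi.map_of_preservesColimits {E : Type v₁} [Category.{w₁} E] {T : Psh k A ⥤ E}
    [PreservesColimitsOfSize.{u, u} T] {I : Type u} {X : I → Psh k A} {Q : Psh k A}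
    {f : ∀ i, X i ⟶ Q} (hf : JointlyEpi f) : JointlyEpi fun i => T.map (f i) := by
  intro Z g h e
  have := hf.epi_sigmaDesc
  -- Being an epimorphism is a pushout condition, whose shape lives in universe `0`.
  have : PreservesColimitsOfSize.{0, 0} T := preservesColimitsOfSize_shrink.{0, u, 0, u} T
  rw [← cancel_epi (T.map (Sigma.desc f))]
  refine (isColimitOfPreserves T (colimit.isColimit (Discrete.functor X))).hom_ext fun i => ?_
  have hi : T.map (Sigma.ι X i.as) ≫ T.map (Sigma.desc f) = T.map (f i.as) := by
    rw [← T.map_comp, Sigma.ι_desc]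
  change T.map (Sigma.ι X i.as) ≫ _ = T.map (Sigma.ι X i.as) ≫ _
  rw [reassoc_of% hi, reassoc_of% hi, e]

/-- The coproduct of representable presheaves indexed by the sections of a presheaf. -/
abbrev Psh.cover (P : Psh k A) : Psh k A := ∐ fun i : Σ a, P.sec a => yo.obj i.1

/-- The canonical epimorphism onto a presheaf. -/
abbrev Psh.coverπ (P : Psh k A) : P.cover ⟶ P := Sigma.desc fun i => Psh.el i.2

/-- The canonical lift of a section to the cover. -/
def Psh.lift (P : Psh k A) {a : A} (p : P.sec a) : P.cover.sec a :=
  Psh.app (Sigma.ι (fun i : Σ a, P.sec a => (yo (k := k)).obj i.1) ⟨a, p⟩) a (yoMk (𝟙 a))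

theorem Psh.coverπ_lift (P : Psh k A) {a : A} (p : P.sec a) :
    Psh.app P.coverπ a (P.lift p) = p := by
  rw [Psh.lift, ← Psh.app_comp, Sigma.ι_desc, Psh.el_app_id]

/-- The sections of the kernel of the cover. -/
abbrev Psh.Syzygy (P : Psh k A) : Type u :=
  Σ a, {r : P.cover.sec a // Psh.app P.coverπ a r = 0}

/-- The coproduct of representable presheaves indexed by the kernel of the cover. -/
abbrev Psh.cover₁ (P : Psh k A) : Psh k A := ∐ fun i : P.Syzygy => yo.obj i.1

/-- The canonical map onto the kernel of the cover. -/
abbrev Psh.coverρ (P : Psh k A) : P.cover₁ ⟶ P.cover := Sigma.desc fun i => Psh.el i.2.1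

theorem Psh.coverρ_π (P : Psh k A) : P.coverρ ≫ P.coverπ = 0 := by
  refine Sigma.hom_ext _ _ fun i => ?_
  rw [Sigma.ι_desc_assoc, Psh.el_comp, i.2.2, comp_zero]
  exact Psh.yo_hom_ext (Psh.el_app_id _)

theorem Psh.app_eq_zero_of_coverρ {P Z : Psh k A} {φ : P.cover ⟶ Z} (h : P.coverρ ≫ φ = 0)
    {a : A} (r : P.cover.sec a) (hr : Psh.app P.coverπ a r = 0) : Psh.app φ a r = 0 := by
  have h' := congrArg (fun t => Sigma.ι (fun i : P.Syzygy => (yo (k := k)).obj i.1)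
    ⟨a, r, hr⟩ ≫ t) h
  simp only [Sigma.ι_desc_assoc, comp_zero, Psh.el_comp] at h'
  rw [← Psh.el_app_id (Psh.app φ a r), h']
  rfl

/-- Every presheaf is a cokernel of a map between coproducts of representable presheaves. -/
def Psh.isColimitCover (P : Psh k A) : IsColimit (CokernelCofork.ofπ _ P.coverρ_π) :=
  CokernelCofork.IsColimit.ofπ _ _
    (fun {Z} φ hφ =>
      -- The canonical lift `P.lift` is not additive. What makes the induced map linear and natural
      -- is that a morphism killing the syzygies depends only on the image in `P` of the section it
      -- is applied to.
      have key : ∀ {a : A} (r r' : P.cover.sec a), Psh.app P.coverπ a r = Psh.app P.coverπ a r' →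
          Psh.app φ a r = Psh.app φ a r' := fun r r' h => by
        rw [← sub_eq_zero, ← map_sub] at h ⊢
        exact Psh.app_eq_zero_of_coverρ hφ _ h
      Psh.ofComponents
        (fun a =>
          { toFun := fun p => Psh.app φ a (P.lift p)
            map_add' := fun p q => by
              rw [← map_add]
              exact key _ _ (by simp only [map_add, Psh.coverπ_lift])
            map_smul' := fun c p => by
              rw [RingHom.id_apply, ← map_smul]
              exact key _ _ (by simp only [map_smul, Psh.coverπ_lift]) })
        (fun {X Y} f p => by
          change Psh.app φ X (P.lift _) = Z.res f (Psh.app φ Y (P.lift p))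
          rw [← Psh.app_res]
          exact key _ _ (by simp only [Psh.app_res, Psh.coverπ_lift])))
    (fun {Z} φ hφ => Psh.hom_ext fun a r => by
      rw [Psh.app_comp]
      change Psh.app φ a (P.lift _) = _
      rw [← sub_eq_zero, ← map_sub]
      exact Psh.app_eq_zero_of_coverρ hφ _ (by rw [map_sub, Psh.coverπ_lift, sub_self]))
    (fun {Z} φ hφ m hm => Psh.hom_ext fun a p => by
      change _ = Psh.app φ a (P.lift p)
      rw [← hm, Psh.app_comp, Psh.coverπ_lift])

/-- A transformation between cocontinuous functors on presheaves is invertible if it is so on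
representable presheaves. -/
theorem isIso_app_of_isIso_yo {E : Type v₁} [Category.{w₁} E] {T T' : Psh k A ⥤ E}
    [PreservesColimitsOfSize.{u, u} T] [PreservesColimitsOfSize.{u, u} T'] (θ : T ⟶ T')
    (h : ∀ a, IsIso (θ.app (yo.obj a))) (P : Psh k A) : IsIso (θ.app P) := by
  have : PreservesColimitsOfSize.{0, 0} T := preservesColimitsOfSize_shrink.{0, u, 0, u} T
  have : PreservesColimitsOfSize.{0, 0} T' := preservesColimitsOfSize_shrink.{0, u, 0, u} T'
  -- The diagram of the cokernel has two objects, each of them a coproduct of representables, so the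
  -- colimit criterion is applied once more to each.
  refine isIso_app_of_isColimit θ P.isColimitCover ?_
  rintro (_ | _)
  · exact isIso_app_of_isColimit θ (colimit.isColimit (Discrete.functor
      fun i : P.Syzygy => (yo (k := k)).obj i.1)) fun j => h _
  · exact isIso_app_of_isColimit θ (colimit.isColimit (Discrete.functor
      fun i : Σ a, P.sec a => (yo (k := k)).obj i.1)) fun j => h _

end Cocontinuity

/-! ### Right adjoints and cocontinuity of the coend extension -/

section DayCocontinuous

variable {k : Type u} [Field k]
  {A : Type u} [Category.{u} A] [Preadditive A] [Linear k A]
  {B : Type u} [Category.{u} B] [Preadditive B] [Linear k B]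
  {C : Type u} [Category.{u} C] [Preadditive C] [Linear k C]

namespace IsBilinear

variable {A : Type v₁} [Category.{w₁} A] [Preadditive A] [Linear k A]
  {B : Type v₂} [Category.{w₂} B] [Preadditive B] [Linear k B]
  {C : Type v₃} [Category.{w₃} C] [Preadditive C] [Linear k C] {T : A ⥤ B ⥤ C}

theorem additive (h : IsBilinear k T) (X : A) : (T.obj X).Additive :=
  ⟨h.map_add_right X _ _⟩

theorem linear (h : IsBilinear k T) (X : A) : (T.obj X).Linear k :=
  ⟨fun f r => h.map_smul_right X r f⟩

theorem additive_flip (h : IsBilinear k T) (Y : B) : (T.flip.obj Y).Additive :=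
  ⟨h.map_add_left _ _ Y⟩

theorem linear_flip (h : IsBilinear k T) (Y : B) : (T.flip.obj Y).Linear k :=
  ⟨fun f r => h.map_smul_left r f Y⟩

end IsBilinear

variable (T : A ⥤ B ⥤ C)

instance (P : Psh k A) : ((day T).obj P).Additive := (day_isBilinear T).additive P
instance (P : Psh k A) : ((day T).obj P).Linear k := (day_isBilinear T).linear P
instance (Q : Psh k B) : ((day (k := k) T).flip.obj Q).Additive := (day_isBilinear T).additive_flip Q
instance (Q : Psh k B) : ((day T).flip.obj Q).Linear k := (day_isBilinear T).linear_flip Q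

theorem dayMap_add_right {P P' : Psh k A} {Q Q' : Psh k B} (φ : P ⟶ P') (ψ ψ' : Q ⟶ Q') :
    dayMap T φ (ψ + ψ') = dayMap T φ ψ + dayMap T φ ψ' :=
  dayObj_hom_ext T fun X a b f p q => by
    rw [Psh.app_add, dayMap_gen, dayMap_gen, dayMap_gen, Psh.app_add, gen_add_right]

theorem dayMap_smul_right {P P' : Psh k A} {Q Q' : Psh k B} (φ : P ⟶ P') (c : k) (ψ : Q ⟶ Q') :
    dayMap T φ (c • ψ) = c • dayMap T φ ψ :=
  dayObj_hom_ext T fun X a b f p q => by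
    rw [Psh.app_smul, dayMap_gen, dayMap_gen, Psh.app_smul, gen_smul_right]

theorem dayMap_add_left {P P' : Psh k A} {Q Q' : Psh k B} (φ φ' : P ⟶ P') (ψ : Q ⟶ Q') :
    dayMap T (φ + φ') ψ = dayMap T φ ψ + dayMap T φ' ψ :=
  dayObj_hom_ext T fun X a b f p q => by
    rw [Psh.app_add, dayMap_gen, dayMap_gen, dayMap_gen, Psh.app_add, gen_add_mid]

theorem dayMap_smul_left {P P' : Psh k A} {Q Q' : Psh k B} (c : k) (φ : P ⟶ P') (ψ : Q ⟶ Q') :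
    dayMap T (c • φ) ψ = c • dayMap T φ ψ :=
  dayObj_hom_ext T fun X a b f p q => by
    rw [Psh.app_smul, dayMap_gen, dayMap_gen, Psh.app_smul, gen_smul_mid]

/-- Every generator is the image of one whose last entry is an identity. A morphism out of the coend
is therefore determined by its restrictions to `dayObj T P (yo b)`, which is what makes currying
injective. -/
theorem gen_dayMap_el {P : Psh k A} {Q : Psh k B} {X : C} {a : A} {b : B}
    (f : X ⟶ (T.obj a).obj b) (p : P.sec a) (q : Q.sec b) :
    Psh.app (dayMap T (𝟙 P) (Psh.el q)) X (gen T f p (yoMk (𝟙 b))) = gen T f p q := by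
  rw [dayMap_gen, Psh.el_app_id, Psh.app_id]

theorem gen_dayMap_el' {P : Psh k A} {Q : Psh k B} {X : C} {a : A} {b : B}
    (f : X ⟶ (T.obj a).obj b) (p : P.sec a) (q : Q.sec b) :
    Psh.app (dayMap T (Psh.el p) (𝟙 Q)) X (gen T f (yoMk (𝟙 a)) q) = gen T f p q := by
  rw [dayMap_gen, Psh.el_app_id, Psh.app_id]

/-- The right adjoint of `dayObj T P -`. -/
abbrev dayHomRight (P : Psh k A) : Psh k C ⥤ Psh k B := nerve (k := k) (yo (k := k) ⋙ (day T).obj P)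

/-- A morphism out of `dayObj T P (yo b)` as a section of `dayHomRight`. -/
def dayHomRightMk {P : Psh k A} {b : B} {R : Psh k C} (g : dayObj T P (yo.obj b) ⟶ R) :
    ((dayHomRight T P).obj R).sec b := g

/-- A section of `dayHomRight` as a morphism. -/
def dayHomRightHom {P : Psh k A} {b : B} {R : Psh k C} (g : ((dayHomRight T P).obj R).sec b) :
    dayObj T P (yo.obj b) ⟶ R := g

theorem dayHomRightHom_res {P : Psh k A} {b b' : B} {R : Psh k C} (β : b ⟶ b')
    (g : ((dayHomRight T P).obj R).sec b') :
    dayHomRightHom T (((dayHomRight T P).obj R).res β g) =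
      dayMap T (𝟙 P) (yo.map β) ≫ dayHomRightHom T g := rfl

theorem dayHomRightHom_add {P : Psh k A} {b : B} {R : Psh k C}
    (g h : ((dayHomRight T P).obj R).sec b) :
    dayHomRightHom T (g + h) = dayHomRightHom T g + dayHomRightHom T h := rfl

theorem dayHomRightHom_smul {P : Psh k A} {b : B} {R : Psh k C} (c : k)
    (g : ((dayHomRight T P).obj R).sec b) :
    dayHomRightHom T (c • g) = c • dayHomRightHom T g := rfl

theorem dayHomRightHom_ext {P : Psh k A} {b : B} {R : Psh k C}
    {g h : ((dayHomRight T P).obj R).sec b}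
    (e : dayHomRightHom T g = dayHomRightHom T h) : g = h := e

/-- Currying in the second variable. -/
def dayCurryRight {P : Psh k A} {Q : Psh k B} {R : Psh k C} (φ : dayObj T P Q ⟶ R) :
    Q ⟶ (dayHomRight T P).obj R :=
  Psh.ofComponents
    (fun b =>
      { toFun := fun q => dayHomRightMk T (dayMap T (𝟙 P) (Psh.el q) ≫ φ)
        map_add' := fun q q' => by
          refine dayHomRightHom_ext T ?_
          change dayMap T _ _ ≫ φ = _
          rw [Psh.el_add, dayMap_add_right]
          exact Preadditive.add_comp _ _ _ _ _ _
        map_smul' := fun c q => by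
          refine dayHomRightHom_ext T ?_
          change dayMap T _ _ ≫ φ = _
          rw [Psh.el_smul, dayMap_smul_right]
          exact Linear.smul_comp _ _ _ _ _ _ })
    (fun {b b'} β q => by
      refine dayHomRightHom_ext T ?_
      rw [dayHomRightHom_res]
      change _ ≫ φ = _ ≫ _ ≫ φ
      rw [← Category.assoc]
      refine congrArg (· ≫ φ) (dayObj_hom_ext T fun X a b f p q => ?_)
      rw [Psh.app_comp, dayMap_gen, dayMap_gen, dayMap_gen, ← Psh.yo_map_el, Psh.app_comp]
      simp only [Psh.app_id])

theorem dayHomRightHom_curry {P : Psh k A} {Q : Psh k B} {R : Psh k C} (φ : dayObj T P Q ⟶ R) {b : B}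
    (q : Q.sec b) :
    dayHomRightHom T (Psh.app (dayCurryRight T φ) b q) = dayMap T (𝟙 P) (Psh.el q) ≫ φ := rfl

/-- Uncurrying in the second variable. -/
def dayUncurryRight {P : Psh k A} {Q : Psh k B} {R : Psh k C} (ψ : Q ⟶ (dayHomRight T P).obj R) :
    dayObj T P Q ⟶ R :=
  descHom T (fun X a b f p q => Psh.app (dayHomRightHom T (Psh.app ψ b q)) X (gen T f p (yoMk (𝟙 b))))
    (fun X a b f f' p q => by rw [gen_add_left, map_add])
    (fun X a b c f p q => by rw [gen_smul_left, map_smul])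
    (fun X a b f p p' q => by rw [gen_add_mid, map_add])
    (fun X a b c f p q => by rw [gen_smul_mid, map_smul])
    (fun X a b f p q q' => by rw [map_add, dayHomRightHom_add, Psh.app_add])
    (fun X a b c f p q => by rw [map_smul, dayHomRightHom_smul, Psh.app_smul])
    (fun X a a' b α f p q => by rw [gen_mid_res])
    (fun X a b b' β f p q => by
      rw [Psh.app_res, dayHomRightHom_res, Psh.app_comp, dayMap_gen, yo_app, Psh.app_id,
        Category.id_comp, ← gen_right_res, yo_res, Category.comp_id])
    (fun X Y a b h f p q => by rw [← Psh.app_res, gen_res])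

theorem dayUncurryRight_gen {P : Psh k A} {Q : Psh k B} {R : Psh k C} (ψ : Q ⟶ (dayHomRight T P).obj R)
    {X : C} {a : A} {b : B} (f : X ⟶ (T.obj a).obj b) (p : P.sec a) (q : Q.sec b) :
    Psh.app (dayUncurryRight T ψ) X (gen T f p q) =
      Psh.app (dayHomRightHom T (Psh.app ψ b q)) X (gen T f p (yoMk (𝟙 b))) := by
  unfold dayUncurryRight
  rw [descHom_gen]

theorem dayUncurryRight_curry {P : Psh k A} {Q : Psh k B} {R : Psh k C} (φ : dayObj T P Q ⟶ R) :
    dayUncurryRight T (dayCurryRight T φ) = φ :=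
  dayObj_hom_ext T fun X a b f p q => by
    rw [dayUncurryRight_gen, dayHomRightHom_curry, Psh.app_comp, gen_dayMap_el]

/-- The extension of `T` to presheaves has right adjoints in the second variable. -/
def dayAdjRight (P : Psh k A) : (day T).obj P ⊣ dayHomRight (k := k) T P :=
  Adjunction.mkOfHomEquiv
    { homEquiv := fun Q R =>
        { toFun := fun φ => dayCurryRight T φ
          invFun := fun ψ => dayUncurryRight T ψ
          left_inv := fun φ => dayUncurryRight_curry T φ
          right_inv := fun ψ => Psh.hom_ext fun b q => by
            refine dayHomRightHom_ext T (dayObj_hom_ext T fun X a b' f p g => ?_)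
            rw [dayHomRightHom_curry, Psh.app_comp, dayMap_gen, dayUncurryRight_gen, Psh.app_id,
              ← yoMk_hom g, Psh.el_app, Psh.app_res, dayHomRightHom_res, Psh.app_comp, dayMap_gen,
              yo_app, Psh.app_id, Category.id_comp] }
      homEquiv_naturality_left_symm := fun f g => dayObj_hom_ext T fun X a b h p q => by
        change Psh.app (dayUncurryRight T _) X _ = Psh.app (dayMap T (𝟙 P) f ≫ dayUncurryRight T _) X _
        rw [Psh.app_comp, dayMap_gen, dayUncurryRight_gen, dayUncurryRight_gen, Psh.app_id, Psh.app_comp]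
      homEquiv_naturality_right := fun f g => Psh.hom_ext fun b q =>
        (Category.assoc (dayMap T (𝟙 P) (Psh.el q)) f g).symm }

/-- The right adjoint of `dayObj T - Q`. -/
abbrev dayHomLeft (Q : Psh k B) : Psh k C ⥤ Psh k A := nerve (k := k) (yo (k := k) ⋙ (day T).flip.obj Q)

/-- A morphism out of `dayObj T (yo b) Q` as a section of `dayHomLeft`. -/
def dayHomLeftMk {Q : Psh k B} {b : A} {R : Psh k C} (g : dayObj T (yo.obj b) Q ⟶ R) :
    ((dayHomLeft T Q).obj R).sec b := g

/-- A section of `dayHomLeft` as a morphism. -/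
def dayHomLeftHom {Q : Psh k B} {b : A} {R : Psh k C} (g : ((dayHomLeft T Q).obj R).sec b) :
    dayObj T (yo.obj b) Q ⟶ R := g

theorem dayHomLeftHom_res {Q : Psh k B} {b b' : A} {R : Psh k C} (β : b ⟶ b')
    (g : ((dayHomLeft T Q).obj R).sec b') :
    dayHomLeftHom T (((dayHomLeft T Q).obj R).res β g) =
      dayMap T (yo.map β) (𝟙 Q) ≫ dayHomLeftHom T g := rfl

theorem dayHomLeftHom_add {Q : Psh k B} {b : A} {R : Psh k C}
    (g h : ((dayHomLeft T Q).obj R).sec b) :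
    dayHomLeftHom T (g + h) = dayHomLeftHom T g + dayHomLeftHom T h := rfl

theorem dayHomLeftHom_smul {Q : Psh k B} {b : A} {R : Psh k C} (c : k)
    (g : ((dayHomLeft T Q).obj R).sec b) :
    dayHomLeftHom T (c • g) = c • dayHomLeftHom T g := rfl

theorem dayHomLeftHom_ext {Q : Psh k B} {b : A} {R : Psh k C}
    {g h : ((dayHomLeft T Q).obj R).sec b}
    (e : dayHomLeftHom T g = dayHomLeftHom T h) : g = h := e

/-- Currying in the first variable. -/
def dayCurryLeft {Q : Psh k B} {P : Psh k A} {R : Psh k C} (φ : dayObj T P Q ⟶ R) :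
    P ⟶ (dayHomLeft T Q).obj R :=
  Psh.ofComponents
    (fun b =>
      { toFun := fun q => dayHomLeftMk T (dayMap T (Psh.el q) (𝟙 Q) ≫ φ)
        map_add' := fun q q' => by
          refine dayHomLeftHom_ext T ?_
          change dayMap T _ _ ≫ φ = _
          rw [Psh.el_add, dayMap_add_left]
          exact Preadditive.add_comp _ _ _ _ _ _
        map_smul' := fun c q => by
          refine dayHomLeftHom_ext T ?_
          change dayMap T _ _ ≫ φ = _
          rw [Psh.el_smul, dayMap_smul_left]
          exact Linear.smul_comp _ _ _ _ _ _ })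
    (fun {b b'} β q => by
      refine dayHomLeftHom_ext T ?_
      rw [dayHomLeftHom_res]
      change _ ≫ φ = _ ≫ _ ≫ φ
      rw [← Category.assoc]
      refine congrArg (· ≫ φ) (dayObj_hom_ext T fun X a b f p q => ?_)
      rw [Psh.app_comp, dayMap_gen, dayMap_gen, dayMap_gen, ← Psh.yo_map_el, Psh.app_comp]
      simp only [Psh.app_id])

theorem dayHomLeftHom_curry {Q : Psh k B} {P : Psh k A} {R : Psh k C} (φ : dayObj T P Q ⟶ R) {b : A}
    (q : P.sec b) :
    dayHomLeftHom T (Psh.app (dayCurryLeft T φ) b q) = dayMap T (Psh.el q) (𝟙 Q) ≫ φ := rfl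

/-- Uncurrying in the first variable. -/
def dayUncurryLeft {Q : Psh k B} {P : Psh k A} {R : Psh k C} (ψ : P ⟶ (dayHomLeft T Q).obj R) :
    dayObj T P Q ⟶ R :=
  descHom T (fun X a b f p q => Psh.app (dayHomLeftHom T (Psh.app ψ a p)) X (gen T f (yoMk (𝟙 a)) q))
    (fun X a b f f' p q => by rw [gen_add_left, map_add])
    (fun X a b c f p q => by rw [gen_smul_left, map_smul])
    (fun X a b f p p' q => by rw [map_add, dayHomLeftHom_add, Psh.app_add])
    (fun X a b c f p q => by rw [map_smul, dayHomLeftHom_smul, Psh.app_smul])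
    (fun X a b f p q q' => by rw [gen_add_right, map_add])
    (fun X a b c f p q => by rw [gen_smul_right, map_smul])
    (fun X a a' b α f p q => by
      rw [Psh.app_res, dayHomLeftHom_res, Psh.app_comp, dayMap_gen, yo_app, Psh.app_id,
        Category.id_comp, ← gen_mid_res, yo_res, Category.comp_id])
    (fun X a b b' β f p q => by rw [gen_right_res])
    (fun X Y a b h f p q => by rw [← Psh.app_res, gen_res])

theorem dayUncurryLeft_gen {Q : Psh k B} {P : Psh k A} {R : Psh k C} (ψ : P ⟶ (dayHomLeft T Q).obj R)
    {X : C} {a : A} {b : B} (f : X ⟶ (T.obj a).obj b) (p : P.sec a) (q : Q.sec b) :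
    Psh.app (dayUncurryLeft T ψ) X (gen T f p q) =
      Psh.app (dayHomLeftHom T (Psh.app ψ a p)) X (gen T f (yoMk (𝟙 a)) q) := by
  unfold dayUncurryLeft
  rw [descHom_gen]

theorem dayUncurryLeft_curry {P : Psh k A} {Q : Psh k B} {R : Psh k C} (φ : dayObj T P Q ⟶ R) :
    dayUncurryLeft T (dayCurryLeft T φ) = φ :=
  dayObj_hom_ext T fun X a b f p q => by
    rw [dayUncurryLeft_gen, dayHomLeftHom_curry, Psh.app_comp, gen_dayMap_el']

/-- The extension of `T` to presheaves has right adjoints in the first variable. -/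
def dayAdjLeft (Q : Psh k B) : (day T).flip.obj Q ⊣ dayHomLeft (k := k) T Q :=
  Adjunction.mkOfHomEquiv
    { homEquiv := fun P R =>
        { toFun := fun φ => dayCurryLeft T φ
          invFun := fun ψ => dayUncurryLeft T ψ
          left_inv := fun φ => dayUncurryLeft_curry T φ
          right_inv := fun ψ => Psh.hom_ext fun b q => by
            refine dayHomLeftHom_ext T (dayObj_hom_ext T fun X a b' f p g => ?_)
            rw [dayHomLeftHom_curry, Psh.app_comp, dayMap_gen, dayUncurryLeft_gen, Psh.app_id,
              ← yoMk_hom p, Psh.el_app, Psh.app_res, dayHomLeftHom_res, Psh.app_comp, dayMap_gen,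
              yo_app, Psh.app_id, Category.id_comp] }
      homEquiv_naturality_left_symm := fun f g => dayObj_hom_ext T fun X a b h p q => by
        change Psh.app (dayUncurryLeft T _) X _ = Psh.app (dayMap T f (𝟙 Q) ≫ dayUncurryLeft T _) X _
        rw [Psh.app_comp, dayMap_gen, dayUncurryLeft_gen, dayUncurryLeft_gen, Psh.app_id, Psh.app_comp]
      homEquiv_naturality_right := fun f g => Psh.hom_ext fun b q =>
        (Category.assoc (dayMap T (Psh.el q) (𝟙 Q)) f g).symm }

/-- In each variable the action is a left adjoint, by currying out of the coend. -/
theorem SemigroupModule.psh_cocontinuous {S M : Type u} [Category.{u} S] [Preadditive S]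
    [Linear k S] [SemigroupCategory k S] [Category.{u} M] [Preadditive M] [Linear k M]
    (σ : SemigroupModule k S M) : SemigroupModule.Cocontinuous.{u} σ.psh :=
  ⟨fun P => (dayAdjRight σ.act P).leftAdjoint_preservesColimits,
    fun Q => (dayAdjLeft σ.act Q).leftAdjoint_preservesColimits⟩

end DayCocontinuous

/-! ### Finitely generated projective presheaves -/

section CompactProjective

open Limits

/-- Morphisms out of `Q` lift along jointly epimorphic families up to finite sums. -/
def LiftsFinitely {N : Type v₁} [Category.{w₁} N] [Preadditive N] (Q : N) : Prop :=
  ∀ {I : Type w₂} {X : I → N} {Y : N} (f : ∀ i, X i ⟶ Y), JointlyEpi f → ∀ g : Q ⟶ Y,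
    ∃ (t : Finset I) (s : ∀ i, Q ⟶ X i), ∑ i ∈ t, s i ≫ f i = g

/-- A left adjoint preserves objects satisfying `LiftsFinitely` if its right adjoint preserves
jointly epimorphic families. -/
theorem LiftsFinitely.map {N : Type v₁} [Category.{w₁} N] [Preadditive N] {N' : Type v₂}
    [Category.{w₂} N'] [Preadditive N'] {L : N ⥤ N'} {R : N' ⥤ N} [L.Additive] (adj : L ⊣ R)
    (hR : ∀ {I : Type w₃} {X : I → N'} {Y : N'} {f : ∀ i, X i ⟶ Y}, JointlyEpi f →
      JointlyEpi fun i => R.map (f i))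
    {Q : N} (hQ : LiftsFinitely.{v₁, w₁, w₃} Q) : LiftsFinitely.{v₂, w₂, w₃} (L.obj Q) := by
  intro I X Y f hf g
  obtain ⟨t, s, hs⟩ := hQ _ (hR hf) (adj.homEquiv _ _ g)
  refine ⟨t, fun i => (adj.homEquiv _ _).symm (s i), ?_⟩
  rw [← (adj.homEquiv _ _).symm_apply_apply g, ← hs]
  simp only [Adjunction.homEquiv_counit, Functor.map_sum, Preadditive.sum_comp, Functor.map_comp,
    Category.assoc, Adjunction.counit_naturality]

variable {k : Type u} [Field k] {A : Type u} [Category.{u} A] [Preadditive A] [Linear k A]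

/-- `Q` is a direct summand of a finite direct sum of objects of the form `K X`. -/
def FinRetract {B : Type v₁} {N : Type v₂} [Category.{w₂} N] [Preadditive N] (K : B → N) (Q : N) :
    Prop :=
  ∃ (n : ℕ) (X : Fin n → B) (s : ∀ j, Q ⟶ K (X j)) (q : ∀ j, K (X j) ⟶ Q), ∑ j, s j ≫ q j = 𝟙 Q

theorem FinRetract.of_finset {B : Type v₁} {N : Type v₂} [Category.{w₂} N] [Preadditive N]
    {K : B → N} {Q : N} {I : Type v₃} (t : Finset I) (X : I → B) (s : ∀ j, Q ⟶ K (X j))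
    (q : ∀ j, K (X j) ⟶ Q) (h : ∑ j ∈ t, s j ≫ q j = 𝟙 Q) : FinRetract K Q := by
  refine ⟨t.card, fun j => X (t.equivFin.symm j), fun j => s _, fun j => q _, ?_⟩
  rw [← h, ← Finset.sum_coe_sort t, t.equivFin.symm.sum_comp (fun j : t => s j ≫ q j)]

/-- By Yoneda, a morphism out of a representable is a section of `Y`, and a section of `Y` is a
finite sum of sections coming from the members of the family. The property passes to finite sums and
summands. -/
theorem Psh.liftsFinitely_of_finRetract {Q : Psh k A} (h : FinRetract (yo (k := k)).obj Q) :
    LiftsFinitely.{u + 1, u, w₂} Q := by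
  classical
  obtain ⟨n, a, s, q, hsq⟩ := h
  intro I X Y f hf g
  choose t x hx using fun j => hf.exists_sum (Psh.app (q j ≫ g) (a j) (yoMk (𝟙 _)))
  -- Each summand `j` uses its own finite set `t j` of indices. These are merged into one, with
  -- coefficient zero where `i` is not in `t j`.
  refine ⟨Finset.univ.biUnion t, fun i => ∑ j, if i ∈ t j then s j ≫ Psh.el (x j i) else 0, ?_⟩
  have hj : ∀ j, ∑ i ∈ t j, Psh.el (x j i) ≫ f i = q j ≫ g := fun j => by
    rw [← Psh.el_eta (q j ≫ g), ← hx j, Psh.el_sum]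
    simp only [Psh.el_comp]
  calc _ = ∑ j, ∑ i ∈ Finset.univ.biUnion t,
        (if i ∈ t j then s j ≫ Psh.el (x j i) ≫ f i else 0) := by
        rw [Finset.sum_comm]
        refine Finset.sum_congr rfl fun i _ => ?_
        rw [Preadditive.sum_comp]
        refine Finset.sum_congr rfl fun j _ => ?_
        split_ifs <;> simp
    _ = ∑ j, s j ≫ q j ≫ g := by
        refine Finset.sum_congr rfl fun j _ => ?_
        rw [← hj j, Preadditive.comp_sum, ← Finset.sum_filter]
        refine Finset.sum_congr ?_ fun _ _ => rfl
        ext i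
        simp only [Finset.mem_filter, Finset.mem_biUnion, Finset.mem_univ, true_and]
        exact ⟨fun h => h.2, fun h => ⟨⟨j, h⟩, h⟩⟩
    _ = g := by
        simp only [← Category.assoc, ← Preadditive.sum_comp, hsq, Category.id_comp]

/-- An epimorphism is a jointly epimorphic family with one member, which gives projectivity. Lifting
the identity of `Q` along a family exhibits a finite subfamily that is already jointly epimorphic.
-/
theorem LiftsFinitely.fgProj {Q : Psh k A} (h : LiftsFinitely.{u + 1, u, u} Q) :
    fgProj (Psh k A) Q := by
  refine ⟨⟨fun {E X} g e _ => ?_⟩, fun I X f hf => ?_⟩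
  · obtain ⟨t, s, hs⟩ := h (fun _ : PUnit => e) (fun Z a b hab => (cancel_epi e).1 (hab ⟨⟩)) g
    exact ⟨∑ i ∈ t, s i, by rw [Preadditive.sum_comp, hs]⟩
  · obtain ⟨t, s, hs⟩ := h f hf (𝟙 Q)
    refine ⟨t, fun Z a b hab => ?_⟩
    rw [← Category.id_comp a, ← Category.id_comp b, ← hs, Preadditive.sum_comp,
      Preadditive.sum_comp]
    exact Finset.sum_congr rfl fun i hi => by
      rw [Category.assoc, Category.assoc, hab ⟨i, hi⟩]

/-- Finite generation, applied to the cover by all sections, gives an epimorphism from a finite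
biproduct of representables, and projectivity splits it. -/
theorem Psh.finRetract_of_fgProj {Q : Psh k A} (h : fgProj (Psh k A) Q) :
    FinRetract (yo (k := k)).obj Q := by
  obtain ⟨h₁, h₂⟩ := h
  obtain ⟨t, ht⟩ := h₂ _ _ _ Q.jointlyEpi_el
  have : HasFiniteBiproducts (Psh k A) := HasFiniteBiproducts.of_hasFiniteCoproducts
  let x : Fin t.card → Σ a, Q.sec a := fun j => (t.equivFin.symm j).1
  let Y : Fin t.card → Psh k A := fun j => yo.obj (x j).1
  let f : (⨁ Y) ⟶ Q := biproduct.desc fun j => Psh.el (x j).2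
  have hf : ∀ j, biproduct.ι Y j ≫ f = Psh.el (x j).2 := fun j => biproduct.ι_desc _ _
  have : Epi f := ⟨fun a b e => ht a b fun i => by
    obtain ⟨j, rfl⟩ := t.equivFin.symm.surjective i
    change Psh.el (x j).2 ≫ a = Psh.el (x j).2 ≫ b
    rw [← hf, Category.assoc, Category.assoc, e]⟩
  refine ⟨t.card, fun j => (x j).1, fun j => Projective.factorThru (𝟙 Q) f ≫ biproduct.π Y j,
    fun j => Psh.el (x j).2, ?_⟩
  calc _ = Projective.factorThru (𝟙 Q) f ≫ (∑ j, biproduct.π Y j ≫ biproduct.ι Y j) ≫ f := by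
        simp only [Preadditive.comp_sum, Preadditive.sum_comp, Category.assoc, hf]
    _ = 𝟙 Q := by rw [biproduct.total, Category.id_comp, Projective.factorThru_comp]

theorem Psh.fgProj_iff_finRetract {Q : Psh k A} :
    fgProj (Psh k A) Q ↔ FinRetract (yo (k := k)).obj Q :=
  ⟨Psh.finRetract_of_fgProj, fun h => LiftsFinitely.fgProj (Psh.liftsFinitely_of_finRetract h)⟩

end CompactProjective

/-! ### Componentwise form of the adjunction axioms -/

section Wrappers

variable {k : Type u} [Field k]
  {S : Type v₁} [Category.{w₁} S] [Preadditive S] [Linear k S] [SemigroupCategory k S]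

local notation:70 F:70 " ⊠ " G:71 =>
  CategoryTheory.Functor.obj (CategoryTheory.Functor.obj (tensor k) F) G
local notation:81 F:82 " ◁ " f:81 =>
  CategoryTheory.Functor.map (CategoryTheory.Functor.obj (tensor k) F) f
local notation:81 f:81 " ▷ " G:82 =>
  NatTrans.app (CategoryTheory.Functor.map (tensor k) f) G
local notation "α_" => SemigroupCategory.assoc (k := k)

namespace Adj

variable {F F' : S} (d : Adj k F F')

/-- The component of `ηˡ`. -/
def etaL (H : S) : H ⟶ H ⊠ (F' ⊠ F) := d.ηl.app H
/-- The component of `εˡ`. -/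
def epsL (H : S) : H ⊠ (F ⊠ F') ⟶ H := d.εl.app H
/-- The component of `ηʳ`. -/
def etaR (H : S) : H ⟶ (F' ⊠ F) ⊠ H := d.ηr.app H
/-- The component of `εʳ`. -/
def epsR (H : S) : (F ⊠ F') ⊠ H ⟶ H := d.εr.app H

theorem epsL_naturality {H K : S} (f : H ⟶ K) : f ▷ (F ⊠ F') ≫ d.epsL K = d.epsL H ≫ f :=
  d.εl.naturality f

theorem etaR_naturality {H K : S} (f : H ⟶ K) : f ≫ d.etaR K = d.etaR H ≫ (F' ⊠ F) ◁ f :=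
  d.ηr.naturality f

theorem epsR_naturality {H K : S} (f : H ⟶ K) : (F ⊠ F') ◁ f ≫ d.epsR K = d.epsR H ≫ f :=
  d.εr.naturality f

theorem epsL_tensor (H K : S) : d.epsL (H ⊠ K) = (α_ H K (F ⊠ F')).hom ≫ H ◁ d.epsL K :=
  d.εl_module H K

theorem epsR_tensor (H K : S) :
    (α_ (F ⊠ F') H K).hom ≫ d.epsR (H ⊠ K) = d.epsR H ▷ K :=
  d.εr_module H K

theorem etaL_triangle (H : S) :
    d.etaL H ▷ F' ≫ (α_ H F' F).inv ▷ F' ≫ (α_ (H ⊠ F') F F').hom ≫ d.epsL (H ⊠ F') = 𝟙 _ :=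
  d.left_triangle H

theorem etaL_triangle' (H : S) :
    d.etaL (H ⊠ F) ≫ (α_ (H ⊠ F) F' F).inv ≫ (α_ H F F').hom ▷ F ≫ d.epsL H ▷ F = 𝟙 _ :=
  d.left_triangle' H

theorem etaL_epsR : d.etaL F ≫ (α_ F F' F).inv ≫ d.epsR F = 𝟙 F := d.zigzag

theorem etaR_epsL : d.etaR F' ≫ (α_ F' F F').hom ≫ d.epsL F' = 𝟙 F' := d.zigzag'

theorem etaL_compat (H K : S) : d.etaL H ▷ K ≫ (α_ H (F' ⊠ F) K).hom = H ◁ d.etaR K :=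
  d.unit_compat H K

theorem epsL_compat (H K : S) : (α_ H (F ⊠ F') K).hom ≫ H ◁ d.epsR K = d.epsL H ▷ K :=
  d.counit_compat H K

end Adj

end Wrappers

/-! ### The unit presheaf and its unitors -/

section UnitPresheaf

variable {k : Type u} [Field k]
  {S : Type u} [Category.{u} S] [Preadditive S] [Linear k S] [SemigroupCategory k S]

local notation:70 F:70 " ⊠ " G:71 =>
  CategoryTheory.Functor.obj (CategoryTheory.Functor.obj (tensor k) F) G
local notation:81 F:82 " ◁ " f:81 =>
  CategoryTheory.Functor.map (CategoryTheory.Functor.obj (tensor k) F) f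
local notation:81 f:81 " ▷ " G:82 =>
  NatTrans.app (CategoryTheory.Functor.map (tensor k) f) G
local notation "α_" => SemigroupCategory.assoc (k := k)

/-- The pairs of a left module transformation `- ⊠ X ⟶ 𝟭` and a right module transformation
`X ⊠ - ⟶ 𝟭` that are compatible with each other. -/
def unitSub (X : S) :
    Submodule k (((tensor k).flip.obj X ⟶ 𝟭 S) × ((tensor k).obj X ⟶ 𝟭 S)) where
  carrier := {t |
    (∀ H K : S, (show (H ⊠ K) ⊠ X ⟶ H ⊠ K from t.1.app (H ⊠ K)) =
      (α_ H K X).hom ≫ H ◁ (show K ⊠ X ⟶ K from t.1.app K)) ∧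
    (∀ H K : S, (α_ X H K).hom ≫ (show X ⊠ (H ⊠ K) ⟶ H ⊠ K from t.2.app (H ⊠ K)) =
      (show X ⊠ H ⟶ H from t.2.app H) ▷ K) ∧
    (∀ H K : S, (α_ H X K).hom ≫ H ◁ (show X ⊠ K ⟶ K from t.2.app K) =
      (show H ⊠ X ⟶ H from t.1.app H) ▷ K)}
  add_mem' {t t'} := by
    rintro ⟨h₁, h₂, h₃⟩ ⟨h₁', h₂', h₃'⟩
    have b := SemigroupCategory.bilinear (k := k) (S := S)
    refine ⟨fun H K => ?_, fun H K => ?_, fun H K => ?_⟩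
    · refine (congrArg₂ (· + ·) (h₁ H K) (h₁' H K)).trans ?_
      rw [← Preadditive.comp_add, ← b.map_add_right]; rfl
    · refine (Preadditive.comp_add _ _ _ (α_ X H K).hom _ _).trans ?_
      refine (congrArg₂ (· + ·) (h₂ H K) (h₂' H K)).trans ?_
      rw [← b.map_add_left]; rfl
    · refine (congrArg (fun z => (α_ H X K).hom ≫ z) (b.map_add_right H _ _)).trans ?_
      refine (Preadditive.comp_add _ _ _ (α_ H X K).hom _ _).trans ?_
      refine (congrArg₂ (· + ·) (h₃ H K) (h₃' H K)).trans ?_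
      rw [← b.map_add_left]; rfl
  zero_mem' := by
    have b := SemigroupCategory.bilinear (k := k) (S := S)
    have h₁ : ∀ (F : S) {H K : S}, F ◁ (0 : H ⟶ K) = 0 := fun F H K => by
      have := b.map_smul_right F (0 : k) (0 : H ⟶ K)
      rwa [zero_smul, zero_smul] at this
    have h₂ : ∀ (F : S) {H K : S}, (0 : H ⟶ K) ▷ F = 0 := fun F H K => by
      have := b.map_smul_left (0 : k) (0 : H ⟶ K) F
      rwa [zero_smul, zero_smul] at this
    refine ⟨fun H K => ?_, fun H K => ?_, fun H K => ?_⟩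
    · change (0 : _ ⟶ H ⊠ K) = (α_ H K X).hom ≫ H ◁ (0 : K ⊠ X ⟶ K)
      rw [h₁, Limits.comp_zero]
    · change (α_ X H K).hom ≫ (0 : _ ⟶ H ⊠ K) = (0 : X ⊠ H ⟶ H) ▷ K
      rw [h₂, Limits.comp_zero]
    · change (α_ H X K).hom ≫ H ◁ (0 : X ⊠ K ⟶ K) = (0 : H ⊠ X ⟶ H) ▷ K
      rw [h₁, h₂, Limits.comp_zero]
  smul_mem' c t := by
    rintro ⟨h₁, h₂, h₃⟩
    have b := SemigroupCategory.bilinear (k := k) (S := S)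
    refine ⟨fun H K => ?_, fun H K => ?_, fun H K => ?_⟩
    · refine (congrArg (c • ·) (h₁ H K)).trans ?_
      rw [← Linear.comp_smul, ← b.map_smul_right]; rfl
    · refine (Linear.comp_smul _ _ _ (α_ X H K).hom _ _).trans ?_
      refine (congrArg (c • ·) (h₂ H K)).trans ?_
      rw [← b.map_smul_left]; rfl
    · refine (congrArg (fun z => (α_ H X K).hom ≫ z) (b.map_smul_right H c _)).trans ?_
      refine (Linear.comp_smul _ _ _ (α_ H X K).hom _ _).trans ?_
      refine (congrArg (c • ·) (h₃ H K)).trans ?_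
      rw [← b.map_smul_left]; rfl

/-- The left component of an element of `unitSub X`. -/
def unitSubL {X : S} (t : unitSub (k := k) X) (H : S) : H ⊠ X ⟶ H := t.1.1.app H

/-- The right component of an element of `unitSub X`. -/
def unitSubR {X : S} (t : unitSub (k := k) X) (H : S) : X ⊠ H ⟶ H := t.1.2.app H

theorem unitSub_ext {X : S} {t t' : unitSub (k := k) X} (hl : ∀ H, unitSubL t H = unitSubL t' H)
    (hr : ∀ H, unitSubR t H = unitSubR t' H) : t = t' := by
  refine Subtype.ext (Prod.ext ?_ ?_)
  · ext H; exact hl H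
  · ext H; exact hr H

/-- Construct an element of `unitSub X` from its components. -/
def unitSubMk {X : S} (l : ∀ H : S, H ⊠ X ⟶ H) (r : ∀ H : S, X ⊠ H ⟶ H)
    (hl : ∀ {H K : S} (f : H ⟶ K), f ▷ X ≫ l K = l H ≫ f)
    (hr : ∀ {H K : S} (f : H ⟶ K), X ◁ f ≫ r K = r H ≫ f)
    (ml : ∀ H K : S, l (H ⊠ K) = (α_ H K X).hom ≫ H ◁ l K)
    (mr : ∀ H K : S, (α_ X H K).hom ≫ r (H ⊠ K) = r H ▷ K)
    (hlr : ∀ H K : S, (α_ H X K).hom ≫ H ◁ r K = l H ▷ K) : unitSub (k := k) X :=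
  ⟨({ app := l, naturality := fun _ _ f => hl f }, { app := r, naturality := fun _ _ f => hr f }),
    ml, mr, hlr⟩

theorem unitSubL_naturality {X : S} (t : unitSub (k := k) X) {H K : S} (f : H ⟶ K) :
    f ▷ X ≫ unitSubL t K = unitSubL t H ≫ f := t.1.1.naturality f

theorem unitSubR_naturality {X : S} (t : unitSub (k := k) X) {H K : S} (f : H ⟶ K) :
    X ◁ f ≫ unitSubR t K = unitSubR t H ≫ f := t.1.2.naturality f

theorem unitSubL_tensor {X : S} (t : unitSub (k := k) X) (H K : S) :
    unitSubL t (H ⊠ K) = (α_ H K X).hom ≫ H ◁ unitSubL t K := t.2.1 H K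

theorem unitSubR_tensor {X : S} (t : unitSub (k := k) X) (H K : S) :
    (α_ X H K).hom ≫ unitSubR t (H ⊠ K) = unitSubR t H ▷ K := t.2.2.1 H K

theorem unitSub_compat {X : S} (t : unitSub (k := k) X) (H K : S) :
    (α_ H X K).hom ≫ H ◁ unitSubR t K = unitSubL t H ▷ K := t.2.2.2 H K

/-- Restriction of elements of `unitSub X`. -/
def unitSubRes {X Y : S} (f : X ⟶ Y) : unitSub (k := k) Y →ₗ[k] unitSub (k := k) X where
  toFun t := unitSubMk (fun H => H ◁ f ≫ unitSubL t H) (fun H => f ▷ H ≫ unitSubR t H)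
    (fun {H K} g => by
      rw [Category.assoc, ← unitSubL_naturality, NatTrans.naturality_assoc])
    (fun {H K} g => by
      rw [Category.assoc, ← unitSubR_naturality, NatTrans.naturality_assoc])
    (fun H K => by
      rw [unitSubL_tensor, Functor.map_comp, reassoc_of% (SemigroupCategory.assoc_nat₃ H K f)])
    (fun H K => by
      rw [Functor.map_comp, NatTrans.comp_app, ← unitSubR_tensor,
        reassoc_of% (SemigroupCategory.assoc_nat₁ f H K)])
    (fun H K => by
      rw [Functor.map_comp, Functor.map_comp, NatTrans.comp_app, ← unitSub_compat,
        reassoc_of% (SemigroupCategory.assoc_nat₂ H f K)])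
  map_add' t t' := unitSub_ext (fun H => Preadditive.comp_add _ _ _ (H ◁ f) _ _)
    (fun H => Preadditive.comp_add _ _ _ (f ▷ H) _ _)
  map_smul' c t := unitSub_ext (fun H => Linear.comp_smul _ _ _ (H ◁ f) _ _)
    (fun H => Linear.comp_smul _ _ _ (f ▷ H) _ _)

variable (k S) in
/-- The unit presheaf of a rigid semigroup category. -/
def unitPsh : Psh k S :=
  Psh.ofSections (fun X => unitSub (k := k) X) (fun f => unitSubRes f)
    (fun X => LinearMap.ext fun t => unitSub_ext
      (fun H => by
        change H ◁ (𝟙 X) ≫ unitSubL t H = unitSubL t H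
        rw [CategoryTheory.Functor.map_id, Category.id_comp])
      (fun H => by
        change (𝟙 X) ▷ H ≫ unitSubR t H = unitSubR t H
        rw [CategoryTheory.Functor.map_id, NatTrans.id_app, Category.id_comp]))
    (fun f g => LinearMap.ext fun t => unitSub_ext
      (fun H => by
        change H ◁ (f ≫ g) ≫ unitSubL t H = H ◁ f ≫ H ◁ g ≫ unitSubL t H
        rw [Functor.map_comp, Category.assoc])
      (fun H => by
        change (f ≫ g) ▷ H ≫ unitSubR t H = f ▷ H ≫ g ▷ H ≫ unitSubR t H
        rw [Functor.map_comp, NatTrans.comp_app, Category.assoc]))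
    (fun f g => LinearMap.ext fun t => unitSub_ext
      (fun H => by
        change H ◁ (f + g) ≫ unitSubL t H = H ◁ f ≫ unitSubL t H + H ◁ g ≫ unitSubL t H
        rw [SemigroupCategory.bilinear.map_add_right, Preadditive.add_comp])
      (fun H => by
        change (f + g) ▷ H ≫ unitSubR t H = f ▷ H ≫ unitSubR t H + g ▷ H ≫ unitSubR t H
        rw [SemigroupCategory.bilinear.map_add_left, Preadditive.add_comp]))
    (fun c f => LinearMap.ext fun t => unitSub_ext
      (fun H => by
        change H ◁ (c • f) ≫ unitSubL t H = c • (H ◁ f ≫ unitSubL t H)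
        rw [SemigroupCategory.bilinear.map_smul_right, Linear.smul_comp])
      (fun H => by
        change (c • f) ▷ H ≫ unitSubR t H = c • (f ▷ H ≫ unitSubR t H)
        rw [SemigroupCategory.bilinear.map_smul_left, Linear.smul_comp]))

/-- The left component of a section of the unit presheaf. -/
def unitL {X : S} (t : (unitPsh k S).sec X) (H : S) : H ⊠ X ⟶ H :=
  unitSubL (show unitSub (k := k) X from t) H

/-- The right component of a section of the unit presheaf. -/
def unitR {X : S} (t : (unitPsh k S).sec X) (H : S) : X ⊠ H ⟶ H :=
  unitSubR (show unitSub (k := k) X from t) H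

theorem unit_ext {X : S} {t t' : (unitPsh k S).sec X} (hl : ∀ H, unitL t H = unitL t' H)
    (hr : ∀ H, unitR t H = unitR t' H) : t = t' :=
  unitSub_ext hl hr

/-- The section of the unit presheaf determined by the counits of an adjunction. -/
def Adj.counit {F F' : S} (d : Adj k F F') : (unitPsh k S).sec (F ⊠ F') :=
  show unitSub (k := k) (F ⊠ F') from
    unitSubMk d.epsL d.epsR d.epsL_naturality d.epsR_naturality d.epsL_tensor d.epsR_tensor
      d.epsL_compat

theorem Adj.unitL_counit {F F' : S} (d : Adj k F F') (H : S) : unitL d.counit H = d.epsL H := rfl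

theorem Adj.unitR_counit {F F' : S} (d : Adj k F F') (H : S) : unitR d.counit H = d.epsR H := rfl

theorem unitL_naturality {X : S} (t : (unitPsh k S).sec X) {H K : S} (f : H ⟶ K) :
    f ▷ X ≫ unitL t K = unitL t H ≫ f :=
  unitSubL_naturality (show unitSub (k := k) X from t) f

theorem unitR_naturality {X : S} (t : (unitPsh k S).sec X) {H K : S} (f : H ⟶ K) :
    X ◁ f ≫ unitR t K = unitR t H ≫ f :=
  unitSubR_naturality (show unitSub (k := k) X from t) f

theorem unitL_tensor {X : S} (t : (unitPsh k S).sec X) (H K : S) :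
    unitL t (H ⊠ K) = (α_ H K X).hom ≫ H ◁ unitL t K :=
  unitSubL_tensor (show unitSub (k := k) X from t) H K

theorem unitR_tensor {X : S} (t : (unitPsh k S).sec X) (H K : S) :
    (α_ X H K).hom ≫ unitR t (H ⊠ K) = unitR t H ▷ K :=
  unitSubR_tensor (show unitSub (k := k) X from t) H K

theorem unit_compat {X : S} (t : (unitPsh k S).sec X) (H K : S) :
    (α_ H X K).hom ≫ H ◁ unitR t K = unitL t H ▷ K :=
  unitSub_compat (show unitSub (k := k) X from t) H K

theorem unitL_res {X Y : S} (f : X ⟶ Y) (t : (unitPsh k S).sec Y) (H : S) :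
    unitL ((unitPsh k S).res f t) H = H ◁ f ≫ unitL t H := rfl

theorem unitR_res {X Y : S} (f : X ⟶ Y) (t : (unitPsh k S).sec Y) (H : S) :
    unitR ((unitPsh k S).res f t) H = f ▷ H ≫ unitR t H := rfl

theorem unitL_add {X : S} (t t' : (unitPsh k S).sec X) (H : S) :
    unitL (t + t') H = unitL t H + unitL t' H := rfl

theorem unitR_add {X : S} (t t' : (unitPsh k S).sec X) (H : S) :
    unitR (t + t') H = unitR t H + unitR t' H := rfl

theorem unitL_smul {X : S} (c : k) (t : (unitPsh k S).sec X) (H : S) :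
    unitL (c • t) H = c • unitL t H := rfl

theorem unitR_smul {X : S} (c : k) (t : (unitPsh k S).sec X) (H : S) :
    unitR (c • t) H = c • unitR t H := rfl

/-- The left and the right unitor agree on the unit presheaf. -/
theorem unit_swap {A B : S} (s : (unitPsh k S).sec A) (t : (unitPsh k S).sec B) :
    (unitPsh k S).res (unitR s B) t = (unitPsh k S).res (unitL t A) s := by
  refine unit_ext (fun H => ?_) (fun H => ?_)
  -- Both sides are compared on `(H ⊠ A) ⊠ B`. Compatibility turns `s` acting on `B` from the left
  -- into `s` acting on `H` from the right, and naturality of `t` exchanges the order in which `s`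
  -- and `t` are applied.
  · rw [unitL_res, unitL_res, ← cancel_epi (α_ H A B).hom, reassoc_of% (unit_compat s H B),
      unitL_naturality, unitL_tensor, Category.assoc]
  · rw [unitR_res, unitR_res, ← unit_compat t A H, ← unitR_tensor, Category.assoc, Category.assoc,
      unitR_naturality]

attribute [irreducible] unitPsh unitL unitR Adj.counit

/-- An isomorphism of presheaves from a morphism with a linear inverse on sections. -/
def Psh.isoOfSections {A : Type u} [Category.{u} A] [Preadditive A] [Linear k A] {P Q : Psh k A}
    (φ : P ⟶ Q) (s : ∀ X, Q.sec X →ₗ[k] P.sec X)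
    (h₁ : ∀ X q, Psh.app φ X (s X q) = q) (h₂ : ∀ X p, s X (Psh.app φ X p) = p) : P ≅ Q where
  hom := φ
  inv := Psh.ofComponents s fun {X Y} f q => by
    conv_lhs => rw [← h₁ Y q, ← Psh.app_res, h₂]
  hom_inv_id := Psh.hom_ext fun X p => by
    rw [Psh.app_comp, Psh.app_ofComponents, h₂, Psh.app_id]
  inv_hom_id := Psh.hom_ext fun X q => by
    rw [Psh.app_comp, Psh.app_ofComponents, h₁, Psh.app_id]

/-- The left unitor, `[f, t, p] ↦ P(tʳ ∘ f)(p)`. -/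
def unitLeftHom (P : Psh k S) : dayObj (tensor k) (unitPsh k S) P ⟶ P :=
  descHom (tensor k) (fun X H K f t p => P.res (f ≫ unitR t K) p)
    (fun X a b f f' p q => by rw [Preadditive.add_comp, Psh.res_add])
    (fun X a b c f p q => by rw [Linear.smul_comp, Psh.res_smul])
    (fun X a b f p p' q => by rw [unitR_add, Preadditive.comp_add, Psh.res_add])
    (fun X a b c f p q => by rw [unitR_smul, Linear.comp_smul, Psh.res_smul])
    (fun X a b f p q q' => map_add _ _ _)
    (fun X a b c f p q => map_smul _ _ _)
    (fun X a a' b α f p q => by rw [unitR_res, Category.assoc])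
    (fun X a b b' β f p q => by
      rw [Category.assoc, unitR_naturality, ← Psh.res_comp, Category.assoc])
    (fun X Y a b h f p q => by rw [Category.assoc, Psh.res_comp])

theorem unitLeftHom_gen (P : Psh k S) {X H K : S} (f : X ⟶ H ⊠ K) (t : (unitPsh k S).sec H)
    (p : P.sec K) :
    Psh.app (unitLeftHom P) X (gen (tensor k) f t p) = P.res (f ≫ unitR t K) p := by
  unfold unitLeftHom
  rw [descHom_gen]

/-- The right unitor, `[f, p, t] ↦ P(tˡ ∘ f)(p)`. -/
def unitRightHom (P : Psh k S) : dayObj (tensor k) P (unitPsh k S) ⟶ P :=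
  descHom (tensor k) (fun X H K f p t => P.res (f ≫ unitL t H) p)
    (fun X a b f f' p q => by rw [Preadditive.add_comp, Psh.res_add])
    (fun X a b c f p q => by rw [Linear.smul_comp, Psh.res_smul])
    (fun X a b f p p' q => map_add _ _ _)
    (fun X a b c f p q => map_smul _ _ _)
    (fun X a b f p q q' => by rw [unitL_add, Preadditive.comp_add, Psh.res_add])
    (fun X a b c f p q => by rw [unitL_smul, Linear.comp_smul, Psh.res_smul])
    (fun X a a' b α f p q => by
      rw [Category.assoc, unitL_naturality, ← Psh.res_comp, Category.assoc])
    (fun X a b b' β f p q => by rw [unitL_res, Category.assoc])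
    (fun X Y a b h f p q => by rw [Category.assoc, Psh.res_comp])

theorem unitRightHom_gen (P : Psh k S) {X H K : S} (f : X ⟶ H ⊠ K) (p : P.sec H)
    (t : (unitPsh k S).sec K) :
    Psh.app (unitRightHom P) X (gen (tensor k) f p t) = P.res (f ≫ unitL t H) p := by
  unfold unitRightHom
  rw [descHom_gen]

variable (hS : IsRigid k S)

/-- A right dual of an object of a rigid semigroup category. -/
def IsRigid.dual (hS : IsRigid k S) (F : S) : S := (hS F).1.choose
/-- The adjunction of an object and its right dual. -/
def IsRigid.adj (hS : IsRigid k S) (F : S) : Adj k F (hS.dual F) := (hS F).1.choose_spec.some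
/-- A left dual of an object of a rigid semigroup category. -/
def IsRigid.dual' (hS : IsRigid k S) (F : S) : S := (hS F).2.choose
/-- The adjunction of the left dual of an object and the object. -/
def IsRigid.adj' (hS : IsRigid k S) (F : S) : Adj k (hS.dual' F) F := (hS F).2.choose_spec.some

/-- The inverse of the left unitor on sections. -/
def unitLeftInv (P : Psh k S) (X : S) : P.sec X →ₗ[k] (dayObj (tensor k) (unitPsh k S) P).sec X where
  toFun p := gen (tensor k) ((hS.adj X).etaL X ≫ (α_ X (hS.dual X) X).inv) (hS.adj X).counit p
  map_add' p q := gen_add_right _ _ _ _ _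
  map_smul' c p := gen_smul_right _ _ _ _ _

theorem unitLeftInv_apply (P : Psh k S) {X : S} (p : P.sec X) :
    unitLeftInv hS P X p = gen (tensor k) ((hS.adj X).etaL X ≫ (α_ X (hS.dual X) X).inv) (hS.adj X).counit p := rfl

/-- The left unitor. -/
def unitLeft (P : Psh k S) : dayObj (tensor k) (unitPsh k S) P ≅ P :=
  Psh.isoOfSections (unitLeftHom P)
    (unitLeftInv hS P)
    (fun X p => by
      rw [unitLeftInv_apply, unitLeftHom_gen, Adj.unitR_counit, Category.assoc, Adj.etaL_epsR, Psh.res_id])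
    (fun X => LinearMap.congr_fun (f := unitLeftInv hS P X ∘ₗ Psh.app (unitLeftHom P) X)
      (g := LinearMap.id) (gen_ext _ fun H K f t p => by
        rw [LinearMap.comp_apply, unitLeftInv_apply, LinearMap.id_apply]
        set d := hS.adj X
        -- The zigzag identity is inserted in front of `f`. Then both generators begin with the same
        -- map from `X` to `(X ⊠ X') ⊠ (H ⊠ K)`. On one side `t` is evaluated on the counit's
        -- object, on the other the counit is evaluated on `H`, and `unit_swap` identifies the two.
        have e : d.etaL X ≫ (α_ X (hS.dual X) X).inv ≫ d.epsR X = 𝟙 X := d.etaL_epsR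
        conv_rhs => rw [← Category.id_comp f, ← e]
        rw [unitLeftHom_gen, gen_right_res]
        simp only [Category.assoc, Functor.map_comp]
        rw [← d.epsR_naturality f, ← Adj.unitR_counit, ← (Iso.inv_comp_eq _).2 (unitR_tensor _ H K).symm,
          ← (Iso.inv_comp_eq _).2 (unit_compat t _ K).symm]
        simp only [← Category.assoc]
        rw [← gen_mid_res, ← gen_mid_res, unit_swap]))

/-- The inverse of the right unitor on sections. -/
def unitRightInv (P : Psh k S) (X : S) : P.sec X →ₗ[k] (dayObj (tensor k) P (unitPsh k S)).sec X where
  toFun p := gen (tensor k) ((hS.adj' X).etaR X ≫ (α_ X (hS.dual' X) X).hom) p (hS.adj' X).counit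
  map_add' p q := gen_add_mid _ _ _ _ _
  map_smul' c p := gen_smul_mid _ _ _ _ _

theorem unitRightInv_apply (P : Psh k S) {X : S} (p : P.sec X) :
    unitRightInv hS P X p = gen (tensor k) ((hS.adj' X).etaR X ≫ (α_ X (hS.dual' X) X).hom) p (hS.adj' X).counit := rfl

/-- The right unitor. -/
def unitRight (P : Psh k S) : dayObj (tensor k) P (unitPsh k S) ≅ P :=
  Psh.isoOfSections (unitRightHom P)
    (unitRightInv hS P)
    (fun X p => by
      rw [unitRightInv_apply, unitRightHom_gen, Adj.unitL_counit, Category.assoc, Adj.etaR_epsL, Psh.res_id])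
    (fun X => LinearMap.congr_fun (f := unitRightInv hS P X ∘ₗ Psh.app (unitRightHom P) X)
      (g := LinearMap.id) (gen_ext _ fun H K f p t => by
        rw [LinearMap.comp_apply, unitRightInv_apply, LinearMap.id_apply]
        set d := hS.adj' X
        -- The mirror image of the argument for the left unitor. It needs the zigzag identity for
        -- `X` as the second entry of an adjunction, hence a dual on the other side.
        have e : d.etaR X ≫ (α_ X (hS.dual' X) X).hom ≫ d.epsL X = 𝟙 X := d.etaR_epsL
        conv_rhs => rw [← Category.id_comp f, ← e]
        rw [unitRightHom_gen, gen_mid_res]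
        simp only [Category.assoc, Functor.map_comp, NatTrans.comp_app]
        rw [← d.epsL_naturality f, ← Adj.unitL_counit, unitL_tensor, ← unit_compat t]
        simp only [← Category.assoc]
        rw [← gen_right_res, ← gen_right_res, unit_swap]))

/-- The presheaf category of a rigid semigroup category is monoidal. -/
def unitStr : UnitStr k (Psh k S) where
  unit := unitPsh k S
  left := NatIso.ofComponents (fun P => unitLeft hS P) fun {P Q} φ =>
    dayObj_hom_ext _ fun X H K f t p => by
      change Psh.app (dayMap _ _ _ ≫ unitLeftHom Q) X _ = Psh.app (unitLeftHom P ≫ φ) X _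
      rw [Psh.app_comp, Psh.app_comp, dayMap_gen, unitLeftHom_gen, unitLeftHom_gen, Psh.app_id,
        Psh.app_res]
  right := NatIso.ofComponents (fun P => unitRight hS P) fun {P Q} φ =>
    dayObj_hom_ext _ fun X H K f p t => by
      change Psh.app (dayMap _ _ _ ≫ unitRightHom Q) X _ = Psh.app (unitRightHom P ≫ φ) X _
      rw [Psh.app_comp, Psh.app_comp, dayMap_gen, unitRightHom_gen, unitRightHom_gen, Psh.app_id,
        Psh.app_res]
  triangle P Q := dayObj_hom_ext₂ _ _ fun X L K f H A g p t q => by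
    change Psh.app ((tensorAssoc P (unitPsh k S) Q).hom ≫ dayMap _ (𝟙 P) (unitLeftHom Q)) X _ =
      Psh.app (dayMap _ (unitRightHom P) (𝟙 Q)) X _
    rw [Psh.app_comp, tensorAssoc_gen, dayMap_gen, dayMap_gen, unitLeftHom_gen, unitRightHom_gen,
      Psh.app_id, Psh.app_id, gen_mid_res, gen_right_res, Category.id_comp]
    -- On generators the triangle axiom is the compatibility between the left and the right
    -- component of `t`.
    simp only [Category.assoc, unit_compat, Functor.map_comp, NatTrans.comp_app]

end UnitPresheaf

/-! ### Faithful module categories and coherent adjunctions -/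

namespace SemigroupModule

section General

variable {k : Type u} [Field k]
  {S : Type v₁} [Category.{w₁} S] [Preadditive S] [Linear k S] [SemigroupCategory k S]
  {M : Type v₂} [Category.{w₂} M] [Preadditive M] [Linear k M] (σ : SemigroupModule k S M)

local notation:70 F:70 " ⊠ " G:71 =>
  CategoryTheory.Functor.obj (CategoryTheory.Functor.obj (tensor k) F) G
local notation:81 F:82 " ◁ " f:81 =>
  CategoryTheory.Functor.map (CategoryTheory.Functor.obj (tensor k) F) f
local notation:81 f:81 " ▷ " G:82 =>
  NatTrans.app (CategoryTheory.Functor.map (tensor k) f) G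
local notation "α_" => SemigroupCategory.assoc (k := k)

theorem assoc_inv_nat₁ {F F' : S} (f : F ⟶ F') (G : S) (X : M) :
    (σ.act.map f).app ((σ.act.obj G).obj X) ≫ (σ.assoc F' G X).inv =
      (σ.assoc F G X).inv ≫ (σ.act.map (f ▷ G)).app X := by
  rw [Iso.comp_inv_eq, Category.assoc, σ.assoc_nat₁, Iso.inv_hom_id_assoc]

theorem assoc_inv_nat₂ (F : S) {G G' : S} (g : G ⟶ G') (X : M) :
    (σ.act.obj F).map ((σ.act.map g).app X) ≫ (σ.assoc F G' X).inv =
      (σ.assoc F G X).inv ≫ (σ.act.map (F ◁ g)).app X := by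
  rw [Iso.comp_inv_eq, Category.assoc, σ.assoc_nat₂, Iso.inv_hom_id_assoc]

theorem assoc_inv_nat₃ (F G : S) {X X' : M} (h : X ⟶ X') :
    (σ.act.obj F).map ((σ.act.obj G).map h) ≫ (σ.assoc F G X').inv =
      (σ.assoc F G X).inv ≫ (σ.act.obj (F ⊠ G)).map h := by
  rw [Iso.comp_inv_eq, Category.assoc, σ.assoc_nat₃, Iso.inv_hom_id_assoc]

theorem map_hom_inv_id_app {F G : S} (e : F ≅ G) (X : M) {Z : M}
    (h : (σ.act.obj F).obj X ⟶ Z) :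
    (σ.act.map e.hom).app X ≫ (σ.act.map e.inv).app X ≫ h = h := by
  rw [← NatTrans.comp_app_assoc, ← Functor.map_comp, e.hom_inv_id, CategoryTheory.Functor.map_id, NatTrans.id_app,
    Category.id_comp]

theorem map_inv_hom_id_app {F G : S} (e : F ≅ G) (X : M) {Z : M}
    (h : (σ.act.obj G).obj X ⟶ Z) :
    (σ.act.map e.inv).app X ≫ (σ.act.map e.hom).app X ≫ h = h :=
  σ.map_hom_inv_id_app e.symm X h

theorem pentagon_mid (F G H : S) (X : M) :
    (σ.assoc F G ((σ.act.obj H).obj X)).hom ≫ (σ.act.obj F).map (σ.assoc G H X).inv ≫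
        (σ.assoc F (G ⊠ H) X).inv =
      (σ.assoc (F ⊠ G) H X).inv ≫ (σ.act.map (α_ F G H).hom).app X := by
  have h := σ.pentagon F G H X
  rw [Iso.eq_inv_comp, ← reassoc_of% h, ← Functor.map_comp_assoc, Iso.hom_inv_id,
    CategoryTheory.Functor.map_id, Category.id_comp, Iso.hom_inv_id, Category.comp_id]

theorem pentagon_mid' (F G H : S) (X : M) :
    (σ.assoc F (G ⊠ H) X).hom ≫ (σ.act.obj F).map (σ.assoc G H X).hom ≫
        (σ.assoc F G ((σ.act.obj H).obj X)).inv =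
      (σ.act.map (α_ F G H).inv).app X ≫ (σ.assoc (F ⊠ G) H X).hom := by
  have h := σ.pentagon F G H X
  rw [← cancel_mono (σ.assoc F G ((σ.act.obj H).obj X)).hom]
  simp only [Category.assoc, Iso.inv_hom_id, Category.comp_id, ← h]
  rw [σ.map_inv_hom_id_app]

/-- Morphisms are determined by the action of the objects of `S` on them. -/
def IsFaithful : Prop :=
  ∀ ⦃X Y : M⦄ (a b : X ⟶ Y), (∀ H : S, (σ.act.obj H).map a = (σ.act.obj H).map b) → a = b

variable {σ}

/-- In a faithful module category, coherent units and counits are those of an adjunction. -/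
def RespectedAdj.ofCoherent (hσ : σ.IsFaithful) {F F' : S} (d : Adj k F F')
    (η : ∀ X : M, X ⟶ (σ.act.obj F').obj ((σ.act.obj F).obj X))
    (ε : ∀ X : M, (σ.act.obj F).obj ((σ.act.obj F').obj X) ⟶ X)
    (hε : ∀ (H : S) (X : M), (σ.act.obj H).map (ε X) =
      (σ.act.obj H).map (σ.assoc F F' X).inv ≫ (σ.assoc H (F ⊠ F') X).inv ≫
        (σ.act.map (d.epsL H)).app X)
    (hη : ∀ (H : S) (X : M), (σ.act.obj H).map (η X) =
      (σ.act.map (d.etaL H)).app X ≫ (σ.assoc H (F' ⊠ F) X).hom ≫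
        (σ.act.obj H).map (σ.assoc F' F X).hom) : σ.RespectedAdj d where
  adj :=
    { unit :=
        { app := η
          naturality := fun X Y f => hσ _ _ fun H => by
            change (σ.act.obj H).map (f ≫ η Y) =
              (σ.act.obj H).map (η X ≫ (σ.act.obj F').map ((σ.act.obj F).map f))
            rw [Functor.map_comp, Functor.map_comp, hη, hη, NatTrans.naturality_assoc,
              reassoc_of% (σ.assoc_nat₃ H (F' ⊠ F) f)]
            simp only [Category.assoc, ← Functor.map_comp, σ.assoc_nat₃] }
      counit :=
        { app := ε
          naturality := fun X Y f => hσ _ _ fun H => by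
            change (σ.act.obj H).map ((σ.act.obj F).map ((σ.act.obj F').map f) ≫ ε Y) =
              (σ.act.obj H).map (ε X ≫ f)
            rw [Functor.map_comp, Functor.map_comp, hε, hε, ← Functor.map_comp_assoc,
              σ.assoc_inv_nat₃, Functor.map_comp_assoc, reassoc_of% (σ.assoc_inv_nat₃ H (F ⊠ F') f)]
            simp only [Category.assoc, NatTrans.naturality] }
      -- After acting by `H`, the triangle identity for `F ⋆ -` becomes the triangle identity for `-
      -- ⊠ F` in the adjunction `- ⊠ F' ⊣ - ⊠ F` at `H`, acting on `X`. The pentagon moves the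
      -- associators out of the way.
      left_triangle_components := fun X => hσ _ _ fun H => by
        change (σ.act.obj H).map ((σ.act.obj F).map (η X) ≫ ε ((σ.act.obj F).obj X)) = _
        have e₁ : (σ.act.obj H).map ((σ.act.obj F).map (η X)) = (σ.assoc H F X).inv ≫
            (σ.act.obj (H ⊠ F)).map (η X) ≫ (σ.assoc H F _).hom := by
          rw [σ.assoc_nat₃, Iso.inv_hom_id_assoc]
        have e₂ := congrArg (fun f => (σ.act.map f).app X) (d.etaL_triangle' H)
        simp only [Functor.map_comp, NatTrans.comp_app] at e₂
        rw [Functor.map_comp, e₁, hε, hη]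
        simp only [Category.assoc]
        rw [reassoc_of% (σ.pentagon_mid H F F' ((σ.act.obj F).obj X)),
          reassoc_of% (σ.pentagon_mid' (H ⊠ F) F' F X), ← reassoc_of% σ.assoc_nat₁,
          ← σ.assoc_nat₁, reassoc_of% e₂]
        simp
      -- Likewise, with the triangle identity for `- ⊠ F'` at `H`.
      right_triangle_components := fun X => hσ _ _ fun H => by
        change (σ.act.obj H).map (η ((σ.act.obj F').obj X) ≫ (σ.act.obj F').map (ε X)) = _
        have e₁ : (σ.act.obj H).map ((σ.act.obj F').map (ε X)) = (σ.assoc H F' _).inv ≫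
            (σ.act.obj (H ⊠ F')).map (ε X) ≫ (σ.assoc H F' _).hom := by
          rw [σ.assoc_nat₃, Iso.inv_hom_id_assoc]
        have e₂ := congrArg (fun f => (σ.act.map f).app X) (d.etaL_triangle H)
        simp only [Functor.map_comp, NatTrans.comp_app] at e₂
        rw [Functor.map_comp, e₁, hε, hη]
        simp only [Category.assoc]
        rw [reassoc_of% (σ.pentagon_mid' H F' F ((σ.act.obj F').obj X)),
          reassoc_of% (σ.pentagon_mid (H ⊠ F') F F' X), reassoc_of% σ.assoc_inv_nat₁,
          reassoc_of% σ.assoc_inv_nat₁, reassoc_of% e₂]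
        simp }
  counit_coherent := hε
  unit_coherent := hη

/-- The counit at an object `F ⋆ Y` is split by `F ⋆ η_Y`. If `X` is a summand of a sum of such
objects through maps `i` and `p`, naturality of the counit along `p` rewrites each `i ≫ p` as `i ≫ F
⋆ (η_Y ≫ F' ⋆ p) ≫ ε_X`. -/
theorem exists_sum_counit (hS : IsRigid k S) (hg : σ.Generated) (hr : σ.RespectsAdjunctions)
    (X : M) : ∃ (n : ℕ) (i : Fin n → σ.RespectedPair)
      (t : ∀ j, X ⟶ (σ.act.obj (i j).F).obj ((σ.act.obj (i j).F').obj X)),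
      ∑ j, t j ≫ (i j).respected.adj.counit.app X = 𝟙 X := by
  obtain ⟨n, F, Y, i, p, h⟩ := hg X
  let d : ∀ j, Adj k (F j) (hS (F j)).1.choose := fun j => (hS (F j)).1.choose_spec.some
  let r : ∀ j, σ.RespectedAdj (d j) := fun j => (hr _ _ (d j)).some
  refine ⟨n, fun j => ⟨F j, _, d j, r j⟩, fun j => i j ≫ (σ.act.obj (F j)).map
    ((r j).adj.unit.app (Y j) ≫ (σ.act.obj _).map (p j)), ?_⟩
  rw [← h]
  refine Finset.sum_congr rfl fun j _ => ?_
  have e₁ := (r j).adj.left_triangle_components (Y j)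
  have e₂ := (r j).adj.counit.naturality (p j)
  simp only [Functor.comp_map, Functor.id_map] at e₂
  dsimp only
  rw [Functor.map_comp, Category.assoc, Category.assoc, e₂, reassoc_of% e₁]

/-- By naturality of the counit, `ε_X ≫ a` depends only on `F' ⋆ a`, and the identity of `X` is a
sum of maps through counits `ε_X`. -/
theorem isFaithful_of_generated (hS : IsRigid k S) (hg : σ.Generated)
    (hr : σ.RespectsAdjunctions) : σ.IsFaithful := fun X Y a b h => by
  obtain ⟨n, i, t, ht⟩ := exists_sum_counit hS hg hr X
  rw [← Category.id_comp a, ← Category.id_comp b, ← ht, Preadditive.sum_comp,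
    Preadditive.sum_comp]
  refine Finset.sum_congr rfl fun j _ => ?_
  have e₁ := (i j).respected.adj.counit.naturality a
  have e₂ := (i j).respected.adj.counit.naturality b
  simp only [Functor.comp_map, Functor.id_map] at e₁ e₂
  rw [Category.assoc, Category.assoc, ← e₁, ← e₂, h]

end General

end SemigroupModule

/-! ### The unit presheaf acting on a module category -/

section UnitAction

variable {k : Type u} [Field k]
  {S : Type u} [Category.{u} S] [Preadditive S] [Linear k S] [SemigroupCategory k S]

local notation:70 F:70 " ⊠ " G:71 =>
  CategoryTheory.Functor.obj (CategoryTheory.Functor.obj (tensor k) F) G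
local notation:81 F:82 " ◁ " f:81 =>
  CategoryTheory.Functor.map (CategoryTheory.Functor.obj (tensor k) F) f
local notation:81 f:81 " ▷ " G:82 =>
  NatTrans.app (CategoryTheory.Functor.map (tensor k) f) G
local notation "α_" => SemigroupCategory.assoc (k := k)

/-- The counits generate the unit presheaf. By `unit_swap`, restricting the counit of `H` along the
left component of `t` is the same as restricting `t` along the right component of the counit, and
the zigzag identity cancels the latter. -/
theorem IsRigid.res_counit (hS : IsRigid k S) {H : S} (t : (unitPsh k S).sec H) :
    (unitPsh k S).res ((hS.adj H).etaL H ≫ (α_ H (hS.dual H) H).inv ≫ unitL t (H ⊠ hS.dual H))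
      (hS.adj H).counit = t := by
  rw [Psh.res_comp, Psh.res_comp, ← unit_swap, Adj.unitR_counit, ← Psh.res_comp, ← Psh.res_comp,
    Category.assoc, Adj.etaL_epsR, Psh.res_id]

namespace SemigroupModule

variable {M : Type v₂} [Category.{w₂} M] [Preadditive M] [Linear k M] {σ : SemigroupModule k S M}

/-- The morphism `a` is the action of the section `t` of the unit presheaf on `X`. -/
def IsUnitAction (σ : SemigroupModule k S M) {H : S} (t : (unitPsh k S).sec H) (X : M)
    (a : (σ.act.obj H).obj X ⟶ X) : Prop :=
  ∀ K : S, (σ.act.obj K).map a = (σ.assoc K H X).inv ≫ (σ.act.map (unitL t K)).app X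

/-- The sections of the unit presheaf act on the module category. -/
def UnitActs (σ : SemigroupModule k S M) : Prop :=
  ∀ ⦃H : S⦄ (t : (unitPsh k S).sec H) (X : M), ∃ a, σ.IsUnitAction t X a

/-- This is the coherence condition on the counit, read as saying that the section `d.counit` acts
through the counit of the module category. -/
theorem RespectedAdj.isUnitAction {F F' : S} {d : Adj k F F'} (r : σ.RespectedAdj d) (X : M) :
    σ.IsUnitAction d.counit X ((σ.assoc F F' X).hom ≫ r.adj.counit.app X) := fun K => by
  rw [Functor.map_comp, r.counit_coherent, ← Functor.map_comp_assoc, Iso.hom_inv_id,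
    CategoryTheory.Functor.map_id, Category.id_comp, Adj.unitL_counit]
  rfl

theorem IsUnitAction.res {H G : S} {t : (unitPsh k S).sec H} {X : M}
    {a : (σ.act.obj H).obj X ⟶ X} (h : σ.IsUnitAction t X a) (f : G ⟶ H) :
    σ.IsUnitAction ((unitPsh k S).res f t) X ((σ.act.map f).app X ≫ a) := fun K => by
  rw [Functor.map_comp, h, unitL_res, Functor.map_comp, NatTrans.comp_app,
    reassoc_of% σ.assoc_inv_nat₂]

/-- Counits act because adjunctions are respected, and every other section is a restriction of a
counit. -/
theorem unitActs_of_respectsAdjunctions (hS : IsRigid k S) (hr : σ.RespectsAdjunctions) :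
    σ.UnitActs := fun H t X => by
  rw [← hS.res_counit t]
  exact ⟨_, ((hr _ _ (hS.adj H)).some.isUnitAction X).res _⟩

/-- The action of a section of the unit presheaf. -/
def UnitActs.act (h : σ.UnitActs) {H : S} (t : (unitPsh k S).sec H) (X : M) :
    (σ.act.obj H).obj X ⟶ X := (h t X).choose

theorem UnitActs.map_act (h : σ.UnitActs) (K : S) {H : S} (t : (unitPsh k S).sec H) (X : M) :
    (σ.act.obj K).map (h.act t X) = (σ.assoc K H X).inv ≫ (σ.act.map (unitL t K)).app X :=
  (h t X).choose_spec K

variable (h : σ.UnitActs)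

/-- Faithfulness removes the choice involved in `UnitActs.act`. Linearity in the section and
compatibility with restriction follow from this uniqueness. -/
theorem UnitActs.eq_act (hσ : σ.IsFaithful) {H : S} {t : (unitPsh k S).sec H} {X : M} {a : (σ.act.obj H).obj X ⟶ X}
    (ha : σ.IsUnitAction t X a) : h.act t X = a :=
  hσ _ _ fun K => by rw [h.map_act, ha]

theorem UnitActs.act_add (hσ : σ.IsFaithful) {H : S} (t t' : (unitPsh k S).sec H) (X : M) :
    h.act (t + t') X = h.act t X + h.act t' X :=
  h.eq_act hσ fun K => by
    rw [σ.bilinear.map_add_right, h.map_act, h.map_act, unitL_add, σ.bilinear.map_add_left,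
      Preadditive.comp_add]

theorem UnitActs.act_smul (hσ : σ.IsFaithful) {H : S} (c : k) (t : (unitPsh k S).sec H) (X : M) :
    h.act (c • t) X = c • h.act t X :=
  h.eq_act hσ fun K => by
    rw [σ.bilinear.map_smul_right, h.map_act, unitL_smul, σ.bilinear.map_smul_left,
      Linear.comp_smul]

theorem UnitActs.act_res (hσ : σ.IsFaithful) {G H : S} (f : G ⟶ H) (t : (unitPsh k S).sec H) (X : M) :
    h.act ((unitPsh k S).res f t) X = (σ.act.map f).app X ≫ h.act t X :=
  h.eq_act hσ (IsUnitAction.res (h.map_act · t X) f)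

theorem UnitActs.act_naturality (hσ : σ.IsFaithful) {H : S} (t : (unitPsh k S).sec H) {X Y : M} (f : X ⟶ Y) :
    (σ.act.obj H).map f ≫ h.act t Y = h.act t X ≫ f :=
  hσ _ _ fun K => by
    rw [Functor.map_comp, Functor.map_comp, h.map_act, h.map_act, reassoc_of% σ.assoc_inv_nat₃,
      NatTrans.naturality, Category.assoc]

/-- The action is defined by left components, and this brings in the right ones. After acting by `K`
the identity reduces, through the pentagon, to the compatibility of the two components of `t`. -/
theorem UnitActs.act_tensor (hσ : σ.IsFaithful) {H : S} (t : (unitPsh k S).sec H) (G : S) (X : M) :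
    (σ.assoc H G X).hom ≫ h.act t ((σ.act.obj G).obj X) = (σ.act.map (unitR t G)).app X :=
  hσ _ _ fun K => by
    rw [Functor.map_comp, h.map_act, ← cancel_epi (σ.assoc K (H ⊠ G) X).hom,
      ← σ.assoc_nat₂, ← cancel_epi ((σ.act.map (α_ K H G).hom).app X),
      reassoc_of% (σ.pentagon K H G X), Iso.hom_inv_id_assoc, ← σ.assoc_nat₁,
      ← NatTrans.comp_app_assoc, ← Functor.map_comp, unit_compat]

theorem UnitActs.act_counit (hσ : σ.IsFaithful) {F F' : S} {d : Adj k F F'} (r : σ.RespectedAdj d) (X : M) :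
    h.act d.counit X = (σ.assoc F F' X).hom ≫ r.adj.counit.app X :=
  h.eq_act hσ (r.isUnitAction X)

end SemigroupModule

section

variable {M : Type u} [Category.{u} M] [Preadditive M] [Linear k M] {σ : SemigroupModule k S M}

open SemigroupModule

theorem gen_sum_left {A B C : Type u} [Category.{u} A] [Preadditive A] [Linear k A]
    [Category.{u} B] [Preadditive B] [Linear k B] [Category.{u} C] [Preadditive C] [Linear k C]
    (T : A ⥤ B ⥤ C) {P : Psh k A} {Q : Psh k B} {X : C} {a : A} {b : B} {I : Type*}
    (s : Finset I) (f : I → (X ⟶ (T.obj a).obj b)) (p : P.sec a) (q : Q.sec b) :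
    gen T (∑ i ∈ s, f i) p q = ∑ i ∈ s, gen T (f i) p q :=
  map_sum (⟨⟨fun f => gen T f p q, by
    simpa using gen_smul_left T (0 : k) (0 : X ⟶ (T.obj a).obj b) p q⟩,
    fun f g => gen_add_left T f g p q⟩ : (X ⟶ (T.obj a).obj b) →+ (dayObj T P Q).sec X) f s

/-- The unitor of the presheaf category of a module category, `[f, t, n] ↦ N(t ∘ f)(n)`. -/
def unitActHom (h : σ.UnitActs) (hσ : σ.IsFaithful) (N : Psh k M) :
    dayObj σ.act (unitPsh k S) N ⟶ N :=
  descHom σ.act (fun X H Y f t n => N.res (f ≫ h.act t Y) n)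
    (fun X a b f f' p q => by rw [Preadditive.add_comp, Psh.res_add])
    (fun X a b c f p q => by rw [Linear.smul_comp, Psh.res_smul])
    (fun X a b f p p' q => by rw [h.act_add hσ, Preadditive.comp_add, Psh.res_add])
    (fun X a b c f p q => by rw [h.act_smul hσ, Linear.comp_smul, Psh.res_smul])
    (fun X a b f p q q' => map_add _ _ _)
    (fun X a b c f p q => map_smul _ _ _)
    (fun X a a' b α f p q => by rw [h.act_res hσ, Category.assoc])
    (fun X a b b' β f p q => by
      rw [Category.assoc, h.act_naturality hσ, ← Psh.res_comp, Category.assoc])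
    (fun X Y a b h f p q => by rw [Category.assoc, Psh.res_comp])

theorem unitActHom_gen (h : σ.UnitActs) (hσ : σ.IsFaithful) (N : Psh k M) {X : M} {H : S} {Y : M}
    (f : X ⟶ (σ.act.obj H).obj Y) (t : (unitPsh k S).sec H) (n : N.sec Y) :
    Psh.app (unitActHom h hσ N) X (gen σ.act f t n) = N.res (f ≫ h.act t Y) n := by
  unfold unitActHom
  rw [descHom_gen]

variable (σ) in
/-- A decomposition of the identity of `X` into counits. -/
structure CounitSum (X : M) where
  n : ℕ
  i : Fin n → σ.RespectedPair
  t : ∀ j, X ⟶ (σ.act.obj (i j).F).obj ((σ.act.obj (i j).F').obj X)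
  sum : ∑ j, t j ≫ (i j).respected.adj.counit.app X = 𝟙 X

/-- The inverse of `unitActHom` on sections. -/
def unitActInv (c : ∀ X, CounitSum σ X) (N : Psh k M) (X : M) :
    N.sec X →ₗ[k] (dayObj σ.act (unitPsh k S) N).sec X where
  toFun n := ∑ j, gen σ.act ((c X).t j ≫ (σ.assoc _ _ X).inv) ((c X).i j).adjunction.counit n
  map_add' p q := by simp only [gen_add_right, Finset.sum_add_distrib]
  map_smul' c p := by simp only [gen_smul_right, Finset.smul_sum, RingHom.id_apply]

theorem unitActInv_apply (c : ∀ X, CounitSum σ X) (N : Psh k M) {X : M} (n : N.sec X) :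
    unitActInv c N X n =
      ∑ j, gen σ.act ((c X).t j ≫ (σ.assoc _ _ X).inv) ((c X).i j).adjunction.counit n := rfl

theorem Psh.sum_res {N : Psh k M} {X Y : M} {I : Type*} (s : Finset I) (f : I → (X ⟶ Y))
    (n : N.sec Y) : N.res (∑ i ∈ s, f i) n = ∑ i ∈ s, N.res (f i) n :=
  map_sum (⟨⟨fun f => N.res f n, by simpa using N.res_smul (0 : k) (0 : X ⟶ Y) n⟩,
    fun f g => N.res_add f g n⟩ : (X ⟶ Y) →+ N.sec X) f s

/-- The unitor of the presheaf category of a module category. -/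
def unitActIso (h : σ.UnitActs) (hσ : σ.IsFaithful) (c : ∀ X, CounitSum σ X) (N : Psh k M) :
    dayObj σ.act (unitPsh k S) N ≅ N :=
  Psh.isoOfSections (unitActHom h hσ N) (unitActInv c N)
    (fun X n => by
      rw [unitActInv_apply, map_sum]
      simp only [unitActHom_gen, Category.assoc, h.act_counit hσ (RespectedPair.respected _),
        Iso.inv_hom_id_assoc]
      rw [← Psh.sum_res, (c X).sum, Psh.res_id])
    (fun X => LinearMap.congr_fun (f := unitActInv c N X ∘ₗ Psh.app (unitActHom h hσ N) X)
      (g := LinearMap.id) (gen_ext _ fun H Y f t n => by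
        rw [LinearMap.comp_apply, unitActInv_apply, LinearMap.id_apply, unitActHom_gen]
        -- The exchange used for the unitors of `unitPsh`: the action of `t` is evaluated on the
        -- counit's object, `unit_swap` turns this into the counit evaluated on `H`, and that is the
        -- counit at `H ⋆ Y`. Naturality brings it to `X`, so that summing over `j` leaves `f`.
        have e : ∀ j, gen σ.act ((c X).t j ≫ (σ.assoc _ _ X).inv)
              ((c X).i j).adjunction.counit (N.res (f ≫ h.act t Y) n) =
            gen σ.act (((c X).t j ≫ ((c X).i j).respected.adj.counit.app X) ≫ f) t n := fun j => by
          have e₁ := h.act_counit hσ ((c X).i j).respected X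
          rw [← Iso.inv_comp_eq] at e₁
          have e₂ := h.act_tensor hσ ((c X).i j).adjunction.counit H Y
          rw [← Iso.eq_inv_comp] at e₂
          rw [gen_right_res, ← e₁]
          simp only [Category.assoc, Functor.map_comp, h.map_act]
          rw [← h.act_naturality hσ ((c X).i j).adjunction.counit f, e₂]
          simp only [← Category.assoc]
          rw [← gen_mid_res, ← gen_mid_res, unit_swap]
        simp only [e]
        rw [← gen_sum_left, ← Preadditive.sum_comp, (c X).sum, Category.id_comp]))

theorem unitActHom_naturality (h : σ.UnitActs) (hσ : σ.IsFaithful) {N N' : Psh k M} (φ : N ⟶ N') :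
    dayMap σ.act (𝟙 (unitPsh k S)) φ ≫ unitActHom h hσ N' = unitActHom h hσ N ≫ φ :=
  dayObj_hom_ext _ fun X H Y f t n => by
    rw [Psh.app_comp, Psh.app_comp, dayMap_gen, unitActHom_gen, unitActHom_gen, Psh.app_id,
      Psh.app_res]

theorem unitActHom_triangle (h : σ.UnitActs) (hσ : σ.IsFaithful) (P : Psh k S) (N : Psh k M) :
    assocHom σ P (unitPsh k S) N ≫ dayMap σ.act (𝟙 P) (unitActHom h hσ N) =
      dayMap σ.act (unitRightHom P) (𝟙 N) :=
  dayObj_hom_ext₂ _ _ fun X L Y f H A g p t n => by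
    rw [Psh.app_comp, assocHom_gen, dayMap_gen, dayMap_gen, unitActHom_gen, unitRightHom_gen,
      Psh.app_id, Psh.app_id, gen_mid_res, gen_right_res, Category.id_comp]
    simp only [Category.assoc, h.map_act, Functor.map_comp, NatTrans.comp_app,
      Iso.hom_inv_id_assoc]

/-- If `M` is generated by the action of `S` and respects adjunctions, then the category of
presheaves on `M` is a monoidal module category. -/
theorem isMonoidal_psh (hS : IsRigid k S) (hg : σ.Generated) (hr : σ.RespectsAdjunctions) :
    σ.psh.IsMonoidal (unitStr hS) := by
  have h := unitActs_of_respectsAdjunctions hS hr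
  have hσ := isFaithful_of_generated hS hg hr
  have hc : ∀ X, Nonempty (CounitSum σ X) := fun X => by
    obtain ⟨n, i, t, ht⟩ := exists_sum_counit hS hg hr X
    exact ⟨⟨n, i, t, ht⟩⟩
  exact ⟨NatIso.ofComponents (fun N => unitActIso h hσ (fun X => (hc X).some) N)
    fun φ => unitActHom_naturality h hσ φ, unitActHom_triangle h hσ⟩

end

end UnitAction

/-! ### Independence of the choice of unit -/

section UnitComparison

variable {k : Type u} [Field k]
  {C : Type v₁} [Category.{w₁} C] [Preadditive C] [Linear k C] [SemigroupCategory k C]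
  {N : Type v₂} [Category.{w₂} N] [Preadditive N] [Linear k N]

local notation:70 F:70 " ⊠ " G:71 =>
  CategoryTheory.Functor.obj (CategoryTheory.Functor.obj (tensor k) F) G
local notation:81 F:82 " ◁ " f:81 =>
  CategoryTheory.Functor.map (CategoryTheory.Functor.obj (tensor k) F) f
local notation:81 f:81 " ▷ " G:82 =>
  NatTrans.app (CategoryTheory.Functor.map (tensor k) f) G
local notation "α_" => SemigroupCategory.assoc (k := k)

namespace UnitStr

variable (U : UnitStr k C)

/-- The left unitor. -/
def lam (P : C) : U.unit ⊠ P ≅ P := U.left.app P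

/-- The right unitor. -/
def rho (P : C) : P ⊠ U.unit ≅ P := U.right.app P

theorem rho_naturality {P Q : C} (f : P ⟶ Q) : f ▷ U.unit ≫ (U.rho Q).hom = (U.rho P).hom ≫ f :=
  U.right.hom.naturality f

theorem triangle_hom (P Q : C) : (α_ P U.unit Q).hom ≫ P ◁ (U.lam Q).hom = (U.rho P).hom ▷ Q :=
  U.triangle P Q

/-- Tensoring with the unit is isomorphic to the identity functor, hence faithful. -/
theorem eq_of_whiskerRight {P Q : C} {f g : P ⟶ Q} (h : f ▷ U.unit = g ▷ U.unit) : f = g := by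
  rw [← cancel_epi (U.rho P).hom, ← U.rho_naturality, ← U.rho_naturality, h]

/-- Kelly's argument: after tensoring with the unit on the right, the identity follows from the
pentagon and from the triangle axiom for `P ⊠ Q` and for `Q`. -/
theorem rho_tensor (P Q : C) :
    (U.rho (P ⊠ Q)).hom = (α_ P Q U.unit).hom ≫ P ◁ (U.rho Q).hom := by
  refine U.eq_of_whiskerRight ?_
  have h := SemigroupCategory.pentagon (k := k) P Q U.unit U.unit
  have h₂ := SemigroupCategory.assoc_nat₂ (k := k) P (U.rho Q).hom U.unit
  rw [← U.triangle_hom, Functor.map_comp, NatTrans.comp_app,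
    ← cancel_mono (α_ P Q U.unit).hom, Category.assoc, Category.assoc, h₂,
    SemigroupCategory.assoc_nat₃, ← reassoc_of% h, ← U.triangle_hom, Functor.map_comp]

/-- The canonical comparison of two units respects right unitors: the triangle axiom of `U` replaces
its left unitor by its right unitor, and naturality of the right unitor of `U'` and `rho_tensor`
finish. -/
theorem whiskerLeft_unit_comparison_rho (U' : UnitStr k C) (P : C) :
    P ◁ ((U'.rho U.unit).inv ≫ (U.lam U'.unit).hom) ≫ (U'.rho P).hom = (U.rho P).hom := by
  rw [Functor.map_comp, Category.assoc, ← cancel_epi (P ◁ (U'.rho U.unit).hom),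
    ← Functor.map_comp_assoc, Iso.hom_inv_id, CategoryTheory.Functor.map_id, Category.id_comp,
    ← cancel_epi (α_ P U.unit U'.unit).hom, ← Category.assoc, U.triangle_hom, U'.rho_naturality,
    rho_tensor, Category.assoc]

end UnitStr

/-- The triangle axiom of a module category involves only the right unitor of the unit, so the
unitor can be transported along the canonical comparison of units. -/
theorem SemigroupModule.IsMonoidal.of_unitStr {σ : SemigroupModule k C N} {U : UnitStr k C}
    (h : σ.IsMonoidal U) (U' : UnitStr k C) : σ.IsMonoidal U' := by
  obtain ⟨l, hl⟩ := h
  let u : U.unit ≅ U'.unit := (U'.rho U.unit).symm ≪≫ U.lam U'.unit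
  have hu : ∀ P : C, P ◁ u.inv ≫ (U.rho P).hom = (U'.rho P).hom := fun P => by
    rw [← U.whiskerLeft_unit_comparison_rho U' P, ← Functor.map_comp_assoc]
    change P ◁ (u.inv ≫ u.hom) ≫ _ = _
    rw [Iso.inv_hom_id, CategoryTheory.Functor.map_id, Category.id_comp]
  refine ⟨σ.act.mapIso u.symm ≪≫ l, fun P X => ?_⟩
  change (σ.assoc P U'.unit X).hom ≫ (σ.act.obj P).map ((σ.act.map u.inv).app X ≫ l.hom.app X) =
    (σ.act.map (U'.rho P).hom).app X
  have hl' : (σ.assoc P U.unit X).hom ≫ (σ.act.obj P).map (l.hom.app X) =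
    (σ.act.map (U.rho P).hom).app X := hl P X
  rw [Functor.map_comp, ← reassoc_of% σ.assoc_nat₂, hl', ← hu P, Functor.map_comp,
    NatTrans.comp_app]

end UnitComparison

/-! ### Cocontinuous monoidal module categories respect adjunctions -/

section MonoidalModule

variable {k : Type u} [Field k]
  {S : Type u} [Category.{u} S] [Preadditive S] [Linear k S] [SemigroupCategory k S]
  {N : Type v₂} [Category.{w₂} N] [Preadditive N] [Linear k N]

local notation:70 F:70 " ⊠ " G:71 =>
  CategoryTheory.Functor.obj (CategoryTheory.Functor.obj (tensor k) F) G
local notation:81 F:82 " ◁ " f:81 =>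
  CategoryTheory.Functor.map (CategoryTheory.Functor.obj (tensor k) F) f
local notation:81 f:81 " ▷ " G:82 =>
  NatTrans.app (CategoryTheory.Functor.map (tensor k) f) G
local notation "α_" => SemigroupCategory.assoc (k := k)

/-- The right unitor of the unit presheaf. -/
def unitRho (P : Psh k S) : P ⊠ unitPsh k S ⟶ P := unitRightHom P

/-- Links evaluation in the presheaf category with left components in `S`. By Yoneda it is enough to
follow the identity of `K ⊠ H`, which both sides send to `unitL t K`. -/
theorem yoToDay_unit {K H : S} (t : (unitPsh k S).sec H) :
    yoToDay (tensor k) K H ≫ dayMap (tensor k) (𝟙 (yo.obj K)) (Psh.el t) ≫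
      unitRightHom (yo.obj K) = yo.map (unitL t K) :=
  Psh.yo_hom_ext (by
    rw [Psh.app_comp, Psh.app_comp, yoToDay_app, dayMap_gen, unitRightHom_gen, Psh.app_id,
      Psh.el_app_id, yo_res, yo_app, Category.comp_id, Category.id_comp])

theorem yoTensor_unit {K H : S} (t : (unitPsh k S).sec H) :
    (yoTensor K H).hom ≫ yo.obj K ◁ Psh.el t ≫ unitRho (yo.obj K) = yo.map (unitL t K) :=
  yoToDay_unit t

/-- The unit of the duality between representable presheaves, `t ↦ tˡ ∘ ηʳ`. -/
def Adj.unitHom {F F' : S} (d : Adj k F F') : unitPsh k S ⟶ yo.obj (F' ⊠ F) :=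
  Psh.ofComponents
    (fun H =>
      { toFun := fun t => yoMk (d.etaR H ≫ unitL t (F' ⊠ F))
        map_add' := fun t t' => by rw [unitL_add, Preadditive.comp_add]; rfl
        map_smul' := fun c t => by rw [unitL_smul, Linear.comp_smul]; rfl })
    (fun {G H} f t => by
      change yoMk (d.etaR G ≫ unitL _ (F' ⊠ F)) =
        (yo.obj (F' ⊠ F)).res f (yoMk (d.etaR H ≫ unitL t (F' ⊠ F)))
      rw [yo_res, unitL_res, ← Category.assoc, ← d.etaR_naturality, Category.assoc])

theorem Adj.unitHom_app {F F' : S} (d : Adj k F F') {H : S} (t : (unitPsh k S).sec H) :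
    Psh.app d.unitHom H t = yoMk (d.etaR H ≫ unitL t (F' ⊠ F)) := rfl

/-- `unitHom` is built from `ηʳ`, whereas coherence in a module category is phrased with `ηˡ`. The
axiom relating the two, together with the module property and naturality of left components, gives
the passage. -/
theorem Adj.dayMap_unitHom {F F' : S} (d : Adj k F F') (K : S) :
    dayMap (tensor k) (𝟙 (yo.obj K)) d.unitHom =
      unitRightHom (yo.obj K) ≫ yo.map (d.etaL K) ≫ yoToDay (tensor k) K (F' ⊠ F) :=
  dayObj_hom_ext _ fun X H G f p t => by
    obtain ⟨p, rfl⟩ : ∃ g, yoMk g = p := ⟨yoHom p, yoMk_hom p⟩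
    rw [Psh.app_comp, Psh.app_comp, dayMap_gen, unitRightHom_gen, Psh.app_id, d.unitHom_app,
      yo_res, yo_app, yoToDay_app]
    have e₁ : yoMk (k := k) p = (yo.obj K).res p (yoMk (𝟙 K)) := by
      rw [yo_res, Category.comp_id]
    have e₂ : yoMk (k := k) (d.etaR G ≫ unitL t (F' ⊠ F)) =
        (yo.obj (F' ⊠ F)).res (d.etaR G ≫ unitL t (F' ⊠ F)) (yoMk (𝟙 _)) := by
      rw [yo_res, Category.comp_id]
    rw [e₁, e₂, gen_right_res, gen_mid_res]
    congr 1
    simp only [Category.assoc]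
    rw [NatTrans.naturality, Functor.map_comp, ← d.etaL_compat, Category.assoc, ← unitL_tensor,
      unitL_naturality, reassoc_of% (unitL_naturality t p)]

theorem Adj.whiskerLeft_unitHom {F F' : S} (d : Adj k F F') (K : S) :
    yo.obj K ◁ d.unitHom = unitRho (yo.obj K) ≫ yo.map (d.etaL K) ≫ (yoTensor K (F' ⊠ F)).hom :=
  d.dayMap_unitHom K

namespace SemigroupModule

variable {τ : SemigroupModule k (Psh k S) N} (hS : IsRigid k S)

/-- A unitor of a module category over presheaves. -/
structure Unitor (τ : SemigroupModule k (Psh k S) N) where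
  iso : ∀ X : N, (τ.act.obj (unitPsh k S)).obj X ≅ X
  naturality : ∀ {X Y : N} (f : X ⟶ Y),
    (τ.act.obj (unitPsh k S)).map f ≫ (iso Y).hom = (iso X).hom ≫ f
  triangle : ∀ (P : Psh k S) (X : N),
    (τ.assoc P (unitPsh k S) X).hom ≫ (τ.act.obj P).map (iso X).hom =
      (τ.act.map (unitRho P)).app X

theorem IsMonoidal.unitor (h : τ.IsMonoidal (unitStr hS)) : Nonempty (Unitor τ) := by
  obtain ⟨l, hl⟩ := h
  exact ⟨⟨fun X => l.app X, fun f => l.hom.naturality f, hl⟩⟩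

namespace Unitor

variable (l : Unitor τ)

/-- The action of a section of the unit presheaf. -/
def act {H : S} (t : (unitPsh k S).sec H) (X : N) : (τ.restrictYo.act.obj H).obj X ⟶ X :=
  (τ.act.map (Psh.el t)).app X ≫ (l.iso X).hom

/-- The triangle axiom turns the unitor under `K ⋆ -` into the right unitor at `yo K`, where
`yoTensor_unit` evaluates it. -/
theorem act_isUnitAction {H : S} (t : (unitPsh k S).sec H) (X : N) :
    τ.restrictYo.IsUnitAction t X (l.act t X) := fun K => by
  rw [Iso.eq_inv_comp]
  have e := congrArg (fun f => (τ.act.map f).app X) (yoTensor_unit t (K := K))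
  simp only [Functor.map_comp, NatTrans.comp_app] at e
  rw [← l.triangle, reassoc_of% (τ.assoc_nat₂ (yo.obj K) (Psh.el t) X), ← Functor.map_comp] at e
  refine Eq.trans ?_ e
  exact Category.assoc _ _ _

theorem act_naturality {H : S} (t : (unitPsh k S).sec H) {X Y : N} (f : X ⟶ Y) :
    (τ.restrictYo.act.obj H).map f ≫ l.act t Y = l.act t X ≫ f := by
  refine ((τ.act.map (Psh.el t)).naturality_assoc f _).trans ?_
  rw [l.naturality]
  exact (Category.assoc _ _ _).symm

/-- The unit presheaf is covered by its sections. Cocontinuity of `- ⋆ X` preserves this cover, and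
the unitor identifies its target with `X`. -/
theorem jointlyEpi_act (hc : τ.Cocontinuous) (X : N) :
    JointlyEpi fun i : Σ H, (unitPsh k S).sec H => l.act i.2 X := by
  have := hc.2 X
  intro Z a b e
  rw [← cancel_epi (l.iso X).hom]
  refine JointlyEpi.map_of_preservesColimits (T := τ.act.flip.obj X)
    (unitPsh k S).jointlyEpi_el _ _ fun i => ?_
  exact (Category.assoc _ _ _).symm.trans ((e i).trans (Category.assoc _ _ _))

/-- Naturality of the actions of sections turns equality after acting by `H` into equality after
composing with a jointly epimorphic family. -/
theorem isFaithful (l : Unitor τ) (hc : τ.Cocontinuous) : τ.restrictYo.IsFaithful := fun X Y a b h =>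
  l.jointlyEpi_act hc X _ _ fun i => by
    rw [← l.act_naturality, ← l.act_naturality, h]

/-- The unit of the adjunction between the actions of dual objects. -/
def eta {F F' : S} (d : Adj k F F') (X : N) :
    X ⟶ (τ.restrictYo.act.obj F').obj ((τ.restrictYo.act.obj F).obj X) :=
  (l.iso X).inv ≫ (τ.act.map d.unitHom).app X ≫ (τ.restrictYo.assoc F' F X).hom

/-- Coherence of the unit: the triangle axiom moves the unitor of `X` to the right unitor of `yo H`,
and `whiskerLeft_unitHom` then produces `ηˡ` at `H`. -/
theorem map_eta {F F' : S} (d : Adj k F F') (H : S) (X : N) :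
    (τ.restrictYo.act.obj H).map (l.eta d X) =
      (τ.restrictYo.act.map (d.etaL H)).app X ≫ (τ.restrictYo.assoc H (F' ⊠ F) X).hom ≫
        (τ.restrictYo.act.obj H).map (τ.restrictYo.assoc F' F X).hom := by
  have e := congrArg (fun f => (τ.act.map f).app X) (d.whiskerLeft_unitHom H)
  simp only [Functor.map_comp, NatTrans.comp_app] at e
  rw [← l.triangle] at e
  have e₃ : (τ.act.obj (yo.obj H)).map ((l.iso X).inv ≫ (τ.act.map d.unitHom).app X) =
      (τ.act.map (yo.map (d.etaL H))).app X ≫ (τ.act.map (yoTensor H (F' ⊠ F)).hom).app X ≫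
        (τ.assoc (yo.obj H) (yo.obj (F' ⊠ F)) X).hom := by
    rw [Functor.map_comp, ← cancel_epi ((τ.act.obj (yo.obj H)).map (l.iso X).hom),
      ← Functor.map_comp_assoc, Iso.hom_inv_id, CategoryTheory.Functor.map_id, Category.id_comp,
      ← cancel_epi (τ.assoc (yo.obj H) (unitPsh k S) X).hom, ← τ.assoc_nat₂, e]
    simp only [Category.assoc]
  change (τ.act.obj (yo.obj H)).map ((l.iso X).inv ≫ (τ.act.map d.unitHom).app X ≫ _) = _
  refine ((congrArg (τ.act.obj (yo.obj H)).map (Category.assoc _ _ _).symm).trans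
    (Functor.map_comp _ _ _)).trans ?_
  rw [e₃]
  refine (Category.assoc _ _ _).trans ?_
  exact congrArg (_ ≫ ·) rfl

/-- A cocontinuous monoidal module category respects adjunctions. -/
def respectedAdj (hc : τ.Cocontinuous) {F F' : S} (d : Adj k F F') :
    τ.restrictYo.RespectedAdj d :=
  RespectedAdj.ofCoherent (l.isFaithful hc) d (l.eta d)
    (fun X => (τ.restrictYo.assoc F F' X).inv ≫ l.act d.counit X)
    (fun H X => by
      rw [Functor.map_comp, l.act_isUnitAction, Adj.unitL_counit])
    (l.map_eta d)

/-- A section over `H` is a restriction of the counit of `H`, so its action factors through the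
counit of the adjunction `F ⋆ - ⊣ F' ⋆ -` for `F = H`. The actions of sections are already jointly
epimorphic. -/
theorem counitsEpi (l : Unitor τ) (hS : IsRigid k S) (hc : τ.Cocontinuous) : τ.restrictYo.CounitsEpi := fun X =>
  (l.jointlyEpi_act hc X).of_factor fun ⟨H, t⟩ =>
    ⟨⟨H, _, hS.adj H, l.respectedAdj hc (hS.adj H)⟩,
      (τ.restrictYo.act.map ((hS.adj H).etaL H ≫ (α_ H (hS.dual H) H).inv ≫
        unitL t (H ⊠ hS.dual H))).app X ≫ (τ.restrictYo.assoc _ _ X).hom, by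
      refine l.isFaithful hc _ _ fun K => ?_
      have e := ((l.respectedAdj hc (hS.adj H)).isUnitAction X).res ((hS.adj H).etaL H ≫
        (α_ H (hS.dual H) H).inv ≫ unitL t (H ⊠ hS.dual H)) K
      rw [hS.res_counit] at e
      rw [Category.assoc]
      exact e.trans (l.act_isUnitAction t X K).symm⟩

end Unitor

end SemigroupModule

end MonoidalModule

/-! ### Module functors, transport of structure, full module subcategories -/

section ModuleFunctors

variable {k : Type u} [Field k]
  {S : Type v₁} [Category.{w₁} S] [Preadditive S] [Linear k S] [SemigroupCategory k S]

/-- A `k`-linear functor of semigroup `S`-module categories. -/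
structure ModuleFunctor {M : Type v₂} [Category.{w₂} M] [Preadditive M] [Linear k M]
    {N : Type v₃} [Category.{w₃} N] [Preadditive N] [Linear k N]
    (σ : SemigroupModule k S M) (τ : SemigroupModule k S N) where
  functor : M ⥤ N
  map_add : ∀ {X Y : M} (f g : X ⟶ Y), functor.map (f + g) = functor.map f + functor.map g
  map_smul : ∀ {X Y : M} (r : k) (f : X ⟶ Y), functor.map (r • f) = r • functor.map f
  iso : ∀ (F : S) (X : M),
    functor.obj ((σ.act.obj F).obj X) ≅ (τ.act.obj F).obj (functor.obj X)
  iso_nat_left : ∀ {F G : S} (f : F ⟶ G) (X : M),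
    functor.map ((σ.act.map f).app X) ≫ (iso G X).hom =
      (iso F X).hom ≫ (τ.act.map f).app (functor.obj X)
  iso_nat_right : ∀ (F : S) {X Y : M} (h : X ⟶ Y),
    functor.map ((σ.act.obj F).map h) ≫ (iso F Y).hom =
      (iso F X).hom ≫ (τ.act.obj F).map (functor.map h)
  coherence : ∀ (F G : S) (X : M),
    functor.map (σ.assoc F G X).hom ≫ (iso F ((σ.act.obj G).obj X)).hom ≫
        (τ.act.obj F).map (iso G X).hom =
      (iso (((tensor k).obj F).obj G) X).hom ≫ (τ.assoc F G (functor.obj X)).hom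

variable {M : Type v₂} [Category.{w₂} M] [Preadditive M] [Linear k M]
  {N : Type v₃} [Category.{w₃} N] [Preadditive N] [Linear k N]
  {L : Type v₄} [Category.{w₄} L] [Preadditive L] [Linear k L]
  {σ : SemigroupModule k S M} {τ : SemigroupModule k S N} {ρ : SemigroupModule k S L}

/-- The functor underlying an equivalence of module categories. -/
def ModuleEquiv.toModuleFunctor (e : ModuleEquiv σ τ) : ModuleFunctor σ τ where
  functor := e.functor
  map_add := e.map_add
  map_smul := e.map_smul
  iso := e.iso
  iso_nat_left := e.iso_nat_left
  iso_nat_right := e.iso_nat_right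
  coherence := e.coherence

namespace ModuleFunctor

variable (Φ : ModuleFunctor σ τ)

instance : Φ.functor.Additive := ⟨Φ.map_add _ _⟩
instance : Φ.functor.Linear k := ⟨fun f r => Φ.map_smul r f⟩

/-- A module functor that is an equivalence of categories. -/
def toModuleEquiv (h : Φ.functor.IsEquivalence) : ModuleEquiv σ τ where
  functor := Φ.functor
  map_add := Φ.map_add
  map_smul := Φ.map_smul
  isEquivalence := h
  iso := Φ.iso
  iso_nat_left := Φ.iso_nat_left
  iso_nat_right := Φ.iso_nat_right
  coherence := Φ.coherence

/-- The composite of two module functors. -/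
def comp (Ψ : ModuleFunctor τ ρ) : ModuleFunctor σ ρ where
  functor := Φ.functor ⋙ Ψ.functor
  map_add f g := by simp only [Functor.comp_map, Φ.map_add, Ψ.map_add]
  map_smul r f := by simp only [Functor.comp_map, Φ.map_smul, Ψ.map_smul]
  iso F X := Ψ.functor.mapIso (Φ.iso F X) ≪≫ Ψ.iso F _
  iso_nat_left f X := by
    simp only [Functor.comp_map, Functor.comp_obj, Iso.trans_hom, Functor.mapIso_hom,
      ← Functor.map_comp_assoc, Φ.iso_nat_left, Category.assoc]
    simp only [Functor.map_comp, Category.assoc, Ψ.iso_nat_left]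
  iso_nat_right F _ _ h := by
    simp only [Functor.comp_map, Functor.comp_obj, Iso.trans_hom, Functor.mapIso_hom,
      ← Functor.map_comp_assoc, Φ.iso_nat_right, Category.assoc]
    simp only [Functor.map_comp, Category.assoc, Ψ.iso_nat_right]
  coherence F G X := by
    have h := congrArg Ψ.functor.map (Φ.coherence F G X)
    simp only [Functor.map_comp] at h
    simp only [Functor.comp_map, Functor.comp_obj, Iso.trans_hom, Functor.mapIso_hom,
      Functor.map_comp, Category.assoc, ← reassoc_of% (Ψ.iso_nat_right F), Ψ.coherence,
      reassoc_of% h]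

theorem coherence_inv' (F G : S) (X : M) :
    (Φ.iso F ((σ.act.obj G).obj X)).hom ≫ (τ.act.obj F).map (Φ.iso G X).hom ≫
        (τ.assoc F G (Φ.functor.obj X)).inv =
      Φ.functor.map (σ.assoc F G X).inv ≫ (Φ.iso (((tensor k).obj F).obj G) X).hom := by
  have h := Φ.coherence F G X
  rw [← cancel_mono (τ.assoc F G (Φ.functor.obj X)).hom]
  simp only [Category.assoc, Iso.inv_hom_id, Category.comp_id, ← h]
  rw [← Functor.map_comp_assoc, Iso.inv_hom_id, CategoryTheory.Functor.map_id, Category.id_comp]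

/-- A module functor from its underlying functor and the inverses of its coherence
isomorphisms. -/
def ofInv (R : M ⥤ N) [R.Additive] [R.Linear k]
    (θ : ∀ (F : S) (X : M), (τ.act.obj F).obj (R.obj X) ⟶ R.obj ((σ.act.obj F).obj X))
    [∀ F X, IsIso (θ F X)]
    (nat_left : ∀ {F G : S} (f : F ⟶ G) (X : M),
      (τ.act.map f).app (R.obj X) ≫ θ G X = θ F X ≫ R.map ((σ.act.map f).app X))
    (nat_right : ∀ (F : S) {X Y : M} (h : X ⟶ Y),
      (τ.act.obj F).map (R.map h) ≫ θ F Y = θ F X ≫ R.map ((σ.act.obj F).map h))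
    (coh : ∀ (F G : S) (X : M),
      (τ.assoc F G (R.obj X)).hom ≫ (τ.act.obj F).map (θ G X) ≫ θ F ((σ.act.obj G).obj X) =
        θ (((tensor k).obj F).obj G) X ≫ R.map (σ.assoc F G X).hom) : ModuleFunctor σ τ where
  functor := R
  map_add f g := R.map_add
  map_smul r f := R.map_smul r f
  iso F X := (asIso (θ F X)).symm
  iso_nat_left f X := by
    rw [Iso.symm_hom, Iso.symm_hom, asIso_inv, asIso_inv, IsIso.comp_inv_eq, Category.assoc,
      nat_left, IsIso.inv_hom_id_assoc]
  iso_nat_right F _ _ h := by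
    rw [Iso.symm_hom, Iso.symm_hom, asIso_inv, asIso_inv, IsIso.comp_inv_eq, Category.assoc,
      nat_right, IsIso.inv_hom_id_assoc]
  coherence F G X := by
    simp only [Iso.symm_hom, asIso_inv]
    rw [IsIso.eq_inv_comp, ← reassoc_of% (coh F G X), IsIso.hom_inv_id_assoc,
      ← Functor.map_comp, IsIso.hom_inv_id, CategoryTheory.Functor.map_id, Category.comp_id]

end ModuleFunctor

/-- The composite of two equivalences of module categories. -/
def ModuleEquiv.comp (e : ModuleEquiv σ τ) (e' : ModuleEquiv τ ρ) : ModuleEquiv σ ρ :=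
  (e.toModuleFunctor.comp e'.toModuleFunctor).toModuleEquiv (by
    have := e.isEquivalence
    have := e'.isEquivalence
    exact inferInstanceAs (e.functor ⋙ e'.functor).IsEquivalence)

section Full

variable (σ) in
/-- The inclusion of a full subcategory stable under the action. -/
def fullInclusion (P : ObjectProperty M) (h : ∀ (F : S) (X : M), P X → P ((σ.act.obj F).obj X)) :
    ModuleFunctor (σ.full P h) σ where
  functor := P.ι
  map_add _ _ := rfl
  map_smul _ _ := rfl
  iso F X := Iso.refl _
  iso_nat_left f X := (Category.comp_id _).trans (Category.id_comp _).symm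
  iso_nat_right F _ _ h := (Category.comp_id _).trans (Category.id_comp _).symm
  coherence F G X := by
    refine Eq.trans ?_ (Category.id_comp _).symm
    refine Eq.trans ?_ (Category.comp_id _)
    refine congrArg (_ ≫ ·) ?_
    exact (Category.id_comp _).trans (CategoryTheory.Functor.map_id _ _)

/-- A module functor with values in a full subcategory stable under the action. -/
def ModuleFunctor.lift (Φ : ModuleFunctor σ τ) (P : ObjectProperty N)
    (h : ∀ (F : S) (X : N), P X → P ((τ.act.obj F).obj X)) (hP : ∀ X, P (Φ.functor.obj X)) :
    ModuleFunctor σ (τ.full P h) where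
  functor := P.lift Φ.functor hP
  map_add f g := by apply ObjectProperty.hom_ext; exact Φ.map_add f g
  map_smul r f := by apply ObjectProperty.hom_ext; exact Φ.map_smul r f
  iso F X := ObjectProperty.isoMk P (Φ.iso F X)
  iso_nat_left f X := by apply ObjectProperty.hom_ext; exact Φ.iso_nat_left f X
  iso_nat_right F _ _ g := by apply ObjectProperty.hom_ext; exact Φ.iso_nat_right F g
  coherence F G X := by apply ObjectProperty.hom_ext; exact Φ.coherence F G X

end Full

section Transport

variable (τ) {D : Type v₂} [Category.{w₂} D] [Preadditive D] [Linear k D] (ι : D ⥤ N)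
  [ι.Full] [ι.Faithful] [ι.Additive] [ι.Linear k]
  (φ : S → D → D) (e : ∀ F d, ι.obj (φ F d) ≅ (τ.act.obj F).obj (ι.obj d))

/-- The transport of a module structure along a fully faithful functor whose image is stable
under the action up to isomorphism. -/
def SemigroupModule.transport : SemigroupModule k S D where
  act :=
    { obj := fun F =>
        { obj := φ F
          map := fun f => ι.preimage ((e F _).hom ≫ (τ.act.obj F).map (ι.map f) ≫ (e F _).inv)
          map_id := fun d => ι.map_injective (by simp)
          map_comp := fun f g => ι.map_injective (by simp) }
      map := fun f =>
        { app := fun d => ι.preimage ((e _ d).hom ≫ (τ.act.map f).app _ ≫ (e _ d).inv)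
          naturality := fun d d' g => ι.map_injective (by simp) }
      map_id := fun F => by ext d; exact ι.map_injective (by simp)
      map_comp := fun f g => by ext d; exact ι.map_injective (by simp) }
  bilinear :=
    { map_add_left := fun f g d => ι.map_injective (by
        simp [Functor.map_add, τ.bilinear.map_add_left])
      map_smul_left := fun r f d => ι.map_injective (by
        simp [Functor.map_smul, τ.bilinear.map_smul_left])
      map_add_right := fun F _ _ f g => ι.map_injective (by
        simp [Functor.map_add, τ.bilinear.map_add_right])
      map_smul_right := fun F _ _ r f => ι.map_injective (by
        simp [Functor.map_smul, τ.bilinear.map_smul_right]) }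
  assoc F G d := ι.preimageIso (e _ _ ≪≫ τ.assoc F G (ι.obj d) ≪≫
    (τ.act.obj F).mapIso (e G d).symm ≪≫ (e F _).symm)
  assoc_nat₁ f G d := ι.map_injective (by simp [reassoc_of% τ.assoc_nat₁])
  assoc_nat₂ F _ _ g d := ι.map_injective (by
    simp only [Functor.map_comp, Functor.map_preimage, Functor.preimageIso_hom, Iso.trans_hom,
      Iso.symm_hom, Functor.mapIso_hom, Category.assoc, Iso.inv_hom_id_assoc,
      reassoc_of% τ.assoc_nat₂]
    simp only [← Functor.map_comp_assoc, Iso.inv_hom_id_assoc])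
  assoc_nat₃ F G _ _ g := ι.map_injective (by
    simp only [Functor.map_comp, Functor.map_preimage, Functor.preimageIso_hom, Iso.trans_hom,
      Iso.symm_hom, Functor.mapIso_hom, Category.assoc, Iso.inv_hom_id_assoc,
      reassoc_of% τ.assoc_nat₃]
    simp only [← Functor.map_comp_assoc, Iso.inv_hom_id_assoc])
  pentagon F G H d := ι.map_injective (by
    have h := τ.pentagon F G H (ι.obj d)
    have h' := τ.assoc_nat₃ F G (e H d).inv
    simp only [Functor.map_comp, Functor.map_preimage, Functor.preimageIso_hom, Iso.trans_hom,
      Iso.symm_hom, Functor.mapIso_hom, Category.assoc, Iso.inv_hom_id_assoc]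
    simp only [← Functor.map_comp_assoc, Iso.inv_hom_id_assoc]
    simp only [Functor.map_comp, Category.assoc, reassoc_of% h, reassoc_of% h'])

/-- The functor along which a module structure is transported. -/
def SemigroupModule.transportFunctor : ModuleFunctor (τ.transport ι φ e) τ where
  functor := ι
  map_add f g := ι.map_add
  map_smul r f := ι.map_smul r f
  iso := e
  iso_nat_left f X := by simp [SemigroupModule.transport]
  iso_nat_right F _ _ h := by simp [SemigroupModule.transport]
  coherence F G X := by
    simp only [SemigroupModule.transport, Functor.preimageIso_hom, Functor.map_preimage,
      Iso.trans_hom, Iso.symm_hom, Functor.mapIso_hom, Category.assoc, Iso.inv_hom_id_assoc]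
    rw [← Functor.map_comp, Iso.inv_hom_id, CategoryTheory.Functor.map_id, Category.comp_id]

end Transport

section Transfer

variable (Φ : ModuleFunctor σ τ) [Φ.functor.Full] [Φ.functor.Faithful]

theorem ModuleFunctor.isFaithful (Φ : ModuleFunctor σ τ) [Φ.functor.Full]
    [Φ.functor.Faithful] (h : τ.IsFaithful) : σ.IsFaithful := fun X Y a b hab =>
  Φ.functor.map_injective (h _ _ fun H => by
    rw [← cancel_epi (Φ.iso H X).hom, ← Φ.iso_nat_right, ← Φ.iso_nat_right, hab])

/-- The restriction of a respected adjunction to a full module subcategory. -/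
def ModuleFunctor.respectedAdj (h : τ.IsFaithful) {F F' : S} {d : Adj k F F'}
    (r : τ.RespectedAdj d) : σ.RespectedAdj d :=
  -- Faithfulness passes to the subcategory, so only the coherence of the pulled back unit and
  -- counit has to be checked. The triangle identities are then automatic.
  SemigroupModule.RespectedAdj.ofCoherent (Φ.isFaithful h) d
    (fun X => Φ.functor.preimage (r.adj.unit.app (Φ.functor.obj X) ≫
      (τ.act.obj F').map (Φ.iso F X).inv ≫ (Φ.iso F' _).inv))
    (fun X => Φ.functor.preimage ((Φ.iso F _).hom ≫ (τ.act.obj F).map (Φ.iso F' X).hom ≫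
      r.adj.counit.app (Φ.functor.obj X)))
    (fun H X => Φ.functor.map_injective (by
      have e : (τ.act.obj H).map (r.adj.counit.app (Φ.functor.obj X)) =
        (τ.act.obj H).map (τ.assoc F F' (Φ.functor.obj X)).inv ≫
          (τ.assoc H _ (Φ.functor.obj X)).inv ≫ (τ.act.map (d.epsL H)).app (Φ.functor.obj X) := r.counit_coherent H _
      have e₁ := congrArg (τ.act.obj H).map (Φ.coherence_inv' F F' X)
      simp only [Functor.map_comp] at e₁
      rw [← cancel_mono (Φ.iso H X).hom, Φ.iso_nat_right, Functor.map_preimage]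
      simp only [Functor.map_comp, Category.assoc, e, reassoc_of% e₁, Φ.iso_nat_left]
      rw [← reassoc_of% (Φ.iso_nat_right H), ← reassoc_of% (Φ.coherence_inv' H)]))
    (fun H X => Φ.functor.map_injective (by
      have e : (τ.act.obj H).map (r.adj.unit.app (Φ.functor.obj X)) =
        (τ.act.map (d.etaL H)).app (Φ.functor.obj X) ≫ (τ.assoc H _ (Φ.functor.obj X)).hom ≫
          (τ.act.obj H).map (τ.assoc F' F (Φ.functor.obj X)).hom := r.unit_coherent H _
      have h₁ := Φ.coherence F' F X
      have e₁ : (τ.assoc F' F (Φ.functor.obj X)).hom ≫ (τ.act.obj F').map (Φ.iso F X).inv ≫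
          (Φ.iso F' _).inv = (Φ.iso _ X).inv ≫ Φ.functor.map (σ.assoc F' F X).hom := by
        rw [Iso.eq_inv_comp, ← reassoc_of% h₁, ← Functor.map_comp_assoc, Iso.hom_inv_id,
          CategoryTheory.Functor.map_id, Category.id_comp, Iso.hom_inv_id, Category.comp_id]
      have e₂ := congrArg (τ.act.obj H).map e₁
      simp only [Functor.map_comp] at e₂
      have h₂ := Φ.coherence H (((tensor k).obj F').obj F) X
      rw [← cancel_mono (Φ.iso H _).hom, Φ.iso_nat_right, Functor.map_preimage]
      simp only [Functor.map_comp, Category.assoc, e, e₂, Φ.iso_nat_right]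
      have h₃ : Φ.functor.map (σ.assoc H (((tensor k).obj F').obj F) X).hom ≫
          (Φ.iso H ((σ.act.obj (((tensor k).obj F').obj F)).obj X)).hom =
          (Φ.iso _ X).hom ≫ (τ.assoc H _ _).hom ≫ (τ.act.obj H).map (Φ.iso _ X).inv := by
        rw [← reassoc_of% h₂, ← Functor.map_comp, Iso.hom_inv_id,
          CategoryTheory.Functor.map_id, Category.comp_id]
      rw [reassoc_of% h₃, reassoc_of% (Φ.iso_nat_left (d.etaL H) X)]))

end Transfer

end ModuleFunctors

/-! ### Restriction along Yoneda, and Yoneda as a module functor -/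

section Restriction

variable {k : Type u} [Field k]
  {S : Type u} [Category.{u} S] [Preadditive S] [Linear k S] [SemigroupCategory k S]

/-- Restriction of module functors along the Yoneda embedding. -/
def ModuleFunctor.restrictYo {M : Type v₂} [Category.{w₂} M] [Preadditive M] [Linear k M]
    {N : Type v₃} [Category.{w₃} N] [Preadditive N] [Linear k N]
    {σ : SemigroupModule k (Psh k S) M} {τ : SemigroupModule k (Psh k S) N}
    (Φ : ModuleFunctor σ τ) : ModuleFunctor σ.restrictYo τ.restrictYo where
  functor := Φ.functor
  map_add := Φ.map_add
  map_smul := Φ.map_smul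
  iso F X := Φ.iso (yo.obj F) X
  iso_nat_left f X := Φ.iso_nat_left (yo.map f) X
  iso_nat_right F _ _ h := Φ.iso_nat_right (yo.obj F) h
  coherence F G X := by
    change Φ.functor.map ((σ.act.map (yoTensor F G).hom).app X ≫
      (σ.assoc (yo.obj F) (yo.obj G) X).hom) ≫ (Φ.iso (yo.obj F) _).hom ≫
        (τ.act.obj (yo.obj F)).map (Φ.iso (yo.obj G) X).hom =
      (Φ.iso _ X).hom ≫ (τ.act.map (yoTensor F G).hom).app (Φ.functor.obj X) ≫
        (τ.assoc (yo.obj F) (yo.obj G) (Φ.functor.obj X)).hom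
    rw [Functor.map_comp, Category.assoc, Φ.coherence, reassoc_of% (Φ.iso_nat_left (yoTensor F G).hom X)]

variable {M : Type u} [Category.{u} M] [Preadditive M] [Linear k M]

/-- The Yoneda embedding of a module category. -/
def yoModule (σ : SemigroupModule k S M) : ModuleFunctor σ σ.psh.restrictYo where
  functor := yo
  map_add := yo_map_add
  map_smul := yo_map_smul
  iso F X := yoDay σ.bilinear F X
  iso_nat_left {F F'} f X := by
    change yo.map _ ≫ yoToDay σ.act F' X = yoToDay σ.act F X ≫ dayMap σ.act (yo.map f) (𝟙 _)
    refine Psh.hom_ext fun Y g => ?_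
    rw [Psh.app_comp, Psh.app_comp, ← yoMk_hom g, yo_app, yoToDay_app, yoToDay_app, dayMap_gen,
      Psh.app_id, yo_app, ← gen_mid_res, yo_res, Category.comp_id, Category.id_comp]
  iso_nat_right F X X' f := by
    change yo.map _ ≫ yoToDay σ.act F X' = yoToDay σ.act F X ≫ dayMap σ.act (𝟙 _) (yo.map f)
    refine Psh.hom_ext fun Y g => ?_
    rw [Psh.app_comp, Psh.app_comp, ← yoMk_hom g, yo_app, yoToDay_app, yoToDay_app, dayMap_gen,
      Psh.app_id, yo_app, ← gen_right_res, yo_res, Category.comp_id, Category.id_comp]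
  coherence F G X := by
    change yo.map (σ.assoc F G X).hom ≫ yoToDay σ.act F _ ≫
        dayMap σ.act (𝟙 _) (yoToDay σ.act G X) =
      yoToDay σ.act _ X ≫ dayMap σ.act (yoToDay (tensor k) F G) (𝟙 _) ≫
        (dayAssoc σ (yo.obj F) (yo.obj G) (yo.obj X)).hom
    refine Psh.hom_ext fun Y g => ?_
    simp only [Psh.app_comp]
    rw [← yoMk_hom g, yo_app, yoToDay_app, yoToDay_app, dayMap_gen, dayMap_gen, Psh.app_id,
      Psh.app_id, yoToDay_app, yoToDay_app]
    refine Eq.trans ?_ (assocHom_gen σ _ _ _ _ _ _ _ _).symm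
    simp

end Restriction

/-! ### Summands of finite sums -/

section FinRetract

theorem FinRetract.trans {B : Type v₁} {B' : Type v₃} {N : Type v₂} [Category.{w₂} N]
    [Preadditive N] {K : B → N} {K' : B' → N} {Q : N} (h : FinRetract K Q)
    (hK : ∀ X, FinRetract K' (K X)) : FinRetract K' Q := by
  obtain ⟨n, X, s, q, hsq⟩ := h
  choose m Y s' q' h' using hK
  refine FinRetract.of_finset (I := Σ j, Fin (m (X j))) Finset.univ (fun i => Y _ i.2)
    (fun i => s i.1 ≫ s' _ i.2) (fun i => q' _ i.2 ≫ q i.1) ?_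
  rw [← hsq, Fintype.sum_sigma]
  refine Finset.sum_congr rfl fun j _ => ?_
  rw [← Category.id_comp (q j), ← h', Preadditive.sum_comp, Preadditive.comp_sum]
  simp only [Category.assoc]

theorem FinRetract.of_retract {B : Type v₁} {N : Type v₂} [Category.{w₂} N] [Preadditive N]
    {K : B → N} {Q : N} (X : B) (s : Q ⟶ K X) (q : K X ⟶ Q) (h : s ≫ q = 𝟙 Q) :
    FinRetract K Q :=
  ⟨1, fun _ => X, fun _ => s, fun _ => q, by simpa using h⟩

theorem FinRetract.of_iso {B : Type v₁} {N : Type v₂} [Category.{w₂} N] [Preadditive N]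
    {K : B → N} {Q : N} (X : B) (e : Q ≅ K X) : FinRetract K Q :=
  FinRetract.of_retract X e.hom e.inv e.hom_inv_id

theorem FinRetract.jointlyEpi {B : Type v₁} {N : Type v₂} [Category.{w₂} N] [Preadditive N]
    {K : B → N} {Q : N} (h : FinRetract K Q) :
    JointlyEpi fun i : Σ X, (K X ⟶ Q) => i.2 := fun Z a b e => by
  obtain ⟨n, X, s, q, hsq⟩ := h
  rw [← Category.id_comp a, ← Category.id_comp b, ← hsq, Preadditive.sum_comp,
    Preadditive.sum_comp]
  exact Finset.sum_congr rfl fun j _ => by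
    rw [Category.assoc, Category.assoc]; exact congrArg _ (e ⟨X j, q j⟩)

/-- A natural transformation of additive functors is invertible on finite sums and summands of
objects on which it is invertible. -/
theorem isIso_app_of_finRetract {B : Type v₁} {N : Type v₂} [Category.{w₂} N] [Preadditive N]
    {N' : Type v₃} [Category.{w₃} N'] [Preadditive N'] {K : B → N} {Q : N} (h : FinRetract K Q)
    {L L' : N ⥤ N'} [L.Additive] [L'.Additive] (θ : L ⟶ L') (hθ : ∀ X, IsIso (θ.app (K X))) :
    IsIso (θ.app Q) := by
  obtain ⟨n, X, s, q, hsq⟩ := h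
  -- The inverse at `Q` is assembled from the inverses at the summands. Naturality moves `θ` past
  -- the structure maps, and additivity sums them to the identity.
  refine ⟨∑ j, L'.map (s j) ≫ inv (θ.app (K (X j))) ≫ L.map (q j), ?_, ?_⟩
  · simp only [Preadditive.comp_sum, ← θ.naturality_assoc, IsIso.hom_inv_id_assoc,
      ← Functor.map_comp, ← Functor.map_sum, hsq, CategoryTheory.Functor.map_id]
  · simp only [Preadditive.sum_comp, Category.assoc, θ.naturality, IsIso.inv_hom_id_assoc,
      ← Functor.map_comp, ← Functor.map_sum, hsq, CategoryTheory.Functor.map_id]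

end FinRetract

/-! ### Morita theory: presheaves recovered from projective generators -/

section Morita

variable {k : Type u} [Field k]
  {B : Type u} [Category.{u} B] [Preadditive B] [Linear k B]
  {M : Type u} [Category.{u} M] [Preadditive M] [Linear k M]
  (K : M ⥤ Psh k B) [K.Additive] [K.Linear k]

/-- `Q` is covered by representables, and each of these is covered by objects in the image of `K`.
-/
theorem jointlyEpi_of_generates (hK : ∀ b : B, FinRetract K.obj (yo.obj b)) (Q : Psh k B) :
    JointlyEpi fun i : Σ X, (K.obj X ⟶ Q) => i.2 :=
  (Q.jointlyEpi_el.comp fun i => (hK i.1).jointlyEpi).of_factor fun i =>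
    ⟨⟨_, i.2.2 ≫ Psh.el i.1.2⟩, 𝟙 _, Category.id_comp _⟩

theorem nerve_faithful (hK : ∀ b : B, FinRetract K.obj (yo.obj b)) :
    (nerve (k := k) K).Faithful where
  map_injective {Q Q'} φ ψ h := jointlyEpi_of_generates K hK Q _ _ fun ⟨X, q⟩ => by
    have := congrArg (fun t => nerveHom (Psh.app t X (nerveMk q))) h
    simpa only [nerve_app, nerveHom_mk] using this

section Full

variable {K} {Q Q' : Psh k B} (α : (nerve (k := k) K).obj Q ⟶ (nerve (k := k) K).obj Q')

/-- The map on morphisms out of the objects `K X` given by a morphism of nerves. -/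
def nerveAct {X : M} (q : K.obj X ⟶ Q) : K.obj X ⟶ Q' := nerveHom (Psh.app α X (nerveMk q))

theorem nerveAct_comp [K.Full] {X Y : M} (f : K.obj Y ⟶ K.obj X) (q : K.obj X ⟶ Q) :
    nerveAct α (f ≫ q) = f ≫ nerveAct α q := by
  obtain ⟨f, rfl⟩ := K.map_surjective f
  rw [nerveAct, ← nerve_res, Psh.app_res, nerveHom_res]; rfl

/-- `α` acts only on morphisms out of objects `K X`. It extends to morphisms out of `yo b` by
cutting these along a decomposition of the identity of `yo b`. Fullness of `K` makes `α` commute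
with precomposition, so that the pieces recombine. -/
theorem exists_nerveAct [K.Full] (hK : ∀ b : B, FinRetract K.obj (yo.obj b)) {b : B}
    (q : yo.obj b ⟶ Q) : ∃ q' : yo.obj b ⟶ Q', ∀ (X : M) (h : K.obj X ⟶ yo.obj b),
      h ≫ q' = nerveAct α (h ≫ q) := by
  obtain ⟨n, X, s, r, hsr⟩ := hK b
  refine ⟨∑ j, s j ≫ nerveAct α (r j ≫ q), fun X h => ?_⟩
  have e : ∀ {X : M} {n : ℕ} (t : Fin n → (K.obj X ⟶ Q)), ∑ j, nerveAct α (t j) =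
      nerveAct α (∑ j, t j) := fun {X n} t =>
    (map_sum (Psh.app α X) (fun j => nerveMk (k := k) (t j)) Finset.univ).symm
  rw [Preadditive.comp_sum]
  simp only [← Category.assoc, ← nerveAct_comp]
  rw [e]
  simp only [Category.assoc]
  rw [← Preadditive.comp_sum]
  simp only [← Category.assoc, ← Preadditive.sum_comp, hsr]
  rw [Category.comp_id]

/-- By Yoneda, the extension of `α` to morphisms out of representables defines the components of a
morphism `Q ⟶ Q'`. Linearity and naturality hold because sections of `Q'` are detected by morphisms
from objects `K X` to `yo b`. -/
theorem nerve_full [K.Full] (hK : ∀ b : B, FinRetract K.obj (yo.obj b)) :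
    (nerve (k := k) K).Full where
  map_surjective {Q Q'} α := by
    choose β hβ using fun (b : B) (q : Q.sec b) => exists_nerveAct α hK (Psh.el q)
    have uniq : ∀ {b : B} {x y : Q'.sec b}, (∀ (X : M) (h : K.obj X ⟶ yo.obj b),
        h ≫ Psh.el x = h ≫ Psh.el y) → x = y := fun {b x y} e =>
      Psh.el_injective (jointlyEpi_of_generates K hK _ _ _ fun i => e i.1 i.2)
    have hβ' : ∀ b (q : Q.sec b) (X : M) (h : K.obj X ⟶ yo.obj b),
        h ≫ Psh.el (Psh.app (β b q) b (yoMk (𝟙 b))) = nerveAct α (h ≫ Psh.el q) :=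
      fun b q X h => by rw [Psh.el_eta, hβ]
    let φ : Q ⟶ Q' := Psh.ofComponents
      (fun b =>
        { toFun := fun q => Psh.app (β b q) b (yoMk (𝟙 b))
          map_add' := fun q q' => uniq fun X h => by
            rw [Psh.el_add, Preadditive.comp_add, hβ', hβ', hβ', Psh.el_add,
              Preadditive.comp_add, nerveAct, nerveMk_add, map_add]; rfl
          map_smul' := fun c q => uniq fun X h => by
            rw [RingHom.id_apply, Psh.el_smul, Linear.comp_smul, hβ', hβ', Psh.el_smul,
              Linear.comp_smul, nerveAct, nerveMk_smul, map_smul]; rfl })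
      (fun {b b'} f q => uniq fun X h => by
        change h ≫ Psh.el (Psh.app (β b _) b (yoMk (𝟙 b))) =
          h ≫ Psh.el (Q'.res f (Psh.app (β b' q) b' (yoMk (𝟙 b'))))
        rw [hβ', ← Psh.yo_map_el, ← Psh.yo_map_el, ← Category.assoc, ← Category.assoc, hβ'])
    have hφ : ∀ b (q : Q.sec b), Psh.el q ≫ φ = β b q := fun b q => by
      rw [Psh.el_comp]; exact Psh.el_eta _
    refine ⟨φ, Psh.hom_ext fun X q => ?_⟩
    obtain ⟨q, rfl⟩ : ∃ g : K.obj X ⟶ Q, nerveMk g = q := ⟨nerveHom q, nerveMk_hom q⟩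
    rw [nerve_app]
    refine congrArg (nerveMk (k := k)) (?_ : q ≫ φ = nerveAct α q)
    -- The equality is tested on composites `K Z ⟶ yo b ⟶ K Y ⟶ K X`. On sections `φ` is computed by
    -- `hφ`, and the map from `K Z` allows `hβ` to return to `α`.
    refine (jointlyEpi_of_generates K hK (K.obj X)) _ _ fun ⟨Y, h⟩ => ?_
    change h ≫ q ≫ φ = h ≫ nerveAct α q
    refine (K.obj Y).jointlyEpi_el _ _ fun ⟨b, y⟩ => ?_
    change Psh.el y ≫ h ≫ q ≫ φ = Psh.el y ≫ h ≫ nerveAct α q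
    rw [← Category.assoc, ← Category.assoc, Psh.el_comp, Psh.el_comp, hφ]
    refine jointlyEpi_of_generates K hK _ _ _ fun ⟨Z, z⟩ => ?_
    change z ≫ β b _ = z ≫ _
    rw [hβ, ← Psh.el_comp, ← Psh.el_comp, ← nerveAct_comp, ← Category.assoc, nerveAct_comp,
      Category.assoc, nerveAct_comp, Category.assoc]

end Full

section EssSurj

/-- The comparison of `yo X` with the nerve of `K X`. -/
def yoNerve (X : M) : yo.obj X ⟶ (nerve (k := k) K).obj (K.obj X) :=
  Psh.el (nerveMk (𝟙 (K.obj X)))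

theorem yoNerve_app {X Y : M} (f : Y ⟶ X) :
    Psh.app (yoNerve (k := k) K X) Y (yoMk f) = nerveMk (K.map f) := by
  rw [yoNerve, Psh.el_app, nerve_res, Category.comp_id]

theorem yoNerve_naturality {X Y : M} (f : Y ⟶ X) :
    yo.map f ≫ yoNerve K X = yoNerve K Y ≫ (nerve (k := k) K).map (K.map f) :=
  Psh.yo_hom_ext (by
    rw [Psh.app_comp, Psh.app_comp, yo_app, yoNerve_app, yoNerve_app, nerve_app, Category.id_comp,
      CategoryTheory.Functor.map_id, Category.id_comp])

theorem Psh.isIso_of_bijective {A : Type u} [Category.{u} A] [Preadditive A] [Linear k A]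
    {P Q : Psh k A} (φ : P ⟶ Q) (h : ∀ X, Function.Bijective (Psh.app φ X)) : IsIso φ :=
  ⟨Psh.ofComponents (fun X => (LinearEquiv.ofBijective (Psh.app φ X) (h X)).symm.toLinearMap)
    (fun {X Y} f q => (h X).1 (by
      obtain ⟨p, rfl⟩ := (h Y).2 q
      have e : ∀ Z (x : Q.sec Z), Psh.app φ Z
        ((LinearEquiv.ofBijective (Psh.app φ Z) (h Z)).symm x) = x := fun Z x =>
        (LinearEquiv.ofBijective (Psh.app φ Z) (h Z)).apply_symm_apply x
      refine (e _ _).trans ?_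
      rw [Psh.app_res]
      exact congrArg _ (e _ _).symm)),
    Psh.hom_ext fun X p => by
      rw [Psh.app_comp, Psh.app_ofComponents, Psh.app_id]
      exact (LinearEquiv.ofBijective (Psh.app φ X) (h X)).symm_apply_apply p,
    Psh.hom_ext fun X p => by
      rw [Psh.app_comp, Psh.app_ofComponents, Psh.app_id]
      exact (LinearEquiv.ofBijective (Psh.app φ X) (h X)).apply_symm_apply p⟩

instance isIso_yoNerve [K.Full] [K.Faithful] (X : M) : IsIso (yoNerve (k := k) K X) :=
  Psh.isIso_of_bijective _ fun Y => by
    constructor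
    · intro f g h
      have h' : K.map (yoHom f) = K.map (yoHom g) := by
        have := congrArg nerveHom h
        rwa [← yoMk_hom f, ← yoMk_hom g, yoNerve_app, yoNerve_app] at this
      exact K.map_injective h'
    · intro g
      obtain ⟨f, hf⟩ := K.map_surjective (nerveHom g)
      exact ⟨yoMk f, by rw [yoNerve_app, hf, nerveMk_hom]⟩

instance : (yo (k := k) (A := B) ⋙ nerve (k := k) K).Additive where
  map_add := by simp

instance : (yo (k := k) (A := B) ⋙ nerve (k := k) K).Linear k where
  map_smul f r := by simp [Functor.map_smul]

/-- The presheaf `b ↦ Hom(nerve (yo b), W)`. -/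
abbrev conerve (W : Psh k M) : Psh k B := (nerve (k := k) (yo (k := k) ⋙ nerve (k := k) K)).obj W

variable {K} {W : Psh k M}

/-- A morphism out of the nerve of `yo b` as a section of `conerve`. -/
def conerveMk {b : B} (g : (nerve (k := k) K).obj (yo.obj b) ⟶ W) : (conerve K W).sec b := g

/-- A section of `conerve` as a morphism. -/
def conerveHom {b : B} (g : (conerve K W).sec b) : (nerve (k := k) K).obj (yo.obj b) ⟶ W := g

theorem conerveHom_res {b b' : B} (f : b' ⟶ b) (g : (conerve K W).sec b) :
    conerveHom ((conerve K W).res f g) = (nerve (k := k) K).map (yo.map f) ≫ conerveHom g := rfl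

theorem conerveHom_ext {b : B} {g g' : (conerve K W).sec b} (h : conerveHom g = conerveHom g') :
    g = g' := h

/-- The transposition `Hom(nerve Q, W) → Hom(Q, conerve W)`. -/
def conerveCurry {Q : Psh k B} (φ : (nerve (k := k) K).obj Q ⟶ W) : Q ⟶ conerve K W :=
  Psh.ofComponents
    (fun b =>
      { toFun := fun z => conerveMk ((nerve (k := k) K).map (Psh.el z) ≫ φ)
        map_add' := fun z z' => by
          rw [Psh.el_add, Functor.map_add, Preadditive.add_comp]; rfl
        map_smul' := fun c z => by
          rw [Psh.el_smul, Functor.map_smul, Linear.smul_comp]; rfl })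
    (fun {b b'} f z => conerveHom_ext (by
      rw [conerveHom_res]
      change (nerve (k := k) K).map (Psh.el _) ≫ φ = (nerve (k := k) K).map
        (yo.map f) ≫ (nerve (k := k) K).map (Psh.el z) ≫ φ
      rw [← Psh.yo_map_el, Functor.map_comp, Category.assoc]))

theorem conerveCurry_app {Q : Psh k B} (φ : (nerve (k := k) K).obj Q ⟶ W) {b : B} (z : Q.sec b) :
    conerveHom (Psh.app (conerveCurry φ) b z) = (nerve (k := k) K).map (Psh.el z) ≫ φ := rfl

theorem conerveCurry_comp {Q Q' : Psh k B} (f : Q' ⟶ Q) (φ : (nerve (k := k) K).obj Q ⟶ W) :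
    conerveCurry ((nerve (k := k) K).map f ≫ φ) = f ≫ conerveCurry φ :=
  Psh.hom_ext fun b z => conerveHom_ext (by
    rw [Psh.app_comp, conerveCurry_app, conerveCurry_app, ← Psh.el_comp, Functor.map_comp,
      Category.assoc])

theorem conerveHom_sum {b : B} {n : ℕ} (g : Fin n → (conerve K W).sec b) :
    conerveHom (∑ j, g j) = ∑ j, conerveHom (g j) := rfl

/-- For representable `Q` this is the Yoneda lemma, by the definition of `conerve`. Both sides are
additive in `Q`, so the bijection extends to summands of finite sums. -/
theorem conerveCurry_bijective {Q : Psh k B} (hQ : FinRetract (yo (k := k)).obj Q) :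
    Function.Bijective (conerveCurry (K := K) (W := W) (Q := Q)) := by
  obtain ⟨n, b, s, q, hsq⟩ := hQ
  have hq : ∀ j, Psh.el (Psh.app (q j) (b j) (yoMk (𝟙 _))) = q j := fun j => Psh.el_eta _
  constructor
  · intro φ ψ h
    rw [← Category.id_comp φ, ← Category.id_comp ψ, ← CategoryTheory.Functor.map_id, ← hsq,
      Functor.map_sum, Preadditive.sum_comp, Preadditive.sum_comp]
    refine Finset.sum_congr rfl fun j _ => ?_
    rw [Functor.map_comp, Category.assoc, Category.assoc, ← hq j, ← conerveCurry_app,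
      ← conerveCurry_app, h]
  · intro ψ
    -- The preimage evaluates `ψ` on the sections corresponding to the maps `q j` and recombines the
    -- results along the maps `s j`.
    refine ⟨∑ j, (nerve (k := k) K).map (s j) ≫
      conerveHom (Psh.app ψ (b j) (Psh.app (q j) (b j) (yoMk (𝟙 _)))),
      Psh.hom_ext fun c z => conerveHom_ext ?_⟩
    have e : ∀ j, (nerve (k := k) K).map (Psh.el z) ≫ (nerve (k := k) K).map (s j) ≫
        conerveHom (Psh.app ψ (b j) (Psh.app (q j) (b j) (yoMk (𝟙 _)))) =
        conerveHom (Psh.app ψ c (Psh.app (s j ≫ q j) c z)) := fun j => by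
      have h₁ : Psh.el z ≫ s j = yo.map (yoHom (Psh.app (s j) c z)) := by
        rw [Psh.el_comp, ← yo_map_yoHom (Psh.el _), Psh.el_app_id]
      have h₂ : Psh.app (s j ≫ q j) c z = Q.res (yoHom (Psh.app (s j) c z))
          (Psh.app (q j) (b j) (yoMk (𝟙 _))) := by
        rw [← Psh.app_res, yo_res, Category.comp_id, yoMk_hom, Psh.app_comp]
      rw [← Functor.map_comp_assoc, h₁, h₂, Psh.app_res, conerveHom_res]
    rw [conerveCurry_app, Preadditive.comp_sum, Finset.sum_congr rfl fun j _ => e j,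
      ← conerveHom_sum, ← map_sum, ← Psh.app_sum, hsq, Psh.app_id]

theorem conerveCurry_add {Q : Psh k B} (φ ψ : (nerve (k := k) K).obj Q ⟶ W) :
    conerveCurry (φ + ψ) = conerveCurry φ + conerveCurry ψ :=
  Psh.hom_ext fun _ _ => conerveHom_ext (by
    rw [conerveCurry_app, Preadditive.comp_add]; rfl)

theorem conerveCurry_smul {Q : Psh k B} (c : k) (φ : (nerve (k := k) K).obj Q ⟶ W) :
    conerveCurry (c • φ) = c • conerveCurry φ :=
  Psh.hom_ext fun _ _ => conerveHom_ext (by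
    rw [conerveCurry_app, Linear.comp_smul]; rfl)

/-- The preimage of `W` is `conerve K W`, by `W(X) = Hom(yo X, W) = Hom(nerve (K X), W) = Hom(K X,
conerve W)`. The second equality uses that `K` is fully faithful, the third that `K X` is a summand
of a finite sum of representables. -/
theorem nerve_essSurj [K.Full] [K.Faithful]
    (hK' : ∀ X, FinRetract (yo (k := k)).obj (K.obj X)) : (nerve (k := k) K).EssSurj where
  mem_essImage W := by
    let φ : W ⟶ (nerve (k := k) K).obj (conerve K W) := Psh.ofComponents
      (fun X =>
        { toFun := fun w => nerveMk (conerveCurry (inv (yoNerve K X) ≫ Psh.el w))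
          map_add' := fun w w' => by
            rw [Psh.el_add, Preadditive.comp_add, conerveCurry_add]; rfl
          map_smul' := fun c w => by
            rw [Psh.el_smul, Linear.comp_smul, conerveCurry_smul]; rfl })
      (fun {X Y} f w => by
        change nerveMk (conerveCurry (inv (yoNerve K X) ≫ Psh.el _)) =
          nerveMk (K.map f ≫ conerveCurry (inv (yoNerve K Y) ≫ Psh.el w))
        rw [← conerveCurry_comp, ← Psh.yo_map_el, ← Category.assoc, ← Category.assoc]
        refine congrArg (fun t => nerveMk (conerveCurry (t ≫ _))) ?_
        rw [IsIso.eq_comp_inv, Category.assoc, yoNerve_naturality, IsIso.inv_hom_id_assoc])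
    have : IsIso φ := Psh.isIso_of_bijective φ fun X => by
      constructor
      · intro w w' h
        have h' := (conerveCurry_bijective (hK' X)).1 (congrArg nerveHom h)
        exact Psh.el_injective ((cancel_epi _).1 h')
      · intro g
        obtain ⟨ψ, hψ⟩ := (conerveCurry_bijective (hK' X)).2 (nerveHom g)
        refine ⟨Psh.app (yoNerve K X ≫ ψ) X (yoMk (𝟙 X)), ?_⟩
        change nerveMk (conerveCurry (inv (yoNerve K X) ≫ Psh.el _)) = _
        rw [Psh.el_eta, IsIso.inv_hom_id_assoc, hψ, nerveMk_hom]
    exact ⟨_, ⟨(asIso φ).symm⟩⟩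

/-- Generation makes the nerve fully faithful, and finite projectivity of the generators makes it
essentially surjective. -/
theorem nerve_isEquivalence [K.Full] [K.Faithful] (hK : ∀ b : B, FinRetract K.obj (yo.obj b))
    (hK' : ∀ X, FinRetract (yo (k := k)).obj (K.obj X)) : (nerve (k := k) K).IsEquivalence where
  faithful := nerve_faithful K hK
  full := nerve_full hK
  essSurj := nerve_essSurj hK'

end EssSurj

end Morita

/-! ### Morita theory with an action -/

section MoritaModule

variable {k : Type u} [Field k]
  {S : Type u} [Category.{u} S] [Preadditive S] [Linear k S] [SemigroupCategory k S]
  {B : Type u} [Category.{u} B] [Preadditive B] [Linear k B]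
  {M : Type u} [Category.{u} M] [Preadditive M] [Linear k M]
  {τ : SemigroupModule k (Psh k S) (Psh k B)} {σ : SemigroupModule k S M}
  (ι : ModuleFunctor σ τ.restrictYo)

namespace ModuleFunctor

/-- The functor `Q ↦ Hom(ι -, Q)`. -/
abbrev nv : Psh k B ⥤ Psh k M := nerve (k := k) ι.functor

/-- The coherence isomorphism of a module functor to a restricted module category. -/
def isoYo (F : S) (X : M) : ι.functor.obj ((σ.act.obj F).obj X) ≅
    (τ.act.obj (yo.obj F)).obj (ι.functor.obj X) := ι.iso F X

theorem isoYo_nat_left {F G : S} (f : F ⟶ G) (X : M) :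
    ι.functor.map ((σ.act.map f).app X) ≫ (ι.isoYo G X).hom =
      (ι.isoYo F X).hom ≫ (τ.act.map (yo.map f)).app (ι.functor.obj X) := ι.iso_nat_left f X

theorem isoYo_nat_right (F : S) {X Y : M} (h : X ⟶ Y) :
    ι.functor.map ((σ.act.obj F).map h) ≫ (ι.isoYo F Y).hom =
      (ι.isoYo F X).hom ≫ (τ.act.obj (yo.obj F)).map (ι.functor.map h) := ι.iso_nat_right F h

theorem isoYo_coherence (F G : S) (X : M) :
    ι.functor.map (σ.assoc F G X).hom ≫ (ι.isoYo F ((σ.act.obj G).obj X)).hom ≫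
        (τ.act.obj (yo.obj F)).map (ι.isoYo G X).hom =
      (ι.isoYo (((tensor k).obj F).obj G) X).hom ≫
        (τ.act.map (yoTensor F G).hom).app (ι.functor.obj X) ≫
          (τ.assoc (yo.obj F) (yo.obj G) (ι.functor.obj X)).hom := ι.coherence F G X

/-- The action of a section over `F` on an object in the image of `ι`. -/
def actEl {P : Psh k S} {F : S} (p : P.sec F) (Y : M) :
    ι.functor.obj ((σ.act.obj F).obj Y) ⟶ (τ.act.obj P).obj (ι.functor.obj Y) :=
  (ι.isoYo F Y).hom ≫ (τ.act.map (Psh.el p)).app (ι.functor.obj Y)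

theorem actEl_add {P : Psh k S} {F : S} (p p' : P.sec F) (Y : M) :
    ι.actEl (p + p') Y = ι.actEl p Y + ι.actEl p' Y := by
  rw [actEl, Psh.el_add, τ.bilinear.map_add_left, Preadditive.comp_add]; rfl

theorem actEl_smul {P : Psh k S} {F : S} (c : k) (p : P.sec F) (Y : M) :
    ι.actEl (c • p) Y = c • ι.actEl p Y := by
  rw [actEl, Psh.el_smul, τ.bilinear.map_smul_left, Linear.comp_smul]; rfl

theorem actEl_res {P : Psh k S} {F G : S} (f : F ⟶ G) (p : P.sec G) (Y : M) :
    ι.actEl (P.res f p) Y = ι.functor.map ((σ.act.map f).app Y) ≫ ι.actEl p Y := by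
  rw [actEl, ← Psh.yo_map_el, Functor.map_comp, NatTrans.comp_app, ← reassoc_of% ι.isoYo_nat_left]
  rfl

theorem actEl_naturality {P : Psh k S} {F : S} (p : P.sec F) {Y Y' : M} (f : Y ⟶ Y') :
    ι.functor.map ((σ.act.obj F).map f) ≫ ι.actEl p Y' =
      ι.actEl p Y ≫ (τ.act.obj P).map (ι.functor.map f) := by
  rw [actEl, actEl, reassoc_of% ι.isoYo_nat_right, NatTrans.naturality, Category.assoc]

theorem actEl_app {P P' : Psh k S} (φ : P ⟶ P') {F : S} (p : P.sec F) (Y : M) :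
    ι.actEl (Psh.app φ F p) Y = ι.actEl p Y ≫ (τ.act.map φ).app (ι.functor.obj Y) := by
  rw [actEl, ← Psh.el_comp, Functor.map_comp, NatTrans.comp_app, actEl, Category.assoc]

theorem actEl_yo (F : S) (Y : M) :
    ι.actEl (yoMk (𝟙 F)) Y = (ι.isoYo F Y).hom := by
  have e : Psh.el (yoMk (k := k) (𝟙 F)) = 𝟙 _ := by
    rw [← Psh.el_eta (𝟙 (yo.obj F)), Psh.app_id]
  rw [actEl, e, CategoryTheory.Functor.map_id, NatTrans.id_app, Category.comp_id]

/-- The comparison `P ⋆ Hom(ι -, Q) ⟶ Hom(ι -, P ⋆ Q)`. -/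
def nvMap (P : Psh k S) (Q : Psh k B) :
    dayObj σ.act P (ι.nv.obj Q) ⟶ ι.nv.obj ((τ.act.obj P).obj Q) :=
  descHom σ.act
    (fun X F Y f p q => nerveMk (ι.functor.map f ≫ ι.actEl p Y ≫ (τ.act.obj P).map (nerveHom q)))
    (fun X F Y f f' p q => by rw [Functor.map_add, Preadditive.add_comp]; rfl)
    (fun X F Y c f p q => by rw [Functor.map_smul, Linear.smul_comp]; rfl)
    (fun X F Y f p p' q => by
      rw [actEl_add, Preadditive.add_comp, Preadditive.comp_add]; rfl)
    (fun X F Y c f p q => by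
      rw [actEl_smul, Linear.smul_comp, Linear.comp_smul]; rfl)
    (fun X F Y f p q q' => by
      rw [nerveHom_add, τ.bilinear.map_add_right, Preadditive.comp_add, Preadditive.comp_add]; rfl)
    (fun X F Y c f p q => by
      rw [nerveHom_smul, τ.bilinear.map_smul_right, Linear.comp_smul, Linear.comp_smul]; rfl)
    (fun X F F' Y α f p q => by
      rw [Functor.map_comp, Category.assoc, actEl_res, Category.assoc])
    (fun X F Y Y' β f p q => by
      rw [Functor.map_comp, Category.assoc, nerveHom_res, Functor.map_comp,
        reassoc_of% (ι.actEl_naturality p β)])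
    (fun X Y F Z h f p q => by
      rw [nerve_res, Functor.map_comp, Category.assoc])

theorem nvMap_gen {P : Psh k S} {Q : Psh k B} {X : M} {F : S} {Y : M}
    (f : X ⟶ (σ.act.obj F).obj Y) (p : P.sec F) (q : ι.functor.obj Y ⟶ Q) :
    Psh.app (ι.nvMap P Q) X (gen σ.act f p (nerveMk q)) =
      nerveMk (ι.functor.map f ≫ ι.actEl p Y ≫ (τ.act.obj P).map q) := by
  unfold nvMap
  rw [descHom_gen]; rfl

theorem nvMap_nat_left {P P' : Psh k S} (φ : P ⟶ P') (Q : Psh k B) :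
    dayMap σ.act φ (𝟙 (ι.nv.obj Q)) ≫ ι.nvMap P' Q =
      ι.nvMap P Q ≫ ι.nv.map ((τ.act.map φ).app Q) :=
  dayObj_hom_ext _ fun X F Y f p q => by
    obtain ⟨q, rfl⟩ : ∃ g, nerveMk g = q := ⟨nerveHom q, nerveMk_hom q⟩
    rw [Psh.app_comp, Psh.app_comp, dayMap_gen, Psh.app_id, nvMap_gen, nvMap_gen, nerve_app,
      actEl_app]
    simp only [Category.assoc, NatTrans.naturality]

theorem nvMap_nat_right (P : Psh k S) {Q Q' : Psh k B} (φ : Q ⟶ Q') :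
    dayMap σ.act (𝟙 P) (ι.nv.map φ) ≫ ι.nvMap P Q' =
      ι.nvMap P Q ≫ ι.nv.map ((τ.act.obj P).map φ) :=
  dayObj_hom_ext _ fun X F Y f p q => by
    obtain ⟨q, rfl⟩ : ∃ g, nerveMk g = q := ⟨nerveHom q, nerveMk_hom q⟩
    rw [Psh.app_comp, Psh.app_comp, dayMap_gen, Psh.app_id, nerve_app, nvMap_gen, nvMap_gen,
      nerve_app, Functor.map_comp]
    simp only [Category.assoc]

/-- The key to compatibility of `nvMap` with the associators. Under Yoneda, the section of `P ⊛ P'`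
generated by `g`, `p` and `p'` factors through `yo (F ⊠ G)`, where the coherence of `ι` applies. -/
theorem actEl_gen {P P' : Psh k S} {L F G : S} (g : L ⟶ ((tensor k).obj F).obj G) (p : P.sec F)
    (p' : P'.sec G) (Y : M) :
    ι.actEl (P := ((tensor k).obj P).obj P') (gen (tensor k) g p p') Y ≫
        (τ.assoc P P' (ι.functor.obj Y)).hom =
      ι.functor.map ((σ.act.map g).app Y ≫ (σ.assoc F G Y).hom) ≫ ι.actEl p _ ≫
        (τ.act.obj P).map (ι.actEl p' Y) := by
  have h₀ : Psh.el (P := ((tensor k).obj P).obj P') (gen (tensor k) g p p') =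
      yo.map g ≫ (yoTensor F G).hom ≫ ((tensor k).map (Psh.el p)).app (yo.obj G) ≫
        ((tensor k).obj P).map (Psh.el p') := Psh.yo_hom_ext (by
    refine (Psh.el_app_id _).trans ?_
    rw [Psh.app_comp, Psh.app_comp, Psh.app_comp, yo_app, Category.id_comp]
    change _ = Psh.app (dayMap (tensor k) (𝟙 P) (Psh.el p')) L (Psh.app (dayMap (tensor k)
      (Psh.el p) (𝟙 (yo.obj G))) L (Psh.app (yoToDay (tensor k) F G) L (yoMk g)))
    rw [yoToDay_app, dayMap_gen, dayMap_gen, Psh.app_id, Psh.app_id, Psh.el_app_id, Psh.el_app_id])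
  change ((ι.isoYo L Y).hom ≫ (τ.act.map (Psh.el (P := ((tensor k).obj P).obj P')
    (gen (tensor k) g p p'))).app (ι.functor.obj Y)) ≫ _ = _
  rw [h₀]
  simp only [Functor.map_comp, NatTrans.comp_app, Category.assoc, τ.assoc_nat₂,
    reassoc_of% τ.assoc_nat₁]
  rw [← reassoc_of% ι.isoYo_nat_left, ← reassoc_of% ι.isoYo_coherence]
  simp only [actEl, Functor.map_comp, Category.assoc, NatTrans.naturality_assoc]

theorem nvMap_assoc (P P' : Psh k S) (Q : Psh k B) :
    (dayAssoc σ P P' (ι.nv.obj Q)).hom ≫ dayMap σ.act (𝟙 P) (ι.nvMap P' Q) ≫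
        ι.nvMap P ((τ.act.obj P').obj Q) =
      ι.nvMap (((tensor k).obj P).obj P') Q ≫ ι.nv.map (τ.assoc P P' Q).hom :=
  dayObj_hom_ext₂ _ _ fun X L Z f F G g p p' q => by
    obtain ⟨q, rfl⟩ : ∃ g, nerveMk g = q := ⟨nerveHom q, nerveMk_hom q⟩
    simp only [Psh.app_comp]
    have e₁ : Psh.app (dayAssoc σ P P' (ι.nv.obj Q)).hom X
        (gen σ.act f (gen (tensor k) g p p') (nerveMk q)) = _ := assocHom_gen σ _ _ _ _ _ _ _ _
    have e₂ : Psh.app (ι.nvMap (((tensor k).obj P).obj P') Q) X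
        (gen σ.act f (gen (tensor k) g p p') (nerveMk q)) = _ :=
      ι.nvMap_gen (P := ((tensor k).obj P).obj P') f (gen (tensor k) g p p') q
    refine (congrArg _ (congrArg _ e₁)).trans
      (Eq.trans ?_ ((Psh.app_comp _ _ _ _).trans (congrArg _ e₂)).symm)
    rw [dayMap_gen, nvMap_gen, Psh.app_id, nvMap_gen, nerve_app]
    refine congrArg (nerveMk (k := k)) ?_
    have e₃ := ι.actEl_gen g p p' Z
    rw [Category.assoc, Category.assoc, τ.assoc_nat₃, reassoc_of% e₃]
    simp only [CategoryTheory.Functor.map_id, Category.id_comp, Functor.map_comp, Category.assoc]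

section Iso

variable [ι.functor.Full] [ι.functor.Faithful]

/-- Up to Yoneda isomorphisms, which use that `ι` is fully faithful, the comparison is the nerve of
the coherence isomorphism of `ι`. -/
theorem isIso_nvMap_yo (F : S) (Y : M) : IsIso (ι.nvMap (yo.obj F) (ι.functor.obj Y)) := by
  let a : (yo (k := k)).obj ((σ.act.obj F).obj Y) ≅
      dayObj σ.act (yo.obj F) (ι.nv.obj (ι.functor.obj Y)) :=
    yoDay σ.bilinear F Y ≪≫
      ((day σ.act).obj (yo.obj F)).mapIso (asIso (yoNerve (k := k) ι.functor Y))
  have e : a.hom ≫ ι.nvMap (yo.obj F) (ι.functor.obj Y) =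
      yoNerve ι.functor ((σ.act.obj F).obj Y) ≫ ι.nv.map (ι.isoYo F Y).hom :=
    Psh.yo_hom_ext (by
      rw [Psh.app_comp, Psh.app_comp, yoNerve_app, nerve_app]
      change Psh.app (ι.nvMap _ _) _ (Psh.app (dayMap σ.act (𝟙 (yo.obj F)) (yoNerve ι.functor Y)) _
        (Psh.app (yoToDay σ.act F Y) _ (yoMk (𝟙 _)))) = _
      rw [yoToDay_app, dayMap_gen, Psh.app_id, yoNerve_app, nvMap_gen, actEl_yo]
      simp only [CategoryTheory.Functor.map_id, Category.comp_id])
  have : IsIso (a.hom ≫ ι.nvMap (yo.obj F) (ι.functor.obj Y)) := by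
    rw [e]; infer_instance
  exact IsIso.of_isIso_comp_left a.hom _

/-- `nvMap` as a natural transformation in the second variable. -/
def nvMapRight (P : Psh k S) : ι.nv ⋙ (day σ.act).obj P ⟶ τ.act.obj P ⋙ ι.nv where
  app Q := ι.nvMap P Q
  naturality _ _ φ := ι.nvMap_nat_right P φ

/-- `nvMap` as a natural transformation in the first variable. -/
def nvMapLeft (Q : Psh k B) : (day σ.act).flip.obj (ι.nv.obj Q) ⟶ τ.act.flip.obj Q ⋙ ι.nv where
  app P := ι.nvMap P Q
  naturality _ _ φ := ι.nvMap_nat_left φ Q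

/-- Both sides are cocontinuous in `P` and in `Q`, because the nerve is an equivalence. This reduces
to `P = yo F` and `Q = yo b`, and additivity in `Q` reduces further to objects in the image of `ι`.
-/
theorem isIso_nvMap (hτ : τ.Cocontinuous) (hι : ∀ b : B, FinRetract ι.functor.obj (yo.obj b))
    (hι' : ∀ X, FinRetract (yo (k := k)).obj (ι.functor.obj X)) (P : Psh k S) (Q : Psh k B) :
    IsIso (ι.nvMap P Q) := by
  have hE : ι.nv.IsEquivalence := nerve_isEquivalence hι hι'
  have hc := fun P => hτ.1 P
  have hc' := hτ.2 Q
  have hd : ∀ P, Limits.PreservesColimitsOfSize.{u, u} ((day σ.act).obj P) :=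
    σ.psh_cocontinuous.1
  have hd' : Limits.PreservesColimitsOfSize.{u, u} ((day σ.act).flip.obj (ι.nv.obj Q)) :=
    σ.psh_cocontinuous.2 (ι.nv.obj Q)
  refine isIso_app_of_isIso_yo (ι.nvMapLeft Q) (fun F => ?_) P
  refine isIso_app_of_isIso_yo (ι.nvMapRight (yo.obj F)) (fun b => ?_) Q
  have := τ.bilinear.additive (yo.obj F)
  exact isIso_app_of_finRetract (hι b) (ι.nvMapRight (yo.obj F)) (ι.isIso_nvMap_yo F)

/-- A cocontinuous module category is determined by a full module subcategory of finitely
generated projective objects that generates it. -/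
theorem nonempty_moduleEquiv_psh (hτ : τ.Cocontinuous)
    (hι : ∀ b : B, FinRetract ι.functor.obj (yo.obj b))
    (hι' : ∀ X, FinRetract (yo (k := k)).obj (ι.functor.obj X)) :
    Nonempty (ModuleEquiv τ σ.psh) := by
  have : ∀ P Q, IsIso (X := (σ.psh.act.obj P).obj (ι.nv.obj Q))
    (Y := ι.nv.obj ((τ.act.obj P).obj Q)) (ι.nvMap P Q) := ι.isIso_nvMap hτ hι hι'
  exact ⟨(ModuleFunctor.ofInv (σ := τ) (τ := σ.psh) ι.nv (fun P Q => ι.nvMap P Q)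
    (fun φ Q => ι.nvMap_nat_left φ Q) (fun P _ _ φ => ι.nvMap_nat_right P φ)
    (fun P P' Q => ι.nvMap_assoc P P' Q)).toModuleEquiv (nerve_isEquivalence hι hι')⟩

end Iso

end ModuleFunctor

end MoritaModule

/-! ### Finitely generated projectives: invariance, Cauchy completion, small model -/

section FgProj

variable {k : Type u} [Field k]
  {A : Type u} [Category.{u} A] [Preadditive A] [Linear k A]
  {B : Type u} [Category.{u} B] [Preadditive B] [Linear k B]

theorem Psh.liftsFinitely_iff_fgProj {Q : Psh k A} :
    LiftsFinitely.{u + 1, u, u} Q ↔ fgProj (Psh k A) Q :=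
  ⟨LiftsFinitely.fgProj, fun h => Psh.liftsFinitely_of_finRetract (Psh.finRetract_of_fgProj h)⟩

theorem fgProj_yo (a : A) : fgProj (Psh k A) (yo.obj a) :=
  Psh.fgProj_iff_finRetract.2 (FinRetract.of_iso a (Iso.refl _))

theorem fgProj_of_retract {Q Q' : Psh k A} (h : fgProj (Psh k A) Q) (s : Q' ⟶ Q) (r : Q ⟶ Q')
    (hsr : s ≫ r = 𝟙 Q') : fgProj (Psh k A) Q' :=
  Psh.fgProj_iff_finRetract.2 ((FinRetract.of_retract (K := fun _ : Unit => Q) () s r hsr).trans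
    fun _ => Psh.finRetract_of_fgProj h)

theorem fgProj_of_iso {Q Q' : Psh k A} (h : fgProj (Psh k A) Q) (e : Q' ≅ Q) :
    fgProj (Psh k A) Q' :=
  fgProj_of_retract h e.hom e.inv e.hom_inv_id

/-- The right adjoint of an equivalence is also a left adjoint, so it preserves jointly epimorphic
families. -/
theorem fgProj_map (L : Psh k A ⥤ Psh k B) [L.Additive] [L.IsEquivalence] {Q : Psh k A}
    (h : fgProj (Psh k A) Q) : fgProj (Psh k B) (L.obj Q) :=
  have : L.asEquivalence.functor.Additive := inferInstanceAs L.Additive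
  Psh.liftsFinitely_iff_fgProj.1 (LiftsFinitely.map L.asEquivalence.toAdjunction
    (fun hf => hf.map_of_isLeftAdjoint L.asEquivalence.symm.toAdjunction)
    (Psh.liftsFinitely_iff_fgProj.2 h))

theorem fgProj_of_map (L : Psh k A ⥤ Psh k B) [L.Additive] [L.IsEquivalence] {Q : Psh k A}
    (h : fgProj (Psh k B) (L.obj Q)) : fgProj (Psh k A) Q :=
  have : L.asEquivalence.functor.Additive := inferInstanceAs L.Additive
  have : L.inv.Additive := L.asEquivalence.inverse_additive
  fgProj_of_iso (fgProj_map L.inv h) (L.asEquivalence.unitIso.app Q)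

/-- An idempotent is split by its coequalizer with the identity. Passing to the opposite category
presents this coequalizer as an equalizer. -/
instance : IsIdempotentComplete (Psh k A) := by
  rw [← Idempotents.isIdempotentComplete_iff_opposite,
    Idempotents.isIdempotentComplete_iff_hasEqualizer_of_id_and_idempotent]
  intro X p _
  infer_instance

section CauchyComplete

variable {D : Type v₁} [Category.{w₁} D] [Preadditive D] (K : D ⥤ Psh k A) [K.Full] [K.Faithful]
  [K.Additive]

open Limits in
/-- A category equivalent to the category of finitely generated projective presheaves is Cauchy
complete. -/
theorem cauchyComplete_of_fgProj (hK : ∀ d, fgProj (Psh k A) (K.obj d))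
    (hK' : ∀ Q, fgProj (Psh k A) Q → ∃ d, Nonempty (K.obj d ≅ Q)) : CauchyComplete D := by
  have : HasFiniteBiproducts (Psh k A) := HasFiniteBiproducts.of_hasFiniteCoproducts
  refine ⟨⟨fun n => ⟨fun f => ?_⟩⟩, ⟨fun X p hp => ?_⟩⟩
  -- The biproduct formed among presheaves is again finitely generated projective, hence lies in the
  -- essential image of `K`, and its structure maps are pulled back along `K`.
  · have h : fgProj (Psh k A) (⨁ fun j => K.obj (f j)) :=
      Psh.fgProj_iff_finRetract.2 (FinRetract.trans (K := fun j => K.obj (f j))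
        ⟨n, id, fun j => biproduct.π (fun j => K.obj (f j)) j,
          fun j => biproduct.ι (fun j => K.obj (f j)) j, biproduct.total⟩
        fun j => Psh.finRetract_of_fgProj (hK (f j)))
    obtain ⟨d, ⟨e⟩⟩ := hK' _ h
    let b : Bicone f :=
      { pt := d
        π := fun j => K.preimage (e.hom ≫ biproduct.π _ j)
        ι := fun j => K.preimage (biproduct.ι (fun j => K.obj (f j)) j ≫ e.inv)
        ι_π := fun i j => K.map_injective (by
          simp only [Functor.map_comp, Functor.map_preimage, Category.assoc, Iso.inv_hom_id_assoc]
          rw [biproduct.ι_π]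
          split_ifs with h
          · subst h; simp
          · simp) }
    refine HasBiproduct.mk ⟨b, isBilimitOfTotal b (K.map_injective ?_)⟩
    simp only [b, Functor.map_sum, Functor.map_comp, Functor.map_preimage, Category.assoc]
    have := biproduct.total (f := fun j => K.obj (f j))
    calc _ = e.hom ≫ (∑ j, biproduct.π (fun j => K.obj (f j)) j ≫
          biproduct.ι (fun j => K.obj (f j)) j) ≫ e.inv := by
          simp only [Preadditive.comp_sum, Preadditive.sum_comp, Category.assoc]
      _ = _ := by rw [this, Category.id_comp, e.hom_inv_id, CategoryTheory.Functor.map_id]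
  · obtain ⟨Y, i, e, h₁, h₂⟩ := IsIdempotentComplete.idempotents_split (K.obj X) (K.map p)
      (by rw [← Functor.map_comp, hp])
    obtain ⟨d, ⟨f⟩⟩ := hK' Y (fgProj_of_retract (hK X) i e h₁)
    refine ⟨d, K.preimage (f.hom ≫ i), K.preimage (e ≫ f.inv), K.map_injective ?_,
      K.map_injective ?_⟩
    · simp only [Functor.map_comp, Functor.map_preimage, Category.assoc, reassoc_of% h₁,
        f.hom_inv_id, CategoryTheory.Functor.map_id]
    · simp only [Functor.map_comp, Functor.map_preimage, Category.assoc, f.inv_hom_id_assoc, h₂]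

end CauchyComplete

/-- Over a Cauchy complete category, the finitely generated projective presheaves are
representable. -/
theorem exists_yo_iso (hA : CauchyComplete A) {Q : Psh k A} (hQ : fgProj (Psh k A) Q) :
    ∃ a, Nonempty ((yo (k := k)).obj a ≅ Q) := by
  obtain ⟨n, X, s, q, hsq⟩ := Psh.finRetract_of_fgProj hQ
  have := hA.1
  have := hA.2
  -- Biproducts in `A` turn the finite family into one object, so that `Q` is a retract of the
  -- single representable `yo Y`.
  let Y : A := ⨁ X
  let s' : Q ⟶ yo.obj Y := ∑ j, s j ≫ yo.map (Limits.biproduct.ι X j)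
  let q' : (yo (k := k)).obj Y ⟶ Q := ∑ j, yo.map (Limits.biproduct.π X j) ≫ q j
  have h : s' ≫ q' = 𝟙 Q := by
    have e : ∀ j, (yo (k := k)).map (Limits.biproduct.ι X j) ≫ q' = q j := fun j => by
      have hj : ∀ i, (yo (k := k)).map (Limits.biproduct.ι X j) ≫
          yo.map (Limits.biproduct.π X i) ≫ q i = if i = j then q j else 0 := fun i => by
        rw [← Functor.map_comp_assoc, Limits.biproduct.ι_π]
        split_ifs with h₁ h₂ h₂
        · subst h₁; simp
        · exact absurd h₁.symm h₂
        · exact absurd h₂.symm h₁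
        · rw [Functor.map_zero, Limits.zero_comp]
      rw [Preadditive.comp_sum, Finset.sum_congr rfl fun i _ => hj i, Finset.sum_ite_eq']
      simp
    rw [Preadditive.sum_comp, ← hsq]
    exact Finset.sum_congr rfl fun j _ => by rw [Category.assoc, e]
  -- The idempotent of `yo Y` with image `Q` comes from an idempotent of `Y`, whose splitting in `A`
  -- represents `Q`.
  obtain ⟨p, hp⟩ := (yo (k := k)).map_surjective (q' ≫ s')
  obtain ⟨a, i, e, h₁, h₂⟩ := IsIdempotentComplete.idempotents_split Y p
    ((yo (k := k)).map_injective (by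
      rw [Functor.map_comp, hp, Category.assoc, reassoc_of% h]))
  have h₃ : (yo (k := k)).map i ≫ yo.map e = 𝟙 _ := by
    rw [← Functor.map_comp, h₁, CategoryTheory.Functor.map_id]
  have h₄ : (yo (k := k)).map e ≫ yo.map i = q' ≫ s' := by rw [← Functor.map_comp, h₂, hp]
  refine ⟨a, ⟨⟨yo.map i ≫ q', s' ≫ yo.map e, ?_, ?_⟩⟩⟩
  · rw [Category.assoc, ← reassoc_of% h₄, h₃, Category.comp_id, h₃]
  · rw [Category.assoc, reassoc_of% h₄, h, Category.comp_id, h]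

section SmallModel

variable (k A)

/-- The data of an idempotent matrix of morphisms. -/
abbrev MatrixData : Type u := Σ (n : ℕ) (a : Fin n → A), ∀ i j : Fin n, a i ⟶ a j

variable {k A}

/-- The presheaf `Q` is the image of the matrix `x`. -/
def IsImage (x : MatrixData A) (Q : Psh k A) : Prop :=
  ∃ (s : ∀ j, Q ⟶ yo.obj (x.2.1 j)) (q : ∀ j, yo.obj (x.2.1 j) ⟶ Q),
    ∑ j, s j ≫ q j = 𝟙 Q ∧ ∀ i j, q i ≫ s j = yo.map (x.2.2 i j)

/-- The comparison maps go into the common sum of representables by one decomposition and out of it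
by the other. Since both decompositions have the same matrix, the composites are identities. -/
theorem IsImage.nonempty_iso {x : MatrixData A} {Q Q' : Psh k A} (h : IsImage x Q)
    (h' : IsImage x Q') : Nonempty (Q ≅ Q') := by
  obtain ⟨s, q, h₁, h₂⟩ := h
  obtain ⟨s', q', h₁', h₂'⟩ := h'
  have key : ∀ {P P' : Psh k A} (s : ∀ j, P ⟶ yo.obj (x.2.1 j)) (q : ∀ j, yo.obj (x.2.1 j) ⟶ P)
      (s' : ∀ j, P' ⟶ yo.obj (x.2.1 j)) (q' : ∀ j, yo.obj (x.2.1 j) ⟶ P'),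
      ∑ j, s j ≫ q j = 𝟙 P → (∀ i j, q i ≫ s j = yo.map (x.2.2 i j)) →
      (∀ i j, q' i ≫ s' j = yo.map (x.2.2 i j)) →
      (∑ j, s j ≫ q' j) ≫ (∑ j, s' j ≫ q j) = 𝟙 P := fun {P P'} s q s' q' h₁ h₂ h₂' => by
    calc _ = ∑ i, s i ≫ (∑ j, (q' i ≫ s' j) ≫ q j) := by
          simp only [Preadditive.sum_comp, Preadditive.comp_sum, Category.assoc]
          exact Finset.sum_comm
      _ = ∑ i, s i ≫ (∑ j, (q i ≫ s j) ≫ q j) := by simp only [h₂, h₂']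
      _ = (∑ i, s i ≫ q i) ≫ (∑ j, s j ≫ q j) := by
          simp only [Preadditive.sum_comp, Preadditive.comp_sum, Category.assoc]
          exact Finset.sum_comm
      _ = _ := by rw [h₁, Category.id_comp]
  exact ⟨⟨∑ j, s j ≫ q' j, ∑ j, s' j ≫ q j, key s q s' q' h₁ h₂ h₂', key s' q' s q h₁' h₂' h₂⟩⟩

/-- Yoneda turns the idempotent of a decomposition into a matrix of morphisms of `A`. Matrices form
a type in universe `u`, which bounds the isomorphism classes of finitely generated projectives. -/
theorem exists_isImage {Q : Psh k A} (h : fgProj (Psh k A) Q) : ∃ x : MatrixData A, IsImage x Q := by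
  obtain ⟨n, X, s, q, hsq⟩ := Psh.finRetract_of_fgProj h
  choose m hm using fun i j => (yo (k := k)).map_surjective (q i ≫ s j)
  exact ⟨⟨n, X, m⟩, s, q, hsq, fun i j => (hm i j).symm⟩

theorem IsImage.fgProj {x : MatrixData A} {Q : Psh k A} (h : IsImage x Q) : fgProj (Psh k A) Q := by
  obtain ⟨s, q, h, -⟩ := h
  exact Psh.fgProj_iff_finRetract.2 ⟨x.1, x.2.1, s, q, h⟩

variable (k A)

/-- The objects of a small category equivalent to the category of finitely generated projective
presheaves. -/
abbrev FgProjIndex : Type u := {x : MatrixData A // ∃ Q : Psh k A, IsImage x Q}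

variable {k A}

/-- The presheaf of an index. -/
def fgProjObj (x : FgProjIndex k A) : Psh k A := x.2.choose

variable (k A)

/-- A small category equivalent to the category of finitely generated projective presheaves. -/
abbrev SmallFgProj : Type u := InducedCategory (Psh k A) (fgProjObj (k := k) (A := A))

/-- The embedding of the small model of the finitely generated projective presheaves. -/
abbrev smallIncl : SmallFgProj k A ⥤ Psh k A := inducedFunctor fgProjObj

variable {k A}

theorem fgProj_smallIncl (d : SmallFgProj k A) : fgProj (Psh k A) ((smallIncl k A).obj d) :=
  (show FgProjIndex k A from d).2.choose_spec.fgProj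

theorem exists_smallIncl_iso {Q : Psh k A} (h : fgProj (Psh k A) Q) :
    ∃ d, Nonempty ((smallIncl k A).obj d ≅ Q) := by
  obtain ⟨x, hx⟩ := exists_isImage h
  exact ⟨(⟨x, Q, hx⟩ : FgProjIndex k A),
    (⟨Q, hx⟩ : ∃ Q : Psh k A, IsImage x Q).choose_spec.nonempty_iso hx⟩

end SmallModel

end FgProj

/-! ### Passing between module categories and module presheaf categories -/

section Correspondence

variable {k : Type u} [Field k]
  {S : Type u} [Category.{u} S] [Preadditive S] [Linear k S] [SemigroupCategory k S]
  {U : UnitStr k (Psh k S)}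

namespace PshModuleCat

variable {N N' : PshModuleCat k S}

/-- The given unit structure is exchanged for the explicit one on `unitPsh`. -/
theorem IsAdmissible.exists_unitor (hN : N.IsAdmissible U) (hS : IsRigid k S) :
    Nonempty (SemigroupModule.Unitor N.str) :=
  SemigroupModule.IsMonoidal.unitor hS (hN.monoidal.of_unitStr (unitStr hS))

/-- The right adjoint of `F ⋆ -` is the action of the dual, which has a right adjoint itself, namely
the action of the double dual. It therefore preserves jointly epimorphic families, and `F ⋆ -`
preserves finite lifting. -/
theorem IsAdmissible.fgProjStable (hN : N.IsAdmissible U) (hS : IsRigid k S) :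
    N.FgProjStable := fun F Q hQ => by
  obtain ⟨l⟩ := hN.exists_unitor hS
  have := N.str.restrictYo.bilinear.additive F
  exact Psh.liftsFinitely_iff_fgProj.1 (LiftsFinitely.map
    (l.respectedAdj hN.cocontinuous (hS.adj F)).adj
    (fun hf => hf.map_of_isLeftAdjoint
      (l.respectedAdj hN.cocontinuous (hS.adj (hS.dual F))).adj)
    (Psh.liftsFinitely_iff_fgProj.2 hQ))

/-- The embedding of the finitely generated projective objects. -/
def fgProjInclusion (h : N.FgProjStable) : ModuleFunctor (N.fgProjModule h) N.str.restrictYo :=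
  fullInclusion N.str.restrictYo _ h

/-- A recognition principle, applied below to the Yoneda embedding, to small models, and to
equivalences restricted to finitely generated projectives. -/
theorem nonempty_fgProjModule_equiv (h : N.FgProjStable) {M : Type v₁} [Category.{w₁} M]
    [Preadditive M] [Linear k M] {σ : SemigroupModule k S M}
    (ι : ModuleFunctor σ N.str.restrictYo) [ι.functor.Full] [ι.functor.Faithful]
    (hι : ∀ X, fgProj (Psh k N.base) (ι.functor.obj X))
    (hι' : ∀ Q, fgProj (Psh k N.base) Q → ∃ X, Nonempty (ι.functor.obj X ≅ Q)) :
    Nonempty (ModuleEquiv σ (N.fgProjModule h)) := by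
  refine ⟨(ι.lift (fgProj (Psh k N.base)) h hι).toModuleEquiv ?_⟩
  have h₁ : ((fgProj (Psh k N.base)).lift ι.functor hι).EssSurj := ⟨fun Q => by
    obtain ⟨X, ⟨e⟩⟩ := hι' Q.obj Q.property
    exact ⟨X, ⟨ObjectProperty.isoMk _ e⟩⟩⟩
  have h₂ : ((fgProj (Psh k N.base)).lift ι.functor hι).Full := inferInstance
  have h₃ : ((fgProj (Psh k N.base)).lift ι.functor hι).Faithful := inferInstance
  exact { faithful := h₃, full := h₂, essSurj := h₁ }

/-- An equivalence preserves and reflects finitely generated projective objects. -/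
theorem nonempty_fgProjModule_congr (h : N.FgProjStable) (h' : N'.FgProjStable)
    (e : ModuleEquiv N.str N'.str) :
    Nonempty (ModuleEquiv (N.fgProjModule h) (N'.fgProjModule h')) := by
  have : e.functor.IsEquivalence := e.isEquivalence
  have : e.functor.Additive := ⟨e.map_add _ _⟩
  let ι := (fgProjInclusion h).comp e.toModuleFunctor.restrictYo
  have : ι.functor.Full := inferInstanceAs ((fgProj (Psh k N.base)).ι ⋙ e.functor).Full
  have : ι.functor.Faithful := inferInstanceAs ((fgProj (Psh k N.base)).ι ⋙ e.functor).Faithful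
  refine nonempty_fgProjModule_equiv h' ι (fun X => fgProj_map e.functor X.property)
    fun Q hQ => ?_
  let f : e.functor.obj (e.functor.objPreimage Q) ≅ Q := e.functor.objObjPreimageIso Q
  exact ⟨⟨_, fgProj_of_map e.functor (fgProj_of_iso hQ f)⟩, ⟨f⟩⟩

/-- Representables are finitely generated projective, so the finitely generated projectives
generate, and the Morita equivalence compatible with the action applies to any small category
equivalent to them. -/
theorem nonempty_equiv_psh (hN : N.str.Cocontinuous) (h : N.FgProjStable) {M : SModuleCat k S}
    (e : ModuleEquiv M.str (N.fgProjModule h)) : Nonempty (ModuleEquiv N.str M.psh.str) := by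
  have : e.functor.IsEquivalence := e.isEquivalence
  let ι := e.toModuleFunctor.comp (fgProjInclusion h)
  have : ι.functor.Full := inferInstanceAs (e.functor ⋙ (fgProj (Psh k N.base)).ι).Full
  have : ι.functor.Faithful := inferInstanceAs (e.functor ⋙ (fgProj (Psh k N.base)).ι).Faithful
  refine ι.nonempty_moduleEquiv_psh hN (fun b => ?_)
    fun X => Psh.finRetract_of_fgProj (e.functor.obj X).property
  let f := e.functor.objObjPreimageIso ⟨yo.obj b, fgProj_yo b⟩
  exact FinRetract.of_iso (e.functor.objPreimage ⟨yo.obj b, fgProj_yo b⟩)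
    ((fgProj (Psh k N.base)).ι.mapIso f.symm)

end PshModuleCat

namespace SModuleCat

theorem IsAdmissible.psh {M : SModuleCat k S} (hM : M.IsAdmissible) (hS : IsRigid k S) :
    M.psh.IsAdmissible U := by
  have h := isMonoidal_psh hS hM.generated hM.respects
  obtain ⟨l⟩ := SemigroupModule.IsMonoidal.unitor hS h
  exact ⟨M.str.psh_cocontinuous, h.of_unitStr U, l.counitsEpi hS M.str.psh_cocontinuous⟩

/-- The Yoneda embedding. -/
def yoFunctor (M : SModuleCat k S) : ModuleFunctor M.str M.psh.str.restrictYo := yoModule M.str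

/-- Cauchy completeness makes every finitely generated projective presheaf representable, so the
Yoneda embedding is essentially surjective onto these. -/
theorem IsAdmissible.nonempty_fgProjModule_equiv {M : SModuleCat k S} (hM : M.IsAdmissible)
    (h : M.psh.FgProjStable) : Nonempty (ModuleEquiv M.str (M.psh.fgProjModule h)) := by
  have : M.yoFunctor.functor.Full := inferInstanceAs (yo (k := k) (A := M.carrier)).Full
  have : M.yoFunctor.functor.Faithful := inferInstanceAs (yo (k := k) (A := M.carrier)).Faithful
  exact PshModuleCat.nonempty_fgProjModule_equiv h M.yoFunctor (fun X => fgProj_yo X)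
    fun Q hQ => exists_yo_iso hM.cauchyComplete hQ

end SModuleCat

/-- The objects of `N`-f.g.proj do not form a type in universe `u`, so the action is transported to
the category of idempotent matrices. The adjunctions are restricted from `N`, and generation comes
from splitting the counits. -/
theorem PshModuleCat.IsAdmissible.exists_small_model {N : PshModuleCat k S}
    (hN : N.IsAdmissible U) (hS : IsRigid k S) (h : N.FgProjStable) :
    ∃ M : SModuleCat k S, M.IsAdmissible ∧ Nonempty (ModuleEquiv M.str (N.fgProjModule h)) := by
  obtain ⟨l⟩ := hN.exists_unitor hS
  choose φ e using fun (F : S) (d : SmallFgProj k N.base) =>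
    exists_smallIncl_iso (h F _ (fgProj_smallIncl d))
  let e' := fun F d => (e F d).some
  let M : SModuleCat k S :=
    { carrier := SmallFgProj k N.base
      str := N.str.restrictYo.transport (smallIncl k N.base) φ e' }
  let ι : ModuleFunctor M.str N.str.restrictYo :=
    N.str.restrictYo.transportFunctor (smallIncl k N.base) φ e'
  have : ι.functor.Full := inferInstanceAs (smallIncl k N.base).Full
  have : ι.functor.Faithful := inferInstanceAs (smallIncl k N.base).Faithful
  have hι : ∀ X, fgProj (Psh k N.base) (ι.functor.obj X) := fgProj_smallIncl
  refine ⟨M, ⟨?_, ?_, ?_⟩, ?_⟩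
  · exact cauchyComplete_of_fgProj (smallIncl k N.base) fgProj_smallIncl
      fun Q hQ => exists_smallIncl_iso hQ
  · exact fun F F' d => ⟨ι.respectedAdj (l.isFaithful hN.cocontinuous)
      (l.respectedAdj hN.cocontinuous d)⟩
  · intro X
    obtain ⟨t, s, hs⟩ := Psh.liftsFinitely_of_finRetract (Psh.finRetract_of_fgProj (hι X)) _
      (hN.counitsEpi (ι.functor.obj X)) (𝟙 _)
    let f : ∀ i : N.str.restrictYo.RespectedPair, ι.functor.obj ((M.str.act.obj i.F).obj
        ((M.str.act.obj i.F').obj X)) ≅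
        (N.str.restrictYo.act.obj i.F).obj ((N.str.restrictYo.act.obj i.F').obj (ι.functor.obj X)) :=
      fun i => ι.iso _ _ ≪≫ (N.str.restrictYo.act.obj i.F).mapIso (ι.iso _ _)
    obtain ⟨n, Y, i, p, hip⟩ := FinRetract.of_finset
      (K := fun a : S × M.carrier => (M.str.act.obj a.1).obj a.2) (Q := X) t
      (fun i => (i.F, (M.str.act.obj i.F').obj X)) (fun i => ι.functor.preimage (s i ≫ (f i).inv))
      (fun i => ι.functor.preimage ((f i).hom ≫ i.respected.adj.counit.app _))
      (ι.functor.map_injective (by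
        simp only [Functor.map_sum, Functor.map_comp, Functor.map_preimage, Category.assoc,
          Iso.inv_hom_id_assoc]
        exact hs.trans (CategoryTheory.Functor.map_id _ _).symm))
    exact ⟨n, fun j => (Y j).1, fun j => (Y j).2, i, p, hip⟩
  · exact PshModuleCat.nonempty_fgProjModule_equiv h ι hι fun Q hQ => exists_smallIncl_iso hQ

end Correspondence

/-! ### The bijection of equivalence classes -/

section Correspondence

variable {k : Type u} [Field k]
  {S : Type u} [Category.{u} S] [Preadditive S] [Linear k S] [SemigroupCategory k S]

/-- The correspondence between Cauchy complete module categories over a rigid semigroup category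
and module presheaf categories. -/
theorem exists_correspondence (hS : IsRigid k S) (U : UnitStr k (Psh k S)) :
    ∃ e : Quotient (leftSetoid (k := k) (S := S)) ≃
        Quotient (rightSetoid U),
      (∀ M : {M : SModuleCat k S // M.IsAdmissible},
        ∃ h : M.1.psh.IsAdmissible U,
          e (Quotient.mk _ M) = Quotient.mk _ ⟨M.1.psh, h⟩) ∧
      (∀ N : {N : PshModuleCat k S // N.IsAdmissible U},
        ∃ h : N.1.FgProjStable, ∀ M : {M : SModuleCat k S // M.IsAdmissible},
          e.symm (Quotient.mk _ N) = Quotient.mk _ M ↔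
            Nonempty (ModuleEquiv M.1.str (N.1.fgProjModule h))) := by
  have psh_congr : ∀ M M' : {M : SModuleCat k S // M.IsAdmissible},
      Nonempty (ModuleEquiv M.1.str M'.1.str) →
        Nonempty (ModuleEquiv M.1.psh.str M'.1.psh.str) := fun M M' ⟨e⟩ => by
    -- Since `M` is equivalent to `M'`, and `M'` to the finitely generated projectives in its
    -- presheaves, `M` is also a small model of the latter. Morita theory then compares the presheaf
    -- categories.
    have hN : M'.1.psh.IsAdmissible U := M'.2.psh hS
    obtain ⟨e'⟩ := M'.2.nonempty_fgProjModule_equiv (hN.fgProjStable hS)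
    obtain ⟨e''⟩ := PshModuleCat.nonempty_equiv_psh hN.cocontinuous _ (e.comp e')
    exact ⟨e''.symm⟩
  have of_psh : ∀ M M' : {M : SModuleCat k S // M.IsAdmissible},
      Nonempty (ModuleEquiv M.1.psh.str M'.1.psh.str) →
        Nonempty (ModuleEquiv M.1.str M'.1.str) := fun M M' ⟨e⟩ => by
    have h : M.1.psh.IsAdmissible U := M.2.psh hS
    have h' : M'.1.psh.IsAdmissible U := M'.2.psh hS
    obtain ⟨e₁⟩ := M.2.nonempty_fgProjModule_equiv (h.fgProjStable hS)
    obtain ⟨e₂⟩ := M'.2.nonempty_fgProjModule_equiv (h'.fgProjStable hS)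
    obtain ⟨e₃⟩ := PshModuleCat.nonempty_fgProjModule_congr (h.fgProjStable hS)
      (h'.fgProjStable hS) e
    exact ⟨(e₁.comp e₃).comp e₂.symm⟩
  let f : Quotient (leftSetoid (k := k) (S := S)) → Quotient (rightSetoid U) :=
    Quotient.map (fun M => ⟨M.1.psh, M.2.psh hS⟩) psh_congr
  have hf : Function.Bijective f := by
    constructor
    · intro a b
      induction a using Quotient.inductionOn with | _ M
      induction b using Quotient.inductionOn with | _ M'
      intro h
      exact Quotient.sound (of_psh M M' (Quotient.exact h))
    · intro a
      induction a using Quotient.inductionOn with | _ N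
      -- Surjectivity: a small model of the finitely generated projectives of `N` has `N` as its
      -- presheaf category.
      obtain ⟨M, hM, ⟨e⟩⟩ := N.2.exists_small_model hS (N.2.fgProjStable hS)
      obtain ⟨e'⟩ := PshModuleCat.nonempty_equiv_psh N.2.cocontinuous _ e
      exact ⟨Quotient.mk _ ⟨M, hM⟩, Quotient.sound ⟨e'.symm⟩⟩
  refine ⟨Equiv.ofBijective f hf, fun M => ⟨M.2.psh hS, rfl⟩,
    fun N => ⟨N.2.fgProjStable hS, fun M => ?_⟩⟩
  have hM : M.1.psh.IsAdmissible U := M.2.psh hS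
  rw [Equiv.symm_apply_eq]
  -- The inverse sends the class of `N` to the class of `M` exactly when `N` is equivalent to the
  -- presheaves on `M`. Taking finitely generated projectives and taking presheaves translate this
  -- into the stated equivalence and back.
  refine Iff.trans (b := Nonempty (ModuleEquiv N.1.str M.1.psh.str))
    ⟨fun h => Quotient.exact h, fun h => Quotient.sound h⟩ ⟨fun ⟨e⟩ => ?_, fun ⟨e⟩ => ?_⟩
  · obtain ⟨e₁⟩ := M.2.nonempty_fgProjModule_equiv (hM.fgProjStable hS)
    obtain ⟨e₂⟩ := PshModuleCat.nonempty_fgProjModule_congr (N.2.fgProjStable hS)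
      (hM.fgProjStable hS) e
    exact ⟨e₁.comp e₂.symm⟩
  · exact PshModuleCat.nonempty_equiv_psh N.2.cocontinuous _ e

end Correspondence

end SemigroupCat

end

theorem theorem3p17 (k : Type u) [Field k] (S : Type u) [Category.{u} S] [Preadditive S]
    [Linear k S] [SemigroupCat.SemigroupCategory k S] (hS : SemigroupCat.IsRigid k S) :
    Nonempty (SemigroupCat.UnitStr k (SemigroupCat.Psh k S)) ∧
    ∀ U : SemigroupCat.UnitStr k (SemigroupCat.Psh k S),
      (∀ M : SemigroupCat.SModuleCat k S, M.str.Generated → M.str.RespectsAdjunctions →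
        M.psh.str.IsMonoidal U) ∧
      ∃ e : Quotient (SemigroupCat.leftSetoid (k := k) (S := S)) ≃
          Quotient (SemigroupCat.rightSetoid U),
        (∀ M : {M : SemigroupCat.SModuleCat k S // M.IsAdmissible},
          ∃ h : M.1.psh.IsAdmissible U,
            e (Quotient.mk _ M) = Quotient.mk _ ⟨M.1.psh, h⟩) ∧
        (∀ N : {N : SemigroupCat.PshModuleCat k S // N.IsAdmissible U},
          ∃ h : N.1.FgProjStable, ∀ M : {M : SemigroupCat.SModuleCat k S // M.IsAdmissible},
            e.symm (Quotient.mk _ N) = Quotient.mk _ M ↔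
              Nonempty (SemigroupCat.ModuleEquiv M.1.str (N.1.fgProjModule h))) := 
  ⟨⟨SemigroupCat.unitStr hS⟩, fun U =>
    ⟨fun _ hg hr => (SemigroupCat.isMonoidal_psh hS hg hr).of_unitStr U,
      SemigroupCat.exists_correspondence hS U⟩⟩
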